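/- Fix $q\in(0,1)$. A sensor with a unit-sized battery, empty at time $0$, harvests energy units that arrive according to a Poisson process of rate $1$, and sends status updates at attempt times $0\le x_1\le x_2\le\cdots$. Each attempt consumes one unit of energy and is erased with probability $q$, independently of the other attempts and of the energy arrivals; otherwise it is received instantaneously. After each attempt the sensor learns, instantaneously and without error, whether it was erased. A (feasible, online) policy is a sequence $\{x_n\}$ such that, almost surely, the battery contains a unit of energy at each attempt, where the energy available for attempt $n$ is $E_1=\min\{A_1,1\}$, $E_n=\min\{E_{n-1}-1+A_n,1\}$ for $n\ge2$, and $A_n$ is the number of energy arrivals in $(x_{n-1},x_n]$ (with $x_0=0$); and such that, for all $n$ and $t$, the event $\{x_n\le t\}$ is determined, up to null events, by the energy arrivals up to time $t$ and the erasure outcomes of attempts $1,\dots,n-1$. Let $y_0=0$ and let $y_j$ be the time of the $j$th successful (not erased) attempt; the $j$th epoch is $[y_{j-1},y_j]$ and has length $y_j-y_{j-1}$. The age of information starts from $0$ at time $0$, grows at unit rate and is reset to $0$ at each $y_j$; the area below it on $[0,t]$ is $$r(t)=\sum_{j=1}^{n(t)}\tfrac12(y_j-y_{j-1})^2+\tfrac12\bigl(t-y_{n(t)}\bigr)^2,\qquad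 n(t)=\max\{j: y_j<t\}.$$ A policy is uniformly bounded if there is one function $g$ such that, almost surely, the length of every epoch is at most the value of $g$ at the energy arrivals and the erasures as seen from the beginning of that epoch, and $g$, evaluated at the energy arrivals and erasures seen from time $0$, has a finite second moment. Then among all uniformly bounded policies the minimum of the long-term average age of information $$\limsup_{T\to\infty}\frac1T\,\mathbb E[r(T)]$$ is attained, and it is attained by a uniformly bounded policy that is a renewal policy: in each epoch the sensor ignores everything that happened before the epoch and repeats the same rule, which gives the attempt times relative to the beginning of the epoch as functions of the energy arrivals and erasures seen from the beginning of the epoch; the epoch lengths are positive, independent and identically distributed; and so the successful update times $\{y_j\}$ form a renewal process. -/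

import Mathlib

open MeasureTheory ProbabilityTheory Filter

noncomputable section

namespace StatusUpdate

variable {Ω : Type*} [MeasurableSpace Ω]

/-! ### The random environment -/

/-- The randomness of the system.  `gap k` is the time between the `k`-th and the `(k+1)`-st energy
arrival (`gap 0` is the time of the first one), so that unit energy quanta arrive according to a
Poisson process of rate one.  `erased n` is the indicator that the `n`-th transmission attempt is
erased; the erasures are i.i.d. with probability `q` and independent of the energy arrivals. -/
structure IsEnvironment (P : Measure Ω) (q : ℝ) (gap : ℕ → Ω → ℝ) (erased : ℕ → Ω → Bool) :
    Prop where
  measurable_gap : ∀ k, Measurable (gap k)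
  measurable_erased : ∀ n, Measurable (erased n)
  map_gap : ∀ k, P.map (gap k) = expMeasure 1
  prob_erased : ∀ n, P {ω | erased n ω = true} = ENNReal.ofReal q
  indep_gap : iIndepFun gap P
  indep_erased : iIndepFun erased P
  indep_gap_erased : IndepFun (fun ω k => gap k ω) (fun ω n => erased n ω) P

/-- The time of the `k`-th energy arrival, `k = 0, 1, 2, …`. -/
def arrivalTime (gap : ℕ → Ω → ℝ) (k : ℕ) (ω : Ω) : ℝ :=
  ∑ i ∈ Finset.range (k + 1), gap i ω

/-- The number of energy arrivals up to and including time `t`. -/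
def arrivalCount (gap : ℕ → Ω → ℝ) (t : ℝ) (ω : Ω) : ℕ :=
  {k : ℕ | arrivalTime gap k ω ≤ t}.ncard

/-- The amount of energy that arrives during `(s, t]`. -/
def harvested (gap : ℕ → Ω → ℝ) (s t : ℝ) (ω : Ω) : ℕ :=
  {k : ℕ | s < arrivalTime gap k ω ∧ arrivalTime gap k ω ≤ t}.ncard

/-- What the sensor may know at time `t` when it decides on attempt number `n`: the energy arrivals
up to time `t` and the outcomes (erased or not) of the attempts `0, …, n - 1`. -/
@[reducible] def information (gap : ℕ → Ω → ℝ) (erased : ℕ → Ω → Bool) (n : ℕ) (t : ℝ) : MeasurableSpace Ω :=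
  (⨆ (s : ℝ) (_ : s ≤ t), MeasurableSpace.comap (arrivalCount gap s) ⊤) ⊔
    (⨆ (i : ℕ) (_ : i < n), MeasurableSpace.comap (erased i) ⊤)

/-! ### Status update policies -/

/-- The energy in the unit-sized battery just before attempt `n`, when the battery is empty at time
`0` and each attempt takes one unit.  Energy that arrives at the instant of an attempt can be used
for that attempt. -/
def battery (gap : ℕ → Ω → ℝ) (x : ℕ → Ω → ℝ) : ℕ → Ω → ℤ
  | 0, ω => min (harvested gap 0 (x 0 ω) ω : ℤ) 1
  | n + 1, ω => min (battery gap x n ω - 1 + (harvested gap (x n ω) (x (n + 1) ω) ω : ℤ)) 1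

/-- Feasible online policies.  `x n` is the time of attempt `n`.  The event that attempt `n` has been
made by time `t` is determined (up to null events) by what is known by time `t`, and no attempt is
made without energy. -/
structure IsPolicy (P : Measure Ω) (gap : ℕ → Ω → ℝ) (erased : ℕ → Ω → Bool) (x : ℕ → Ω → ℝ) :
    Prop where
  measurable : ∀ n, Measurable (x n)
  nonneg : ∀ᵐ ω ∂P, 0 ≤ x 0 ω
  mono : ∀ᵐ ω ∂P, Monotone fun n => x n ω
  online : ∀ (n : ℕ) (t : ℝ), ∃ s : Set Ω,
    MeasurableSet[information gap erased n t] s ∧ {ω | x n ω ≤ t} =ᵐ[P] s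
  energy_causality : ∀ᵐ ω ∂P, ∀ n, 1 ≤ battery gap x n ω

/-- The index of the first attempt in epoch `j`, where epoch `0` starts at time `0` and epoch `j + 1`
starts at the `j`-th successful attempt. -/
def firstAttempt (erased : ℕ → Ω → Bool) : ℕ → Ω → ℕ
  | 0, _ => 0
  | j + 1, ω => Nat.nth (fun n => erased n ω = false) j + 1

/-- The start time of epoch `j`: time `0` for `j = 0`, and the time of the `j`-th successful update
(counted from one) for `j ≥ 1`. -/
def successTime (erased : ℕ → Ω → Bool) (x : ℕ → Ω → ℝ) : ℕ → Ω → ℝ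
  | 0, _ => 0
  | j + 1, ω => x (Nat.nth (fun n => erased n ω = false) j) ω

/-- The length of epoch `j`. -/
def epochLength (erased : ℕ → Ω → Bool) (x : ℕ → Ω → ℝ) (j : ℕ) (ω : Ω) : ℝ :=
  successTime erased x (j + 1) ω - successTime erased x j ω

/-! ### The age of information -/

/-- The number of updates received successfully before time `t > 0`. -/
def successCount (erased : ℕ → Ω → Bool) (x : ℕ → Ω → ℝ) (t : ℝ) (ω : Ω) : ℕ :=
  sSup {j : ℕ | successTime erased x j ω < t}

/-- The area below the age of information on `[0, t]`.  The age starts from `0`, grows at unit rate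
and drops to `0` at each successful update. -/
def ageArea (erased : ℕ → Ω → Bool) (x : ℕ → Ω → ℝ) (t : ℝ) (ω : Ω) : ℝ :=
  ∑ j ∈ Finset.range (successCount erased x t ω), 1 / 2 * epochLength erased x j ω ^ 2 +
    1 / 2 * (t - successTime erased x (successCount erased x t ω) ω) ^ 2

/-- The long-term average age of information, `limsup_{T → ∞} E[r(T)] / T`. -/
def averageAge (P : Measure Ω) (erased : ℕ → Ω → Bool) (x : ℕ → Ω → ℝ) : ENNReal :=
  limsup (fun T : ℝ => (∫⁻ ω, ENNReal.ofReal (ageArea erased x T ω) ∂P) / ENNReal.ofReal T) atTop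

/-! ### Uniformly bounded policies and renewal policies -/

/-- The energy arrivals after time `t`, listed as the waiting time from `t` to the next arrival
followed by the later inter-arrival times. -/
def gapsAfter (gap : ℕ → Ω → ℝ) (t : ℝ) (ω : Ω) : ℕ → ℝ
  | 0 => arrivalTime gap (arrivalCount gap t ω) ω - t
  | i + 1 => gap (arrivalCount gap t ω + (i + 1)) ω

/-- The energy arrivals and the erasures seen from the beginning of epoch `j`. -/
def epochEnvironment (gap : ℕ → Ω → ℝ) (erased : ℕ → Ω → Bool) (x : ℕ → Ω → ℝ) (j : ℕ) (ω : Ω) :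
    (ℕ → ℝ) × (ℕ → Bool) :=
  (gapsAfter gap (successTime erased x j ω) ω,
    fun i => erased (firstAttempt erased j ω + i) ω)

/-- A policy is uniformly bounded if the epoch lengths are bounded by one and the same function, of
finite second moment, of the energy arrivals and erasures seen from the beginning of the epoch. -/
def IsUniformlyBounded (P : Measure Ω) (gap : ℕ → Ω → ℝ) (erased : ℕ → Ω → Bool)
    (x : ℕ → Ω → ℝ) : Prop :=
  ∃ g : (ℕ → ℝ) × (ℕ → Bool) → ℝ, Measurable g ∧
    MemLp (fun ω => g (fun k => gap k ω, fun n => erased n ω)) 2 P ∧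
    ∀ j, ∀ᵐ ω ∂P, epochLength erased x j ω ≤ g (epochEnvironment gap erased x j ω)

/-- `y 0, y 1, …` is a renewal process that starts from `0`: its increments are positive,
independent and identically distributed. -/
structure IsRenewalProcess (P : Measure Ω) (y : ℕ → Ω → ℝ) : Prop where
  zero : ∀ᵐ ω ∂P, y 0 ω = 0
  pos : ∀ j, ∀ᵐ ω ∂P, 0 < y (j + 1) ω - y j ω
  indep : iIndepFun (fun j ω => y (j + 1) ω - y j ω) P
  identDistrib : ∀ j, IdentDistrib (fun ω => y (j + 1) ω - y j ω) (fun ω => y 1 ω - y 0 ω) P P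

/-- A renewal policy: in each epoch the sensor ignores all that happened before the epoch and
repeats the same rule `φ` (`φ i` gives the time of the `i`-th attempt of the epoch, measured from the
beginning of the epoch), and the epochs are i.i.d., so that the successful update times form a
renewal process. -/
structure IsRenewalPolicy (P : Measure Ω) (gap : ℕ → Ω → ℝ) (erased : ℕ → Ω → Bool)
    (x : ℕ → Ω → ℝ) : Prop where
  same_rule : ∃ φ : ℕ → (ℕ → ℝ) × (ℕ → Bool) → ℝ, (∀ i, Measurable (φ i)) ∧
    ∀ j i, ∀ᵐ ω ∂P, firstAttempt erased j ω + i < firstAttempt erased (j + 1) ω →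
      x (firstAttempt erased j ω + i) ω - successTime erased x j ω =
        φ i (epochEnvironment gap erased x j ω)
  renewal : IsRenewalProcess P (successTime erased x)

end StatusUpdate

end

/-!
The long-term average age is the cost rate of a Markov decision problem whose state is the age of
information together with the content of the battery, and the proof is a verification argument for
its average-cost optimality equation.

Let `m = q / (1 - q)` be the mean number of erased attempts before a success (`meanRetries`), and
let `γ` solve `exp (-γ) + m (1 - γ) = γ ^ 2 / 2` (`IsThreshold`). Charge an epoch of length `s`
with `s ^ 2 / 2 - (γ + m) s` (`epochCost`), its area minus its duration at the rate `γ + m`. The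
functions `fullValue` and `emptyValue` are the values of this problem with a full and an empty
battery, and they satisfy the optimality equation:
* the mean of `fullValue` at the next energy arrival is `emptyValue` (`integral_fullValue`),
  because the wait for energy is exponential and independent of the past at every time at which the
  sensor may attempt. This is the strong Markov property of the Poisson process
  (`IsOnlineTime.indepFun_waitingTime`), derived from the lack of memory at fixed times
  (`measure_inter_lt_nextArrival_sub`);
* an attempt at age `s` has mean cost, continuation included, at least `fullValue γ s`
  (`fullValue_le_attemptValue`), with equality if `γ ≤ s` (`attemptValue_eq_fullValue`), because
  the next erasure is independent of what has been observed
  (`IsEnvironment.indep_erased_outcomeHistory`);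
* a new epoch starts with value `emptyValue γ 0 = 0`.

Summing over the attempts before a horizon `T` gives mean cost at least zero for every policy
(`IsPolicy.integral_horizonCost_nonneg`), and exactly zero for the threshold policy, which attempts
as soon as there is energy and the age is at least `γ` (`IsPolicy.integral_horizonCost_eq_zero`).
Comparing the cost with the area below the age up to `T`, the average age is at least `γ + m` for
every policy (`IsPolicy.le_averageAge`) and at most `γ + m` for the threshold policy
(`IsPolicy.averageAge_le`).

The threshold policy reads only the environment seen from the beginning of the epoch
(`IsRegularPath.thresholdPolicy_sub`). Its epochs form a renewal process for the following reason.
The waits for energy and the outcomes of the attempts are an i.i.d. sequence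
(`IsPolicy.iIndepFun_waitOutcome`), the length of an epoch is a function of this sequence up to the
first success, and what follows the first success is an independent copy of the whole sequence
(`waitsEpoch_inter_afterSuccess`). The second moment of an epoch is finite since the number of
attempts is geometric (`IsPolicy.lintegral_sq_waitsEpoch_lt_top`), so the epoch length itself is
the bound that makes the policy uniformly bounded.
-/

noncomputable section

namespace StatusUpdate

set_option linter.unusedSectionVars false

variable {Ω : Type*} [MeasurableSpace Ω]

/-! ### Counting arrivals along one path -/

/-- The path `ω` of the arrival process is regular: gaps are positive and there are finitely many
arrivals in bounded time. -/
structure IsRegularPath (gap : ℕ → Ω → ℝ) (ω : Ω) : Prop where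
  gap_pos : ∀ k, 0 < gap k ω
  tendsto_arrivalTime : Tendsto (fun k => arrivalTime gap k ω) atTop atTop

/-- The first energy arrival strictly after time `t`. -/
def nextArrival (gap : ℕ → Ω → ℝ) (t : ℝ) (ω : Ω) : ℝ :=
  arrivalTime gap (arrivalCount gap t ω) ω

lemma arrivalTime_succ (gap : ℕ → Ω → ℝ) (k : ℕ) (ω : Ω) :
    arrivalTime gap (k + 1) ω = arrivalTime gap k ω + gap (k + 1) ω := by
  simp [arrivalTime, Finset.sum_range_succ _ (k + 1)]

lemma arrivalTime_zero (gap : ℕ → Ω → ℝ) (ω : Ω) : arrivalTime gap 0 ω = gap 0 ω := by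
  simp [arrivalTime]

namespace IsRegularPath

variable {gap : ℕ → Ω → ℝ} {ω : Ω}

lemma strictMono (h : IsRegularPath gap ω) : StrictMono fun k => arrivalTime gap k ω :=
  strictMono_nat_of_lt_succ fun k => by
    rw [arrivalTime_succ]; linarith [h.gap_pos (k + 1)]

lemma arrivalTime_pos (h : IsRegularPath gap ω) (k : ℕ) : 0 < arrivalTime gap k ω := by
  have := h.strictMono.monotone (Nat.zero_le k)
  simp only [arrivalTime_zero] at this
  linarith [h.gap_pos 0]

lemma setOf_arrivalTime_le (h : IsRegularPath gap ω) (t : ℝ) :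
    {k : ℕ | arrivalTime gap k ω ≤ t} = Set.Iio (arrivalCount gap t ω) := by
  classical
  have hex : ∃ k, t < arrivalTime gap k ω := (h.tendsto_arrivalTime.eventually_gt_atTop t).exists
  have hset : {k : ℕ | arrivalTime gap k ω ≤ t} = Set.Iio (Nat.find hex) := by
    ext k
    simp only [Set.mem_ofPred_eq, Set.mem_Iio, Nat.lt_find_iff, not_lt]
    exact ⟨fun hk m hm => (h.strictMono.monotone hm).trans hk, fun hk => hk k le_rfl⟩
  have : arrivalCount gap t ω = Nat.find hex := by
    rw [arrivalCount, hset, Set.ncard_eq_toFinset_card', Set.toFinset_Iio, Nat.card_Iio]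
  rw [hset, this]

lemma lt_arrivalCount_iff (h : IsRegularPath gap ω) {k : ℕ} {t : ℝ} :
    k < arrivalCount gap t ω ↔ arrivalTime gap k ω ≤ t := by
  have := Set.ext_iff.1 (h.setOf_arrivalTime_le t) k
  simpa using this.symm

lemma arrivalCount_le_iff (h : IsRegularPath gap ω) {k : ℕ} {t : ℝ} :
    arrivalCount gap t ω ≤ k ↔ t < arrivalTime gap k ω := by
  rw [← not_lt, h.lt_arrivalCount_iff, not_le]

lemma arrivalCount_mono (h : IsRegularPath gap ω) {s t : ℝ} (hst : s ≤ t) :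
    arrivalCount gap s ω ≤ arrivalCount gap t ω := by
  rw [h.arrivalCount_le_iff]
  exact hst.trans_lt (h.arrivalCount_le_iff.1 le_rfl)

lemma lt_nextArrival (h : IsRegularPath gap ω) (t : ℝ) : t < nextArrival gap t ω :=
  h.arrivalCount_le_iff.1 le_rfl

lemma nextArrival_le (h : IsRegularPath gap ω) {k : ℕ} {t : ℝ} (hk : t < arrivalTime gap k ω) :
    nextArrival gap t ω ≤ arrivalTime gap k ω :=
  h.strictMono.monotone (h.arrivalCount_le_iff.2 hk)

lemma nextArrival_mono (h : IsRegularPath gap ω) {s t : ℝ} (hst : s ≤ t) :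
    nextArrival gap s ω ≤ nextArrival gap t ω :=
  h.strictMono.monotone (h.arrivalCount_mono hst)

lemma arrivalCount_eq_iff (h : IsRegularPath gap ω) {k : ℕ} {t : ℝ} :
    arrivalCount gap t ω = k ↔ (∀ i < k, arrivalTime gap i ω ≤ t) ∧ t < arrivalTime gap k ω := by
  constructor
  · rintro rfl
    exact ⟨fun i hi => h.lt_arrivalCount_iff.1 hi, h.lt_nextArrival t⟩
  · rintro ⟨h1, h2⟩
    refine le_antisymm (h.arrivalCount_le_iff.2 h2) ?_
    by_contra! hlt
    exact absurd (h1 _ hlt) (not_le.2 (h.lt_nextArrival t))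

/-- The arrival count is constant up to the next arrival. -/
lemma arrivalCount_eq_of_lt_nextArrival (h : IsRegularPath gap ω) {s t : ℝ} (hst : s ≤ t)
    (ht : t < nextArrival gap s ω) : arrivalCount gap t ω = arrivalCount gap s ω :=
  le_antisymm (h.arrivalCount_le_iff.2 ht) (h.arrivalCount_mono hst)

lemma nextArrival_eq_of_lt (h : IsRegularPath gap ω) {s t : ℝ} (hst : s ≤ t)
    (ht : t < nextArrival gap s ω) : nextArrival gap t ω = nextArrival gap s ω := by
  rw [nextArrival, h.arrivalCount_eq_of_lt_nextArrival hst ht, ← nextArrival]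

lemma nextArrival_le_iff (h : IsRegularPath gap ω) {s t : ℝ} :
    nextArrival gap s ω ≤ t ↔ arrivalCount gap s ω < arrivalCount gap t ω :=
  h.lt_arrivalCount_iff.symm

/-- One unit of energy arrives in `(s, t]` exactly when the first arrival after `s` comes by `t`. -/
lemma one_le_harvested_iff (h : IsRegularPath gap ω) {s t : ℝ} :
    1 ≤ harvested gap s t ω ↔ nextArrival gap s ω ≤ t := by
  have hfin : {k : ℕ | s < arrivalTime gap k ω ∧ arrivalTime gap k ω ≤ t}.Finite := by
    refine (Set.finite_Iio (arrivalCount gap t ω)).subset fun k hk => ?_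
    exact h.lt_arrivalCount_iff.2 hk.2
  rw [harvested, Nat.one_le_iff_ne_zero, Ne, Set.ncard_eq_zero hfin, ← Ne, ← Set.nonempty_iff_ne_empty]
  constructor
  · rintro ⟨k, hk1, hk2⟩
    exact (h.nextArrival_le hk1).trans hk2
  · exact fun hle => ⟨_, h.lt_nextArrival s, hle⟩

/-! ### The arrivals seen from a later time -/

lemma arrivalTime_gapsAfter (t : ℝ) (k : ℕ) :
    arrivalTime (fun k (g : ℕ → ℝ) => g k) k (gapsAfter gap t ω) =
      arrivalTime gap (arrivalCount gap t ω + k) ω - t := by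
  induction k with
  | zero => rw [arrivalTime_zero]; rfl
  | succ k ih => rw [arrivalTime_succ, ih, ← add_assoc, arrivalTime_succ, gapsAfter]; ring_nf

lemma gapsAfter (h : IsRegularPath gap ω) (t : ℝ) :
    IsRegularPath (fun k (g : ℕ → ℝ) => g k) (gapsAfter gap t ω) where
  gap_pos k := by
    cases k with
    | zero => exact sub_pos.2 (h.lt_nextArrival t)
    | succ k => exact h.gap_pos _
  tendsto_arrivalTime := by
    simp only [arrivalTime_gapsAfter]
    refine tendsto_atTop_add_const_right _ _ ?_
    exact h.tendsto_arrivalTime.comp (tendsto_add_atTop_nat _ |>.congr fun k => add_comm _ _)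

lemma arrivalCount_gapsAfter (h : IsRegularPath gap ω) {s t : ℝ} (hs : 0 ≤ s) :
    arrivalCount (fun k (g : ℕ → ℝ) => g k) s (StatusUpdate.gapsAfter gap t ω) =
      arrivalCount gap (t + s) ω - arrivalCount gap t ω := by
  have hmono := h.arrivalCount_mono (show t ≤ t + s by linarith)
  rw [(h.gapsAfter t).arrivalCount_eq_iff]
  simp only [arrivalTime_gapsAfter]
  refine ⟨fun i hi => ?_, ?_⟩
  · have : arrivalCount gap t ω + i < arrivalCount gap (t + s) ω := by omega
    linarith [h.lt_arrivalCount_iff.1 this]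
  · rw [Nat.add_sub_cancel' hmono]
    have := h.lt_nextArrival (t + s)
    rw [nextArrival] at this
    linarith

/-- Shifting the origin of time shifts the next arrival. -/
lemma nextArrival_gapsAfter (h : IsRegularPath gap ω) {s t : ℝ} (hs : 0 ≤ s) :
    nextArrival (fun k (g : ℕ → ℝ) => g k) s (StatusUpdate.gapsAfter gap t ω) =
      nextArrival gap (t + s) ω - t := by
  rw [nextArrival, h.arrivalCount_gapsAfter hs, arrivalTime_gapsAfter,
    Nat.add_sub_cancel' (h.arrivalCount_mono (by linarith)), nextArrival]

lemma arrivalCount_zero (h : IsRegularPath gap ω) : arrivalCount gap 0 ω = 0 :=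
  Nat.le_zero.1 (h.arrivalCount_le_iff.2 (h.arrivalTime_pos 0))

lemma gapsAfter_zero (h : IsRegularPath gap ω) :
    StatusUpdate.gapsAfter gap 0 ω = fun k => gap k ω := by
  funext k
  cases k with
  | zero => simp [StatusUpdate.gapsAfter, h.arrivalCount_zero, arrivalTime_zero]
  | succ k => simp [StatusUpdate.gapsAfter, h.arrivalCount_zero]

end IsRegularPath

/-! ### Almost every path is regular -/

/-- A value that is taken with a fixed positive probability in independent trials is taken
infinitely often. -/
lemma ae_frequently_mem {β : Type*} [MeasurableSpace β] {P : Measure Ω} {X : ℕ → Ω → β}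
    (hX : ∀ n, Measurable (X n)) (hind : iIndepFun X P) {B : Set β} (hB : MeasurableSet B)
    {c : ENNReal} (hc : c ≠ 0) (h : ∀ n, P (X n ⁻¹' B) = c) : ∀ᵐ ω ∂P, ∃ᶠ n in atTop, X n ω ∈ B := by
  have := hind.isProbabilityMeasure
  have hset : iIndepSet (fun n => X n ⁻¹' B) P := by
    rw [iIndepSet_iff_meas_biInter fun n => hX n hB]
    intro S
    exact hind.measure_inter_preimage_eq_mul S fun _ _ => hB
  have := measure_limsup_eq_one (fun n => hX n hB) hset (by simp [h, ENNReal.tsum_const_eq_top_of_ne_zero hc])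
  have h2 : ∀ᵐ ω ∂P, ω ∈ limsup (fun n => X n ⁻¹' B) atTop := by
    rw [← prob_compl_eq_zero_iff] at this
    · exact this
    · exact MeasurableSet.measurableSet_limsup fun n => hX n hB
  filter_upwards [h2] with ω hω
  exact mem_limsup_iff_frequently_mem.1 hω

lemma expMeasure_Ioi {u : ℝ} (hu : 0 ≤ u) :
    expMeasure 1 (Set.Ioi u) = ENNReal.ofReal (Real.exp (-u)) := by
  have := isProbabilityMeasure_expMeasure (r := 1) one_pos
  rw [← Set.compl_Iic, prob_compl_eq_one_sub measurableSet_Iic, ← ofReal_cdf,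
    cdf_expMeasure_eq one_pos, if_pos hu, ← ENNReal.ofReal_one, ← ENNReal.ofReal_sub]
  · simp
  · simp [hu]

namespace IsEnvironment

variable {P : Measure Ω} {q : ℝ} {gap : ℕ → Ω → ℝ} {erased : ℕ → Ω → Bool}

lemma measure_gap_gt (h : IsEnvironment P q gap erased) (k : ℕ) {u : ℝ} (hu : 0 ≤ u) :
    P {ω | u < gap k ω} = ENNReal.ofReal (Real.exp (-u)) := by
  rw [← expMeasure_Ioi hu, ← h.map_gap k, Measure.map_apply (h.measurable_gap k) measurableSet_Ioi]
  rfl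

lemma ae_isRegularPath (h : IsEnvironment P q gap erased) : ∀ᵐ ω ∂P, IsRegularPath gap ω := by
  have := h.indep_gap.isProbabilityMeasure
  have hpos : ∀ k, ∀ᵐ ω ∂P, 0 < gap k ω := fun k => by
    have h0 := h.measure_gap_gt k le_rfl
    simp only [neg_zero, Real.exp_zero, ENNReal.ofReal_one] at h0
    exact (mem_ae_iff_prob_eq_one (measurableSet_lt measurable_const (h.measurable_gap k))).2 h0
  have hfreq := ae_frequently_mem h.measurable_gap h.indep_gap (measurableSet_Ioi (a := (1 : ℝ)))
    (c := ENNReal.ofReal (Real.exp (-1))) (by simp [Real.exp_pos])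
    (fun n => h.measure_gap_gt n zero_le_one)
  filter_upwards [ae_all_iff.2 hpos, hfreq] with ω hω hf
  refine ⟨hω, ?_⟩
  -- infinitely many gaps exceed `1`, so the gaps are not summable
  have hns : ¬ Summable fun k => gap k ω := fun hs => by
    have := hs.tendsto_atTop_zero.eventually (gt_mem_nhds (show (0 : ℝ) < 1 by norm_num))
    obtain ⟨n, hn1, hn2⟩ := (hf.and_eventually this).exists
    exact absurd hn2 (not_lt.2 (le_of_lt hn1))
  have := (not_summable_iff_tendsto_nat_atTop_of_nonneg fun k => (hω k).le).1 hns
  exact this.comp (tendsto_add_atTop_nat 1)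

lemma ae_frequently_success (h : IsEnvironment P q gap erased) (hq1 : q < 1) :
    ∀ᵐ ω ∂P, ∃ᶠ n in atTop, erased n ω = false := by
  have := h.indep_gap.isProbabilityMeasure
  refine ae_frequently_mem h.measurable_erased h.indep_erased (measurableSet_singleton false)
    (c := 1 - ENNReal.ofReal q) ?_ fun n => ?_
  · rw [Ne, tsub_eq_zero_iff_le, not_le]
    simpa using hq1
  · rw [← h.prob_erased n, ← prob_compl_eq_one_sub]
    · congr 1; ext ω; simp
    · exact h.measurable_erased n (measurableSet_singleton true)

end IsEnvironment

/-! ### Measurability of the arrival process -/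

lemma measurable_ncard : Measurable (Set.ncard : Set ℕ → ℕ) := by
  have hc : {s : Set ℕ | s.Finite}.Countable := by
    simpa using Set.Countable.ofPred_finite (α := ℕ)
  refine measurable_to_countable' fun n => ?_
  rcases Nat.eq_zero_or_pos n with rfl | hn
  · rw [← MeasurableSet.compl_iff]
    refine (hc.mono fun s hs => ?_).measurableSet
    by_contra hinf
    exact hs (Set.Infinite.ncard hinf)
  · refine (hc.mono fun s hs => ?_).measurableSet
    exact Set.finite_of_ncard_pos (by rw [show s.ncard = n from hs]; exact hn)

lemma measurable_arrivalTime {gap : ℕ → Ω → ℝ} (hgap : ∀ k, Measurable (gap k)) (k : ℕ) :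
    Measurable (arrivalTime gap k) := by
  unfold arrivalTime
  exact Finset.measurable_sum _ fun i _ => hgap i

lemma measurable_arrivalCount {gap : ℕ → Ω → ℝ} (hgap : ∀ k, Measurable (gap k)) :
    Measurable fun z : ℝ × Ω => arrivalCount gap z.1 z.2 := by
  unfold arrivalCount
  refine measurable_ncard.comp (measurable_set_iff.2 fun k => ?_)
  exact measurableSet_setOfPred.1
    (measurableSet_le ((measurable_arrivalTime hgap k).comp measurable_snd) measurable_fst)

lemma measurable_arrivalCount_const {gap : ℕ → Ω → ℝ} (hgap : ∀ k, Measurable (gap k)) (t : ℝ) :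
    Measurable (arrivalCount gap t) :=
  (measurable_arrivalCount hgap).comp (g := fun z : ℝ × Ω => arrivalCount gap z.1 z.2)
    (f := fun ω => (t, ω)) (measurable_const.prodMk measurable_id)

lemma measurable_nextArrival {gap : ℕ → Ω → ℝ} (hgap : ∀ k, Measurable (gap k)) :
    Measurable fun z : ℝ × Ω => nextArrival gap z.1 z.2 := by
  have h : Measurable fun y : ℕ × Ω => arrivalTime gap y.1 y.2 :=
    measurable_from_prod_countable_right fun k => measurable_arrivalTime hgap k
  exact h.comp ((measurable_arrivalCount hgap).prodMk measurable_snd)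

lemma measurable_nextArrival_const {gap : ℕ → Ω → ℝ} (hgap : ∀ k, Measurable (gap k)) (t : ℝ) :
    Measurable (nextArrival gap t) :=
  (measurable_nextArrival hgap).comp (g := fun z : ℝ × Ω => nextArrival gap z.1 z.2)
    (f := fun ω => (t, ω)) (measurable_const.prodMk measurable_id)

lemma measurable_sum_range {α : Type*} {m : MeasurableSpace α} {f : ℕ → α → ℝ} {k : ℕ}
    (h : ∀ i < k, Measurable (f i)) : Measurable fun a => ∑ i ∈ Finset.range k, f i a :=
  Finset.measurable_sum _ fun i hi => h i (Finset.mem_range.1 hi)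

lemma measurable_card_le {α : Type*} {m : MeasurableSpace α} {f : ℕ → α → ℝ} {k : ℕ} (s : ℝ)
    (h : ∀ i < k, Measurable (f i)) :
    Measurable fun a => ∑ i ∈ Finset.range k, if f i a ≤ s then (1 : ℕ) else 0 :=
  Finset.measurable_sum _ fun i hi => Measurable.ite
    (measurableSet_le (h i (Finset.mem_range.1 hi)) measurable_const) measurable_const
    measurable_const

lemma measurable_indicator_prodMk {α : Type*} {m : MeasurableSpace α} {B : Set α}
    (hB : MeasurableSet B) {f : α → ℝ} (hf : Measurable f) :
    Measurable fun a => (B.indicator (1 : α → ENNReal) a, f a) :=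
  (measurable_one.indicator hB).prodMk hf

lemma Indep.sup_right {a b c mΩ : MeasurableSpace Ω} {μ : Measure[mΩ] Ω} [IsProbabilityMeasure μ]
    (ha : a ≤ mΩ) (hb : b ≤ mΩ) (hc : c ≤ mΩ) (hab : Indep a b μ) (habc : Indep (a ⊔ b) c μ) :
    Indep a (b ⊔ c) μ := by
  have hgen : b ⊔ c = MeasurableSpace.generateFrom
      {t | ∃ B C, MeasurableSet[b] B ∧ MeasurableSet[c] C ∧ t = B ∩ C} := by
    apply le_antisymm
    · refine sup_le (fun B hB => ?_) (fun C hC => ?_)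
      · exact MeasurableSpace.measurableSet_generateFrom
          ⟨B, Set.univ, hB, MeasurableSet.univ, (Set.inter_univ B).symm⟩
      · exact MeasurableSpace.measurableSet_generateFrom
          ⟨Set.univ, C, MeasurableSet.univ, hC, (Set.univ_inter C).symm⟩
    · refine MeasurableSpace.generateFrom_le ?_
      rintro _ ⟨B, C, hB, hC, rfl⟩
      exact ((le_sup_left : b ≤ b ⊔ c) B hB).inter ((le_sup_right : c ≤ b ⊔ c) C hC)
  refine IndepSets.indep ha (sup_le hb hc) (@MeasurableSpace.isPiSystem_measurableSet _ a) ?_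
    (@MeasurableSpace.generateFrom_measurableSet _ a).symm hgen ?_
  · rintro _ ⟨B, C, hB, hC, rfl⟩ _ ⟨B', C', hB', hC', rfl⟩ -
    exact ⟨B ∩ B', C ∩ C', hB.inter hB', hC.inter hC', Set.inter_inter_inter_comm _ _ _ _⟩
  · rw [IndepSets_iff]
    rintro A _ hA ⟨B, C, hB, hC, rfl⟩
    rw [Indep_iff] at hab habc
    have hA' : MeasurableSet[a ⊔ b] A := (le_sup_left : a ≤ a ⊔ b) A hA
    have hB' : MeasurableSet[a ⊔ b] B := (le_sup_right : b ≤ a ⊔ b) B hB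
    rw [← Set.inter_assoc, habc _ _ (hA'.inter hB') hC, hab A B hA hB, habc B C hB' hC, mul_assoc]

lemma lintegral_comp_of_indepFun {β γ : Type*} [MeasurableSpace β] [MeasurableSpace γ]
    {P : Measure Ω} [IsFiniteMeasure P] {Y : Ω → β} {X : Ω → γ} (hY : Measurable Y)
    (hX : Measurable X) (hind : IndepFun Y X P) {K : β × γ → ENNReal} (hK : Measurable K) :
    ∫⁻ ω, K (Y ω, X ω) ∂P = ∫⁻ ω, ∫⁻ x, K (Y ω, x) ∂(P.map X) ∂P := by
  have hmap := (indepFun_iff_map_prod_eq_prod_map_map hY.aemeasurable hX.aemeasurable).1 hind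
  rw [← lintegral_map (f := K) hK (hY.prodMk hX), hmap, lintegral_prod _ hK.aemeasurable,
    lintegral_map hK.lintegral_prod_right' hY]

/-! ### Past of a random time and the strong Markov property -/

section Markov

variable (gap : ℕ → Ω → ℝ) (erased : ℕ → Ω → Bool)

/-- The energy arrivals up to time `t` together with all erasure outcomes.  It contains what the
sensor may know at time `t`, and the arrivals after `t` are still independent of it. -/
@[reducible] def arrivalHistory (t : ℝ) : MeasurableSpace Ω :=
  (⨆ (s : ℝ) (_ : s ≤ t), MeasurableSpace.comap (arrivalCount gap s) ⊤) ⊔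
    (⨆ i : ℕ, MeasurableSpace.comap (erased i) ⊤)

/-- The first `k` gaps together with all erasure outcomes. -/
@[reducible] def gapHistory (k : ℕ) : MeasurableSpace Ω :=
  (⨆ (i : ℕ) (_ : i ∈ Set.Iio k), MeasurableSpace.comap (gap i) inferInstance) ⊔
    (⨆ i : ℕ, MeasurableSpace.comap (erased i) ⊤)

variable {gap erased}

lemma arrivalHistory_mono : Monotone (arrivalHistory gap erased) := fun _ _ hst =>
  sup_le_sup_right (iSup₂_le fun s hs => le_iSup₂ (f := fun (s : ℝ) (_ : s ≤ _) =>
    MeasurableSpace.comap (arrivalCount gap s) ⊤) s (hs.trans hst)) _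

lemma comap_gap_le_gapHistory {i k : ℕ} (hi : i < k) :
    MeasurableSpace.comap (gap i) inferInstance ≤ gapHistory gap erased k :=
  (le_iSup₂ (f := fun (i : ℕ) (_ : i ∈ Set.Iio k) =>
    MeasurableSpace.comap (gap i) inferInstance) i hi).trans le_sup_left

lemma comap_erased_le_gapHistory (i k : ℕ) :
    MeasurableSpace.comap (erased i) ⊤ ≤ gapHistory gap erased k :=
  (le_iSup (fun i => MeasurableSpace.comap (erased i) ⊤) i).trans le_sup_right

lemma measurable_gap_gapHistory {i k : ℕ} (hi : i < k) :
    Measurable[gapHistory gap erased k] (gap i) :=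
  (comap_measurable (gap i)).mono (comap_gap_le_gapHistory hi) le_rfl

lemma gapHistory_le (hgap : ∀ k, Measurable (gap k)) (her : ∀ n, Measurable (erased n)) (k : ℕ) :
    gapHistory gap erased k ≤ ‹MeasurableSpace Ω› :=
  sup_le (iSup₂_le fun i _ => (hgap i).comap_le) (iSup_le fun i => (her i).comap_le)

/-- On the event of exactly `k` arrivals up to time `t`, the history up to time `t` is a function of
the first `k` gaps. -/
lemma exists_gapHistory_of_arrivalHistory {t : ℝ} (k : ℕ) {A : Set Ω}
    (hA : MeasurableSet[arrivalHistory gap erased t] A) :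
    ∃ B, MeasurableSet[gapHistory gap erased k] B ∧
      ∀ ω, IsRegularPath gap ω → arrivalCount gap t ω = k → (ω ∈ A ↔ ω ∈ B) := by
  classical
  let M : MeasurableSpace Ω :=
    { MeasurableSet' := fun A => ∃ B, MeasurableSet[gapHistory gap erased k] B ∧
        ∀ ω, IsRegularPath gap ω → arrivalCount gap t ω = k → (ω ∈ A ↔ ω ∈ B)
      measurableSet_empty := ⟨∅, @MeasurableSet.empty _ (_), by simp⟩
      measurableSet_compl := by
        rintro A ⟨B, hB, h⟩
        exact ⟨Bᶜ, hB.compl, fun ω h1 h2 => not_congr (h ω h1 h2)⟩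
      measurableSet_iUnion := by
        intro A hA
        choose B hB h using hA
        refine ⟨⋃ i, B i, MeasurableSet.iUnion hB, fun ω h1 h2 => ?_⟩
        simp only [Set.mem_iUnion, h _ ω h1 h2] }
  suffices hle : arrivalHistory gap erased t ≤ M from hle A hA
  refine sup_le (iSup₂_le fun s hs => ?_) (iSup_le fun i => ?_)
  · rintro _ ⟨J, -, rfl⟩
    have hcard := measurable_card_le (m := gapHistory gap erased k) s
      (f := arrivalTime gap) (k := k) fun i hi =>
        measurable_sum_range fun j hj => measurable_gap_gapHistory (by omega)
    refine ⟨_, hcard (MeasurableSet.of_discrete (s := J)), fun ω hω hk => ?_⟩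
    have hle : arrivalCount gap s ω ≤ k := hk ▸ hω.arrivalCount_mono hs
    have : (∑ i ∈ Finset.range k, if arrivalTime gap i ω ≤ s then 1 else 0) =
        arrivalCount gap s ω := by
      simp only [← hω.lt_arrivalCount_iff]
      rw [← Finset.card_filter]
      have : (Finset.range k).filter (· < arrivalCount gap s ω) =
          Finset.range (arrivalCount gap s ω) := by
        ext i; simp only [Finset.mem_filter, Finset.mem_range]; omega
      rw [this, Finset.card_range]
    simp only [Set.mem_preimage, this]
  · intro A hA
    exact ⟨A, comap_erased_le_gapHistory i k A hA, fun _ _ _ => Iff.rfl⟩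

variable {P : Measure Ω} [IsProbabilityMeasure P] {q : ℝ}

lemma IsEnvironment.indep_gap_gapHistory (h : IsEnvironment P q gap erased) (k : ℕ) :
    Indep (MeasurableSpace.comap (gap k) inferInstance) (gapHistory gap erased k) P := by
  have hle : ∀ i, MeasurableSpace.comap (gap i) inferInstance ≤
      MeasurableSpace.comap (fun ω k => gap k ω) inferInstance := fun i =>
    (((measurable_pi_apply i).comp (comap_measurable fun ω k => gap k ω))).comap_le
  refine Indep.sup_right (h.measurable_gap k).comap_le
    (iSup₂_le fun i _ => (h.measurable_gap i).comap_le)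
    (iSup_le fun i => (h.measurable_erased i).comap_le) ?_ ?_
  · have := indep_iSup_of_disjoint (fun i => (h.measurable_gap i).comap_le) h.indep_gap
      (S := {k}) (T := Set.Iio k) (by simp)
    simpa using this
  · refine indep_of_indep_of_le h.indep_gap_erased
      (sup_le (hle k) (iSup₂_le fun i _ => hle i)) (iSup_le fun i => ?_)
    exact (((measurable_pi_apply i).comp (comap_measurable fun ω k => erased k ω))).comap_le

/-- Memorylessness of a gap that is independent of the time `S` from which it is counted. -/
lemma measure_inter_lt_add_gap (h : IsEnvironment P q gap erased) {k : ℕ} {B : Set Ω}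
    (hB : MeasurableSet[gapHistory gap erased k] B) {S : Ω → ℝ}
    (hS : Measurable[gapHistory gap erased k] S) {t u : ℝ} (hu : 0 ≤ u) :
    P (B ∩ {ω | S ω ≤ t ∧ t + u < S ω + gap k ω}) =
      ENNReal.ofReal (Real.exp (-u)) * P (B ∩ {ω | S ω ≤ t ∧ t < S ω + gap k ω}) := by
  have hle := gapHistory_le h.measurable_gap h.measurable_erased k
  have hB' := hle B hB
  have hS' : Measurable S := hS.mono hle le_rfl
  let Y : Ω → ENNReal × ℝ := fun ω => (B.indicator 1 ω, S ω)
  have hY : Measurable[gapHistory gap erased k] Y :=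
    measurable_indicator_prodMk hB hS
  have hind : IndepFun Y (gap k) P :=
    indep_of_indep_of_le_left (h.indep_gap_gapHistory k).symm hY.comap_le
  have key : ∀ v, 0 ≤ v → P (B ∩ {ω | S ω ≤ t ∧ t + v < S ω + gap k ω}) =
      ∫⁻ ω, (B ∩ {ω | S ω ≤ t}).indicator
        (fun ω => ENNReal.ofReal (Real.exp (-v)) * ENNReal.ofReal (Real.exp (-(t - S ω)))) ω ∂P := by
    intro v hv
    let D : Set (ℝ × ℝ) := {z | z.1 ≤ t ∧ t + v < z.1 + z.2}
    have hD : MeasurableSet D :=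
      (measurableSet_le measurable_fst measurable_const).inter
        (measurableSet_lt measurable_const (measurable_fst.add measurable_snd))
    let K : (ENNReal × ℝ) × ℝ → ENNReal := fun z => z.1.1 * D.indicator 1 (z.1.2, z.2)
    have hK : Measurable K := by
      refine measurable_fst.fst.mul ((measurable_one.indicator hD).comp ?_)
      exact measurable_fst.snd.prodMk measurable_snd
    have h1 := lintegral_comp_of_indepFun (hY.mono hle le_rfl) (h.measurable_gap k) hind hK
    have hset : MeasurableSet (B ∩ {ω | S ω ≤ t ∧ t + v < S ω + gap k ω}) :=
      hB'.inter ((measurableSet_le hS' measurable_const).inter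
        (measurableSet_lt measurable_const (hS'.add (h.measurable_gap k))))
    rw [← lintegral_indicator_one hset]
    convert h1 using 1
    · refine lintegral_congr fun ω => ?_
      by_cases h1 : ω ∈ B <;> by_cases h2 : S ω ≤ t ∧ t + v < S ω + gap k ω <;>
        simp [K, Y, D, h1, h2, Set.indicator_apply]
    · refine lintegral_congr fun ω => ?_
      simp only [K, Y]
      have hm : Measurable fun x => D.indicator (1 : ℝ × ℝ → ENNReal) (S ω, x) :=
        (measurable_one.indicator hD).comp (measurable_const.prodMk measurable_id)
      rw [lintegral_const_mul _ hm, h.map_gap k]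
      by_cases h1 : ω ∈ B
      · by_cases h2 : S ω ≤ t
        · have : (fun x => D.indicator (1 : ℝ × ℝ → ENNReal) (S ω, x)) =
              (Set.Ioi (t + v - S ω)).indicator 1 := by
            funext x
            simp only [Set.indicator_apply, D, Set.mem_ofPred_eq, Set.mem_Ioi, h2, true_and,
              sub_lt_iff_lt_add']
            rfl
          rw [this, lintegral_indicator_one measurableSet_Ioi, expMeasure_Ioi (by linarith)]
          rw [Set.indicator_of_mem (show ω ∈ B ∩ {ω | S ω ≤ t} from ⟨h1, h2⟩),
            Set.indicator_of_mem h1, Pi.one_apply, one_mul]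
          rw [← ENNReal.ofReal_mul (Real.exp_pos _).le, ← Real.exp_add]
          congr 2; ring
        · simp [D, h2]
      · simp [h1]
  rw [key u hu]
  have h0 := key 0 le_rfl
  simp only [add_zero, neg_zero, Real.exp_zero, ENNReal.ofReal_one, one_mul] at h0
  rw [h0, ← lintegral_const_mul]
  · refine lintegral_congr fun ω => ?_
    by_cases h1 : ω ∈ B ∩ {ω | S ω ≤ t} <;> simp [h1]
  · refine Measurable.indicator ?_ (hB'.inter (measurableSet_le hS' measurable_const))
    exact ENNReal.measurable_ofReal.comp (Real.measurable_exp.comp (measurable_const.sub hS').neg)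

lemma arrivalHistory_le (hgap : ∀ k, Measurable (gap k)) (her : ∀ n, Measurable (erased n)) (t : ℝ) :
    arrivalHistory gap erased t ≤ ‹MeasurableSpace Ω› :=
  sup_le (iSup₂_le fun s _ => (measurable_arrivalCount_const hgap s).comap_le)
    (iSup_le fun i => (her i).comap_le)

/-- The Markov property at a fixed time: the wait for the next arrival is exponential and does not
depend on the history. -/
lemma measure_inter_lt_nextArrival_sub (h : IsEnvironment P q gap erased) {t : ℝ} (ht : 0 ≤ t)
    {A : Set Ω} (hA : MeasurableSet[arrivalHistory gap erased t] A) {u : ℝ} (hu : 0 ≤ u) :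
    P (A ∩ {ω | u < nextArrival gap t ω - t}) = ENNReal.ofReal (Real.exp (-u)) * P A := by
  have hA' := arrivalHistory_le h.measurable_gap h.measurable_erased t A hA
  have hcount := measurable_arrivalCount_const h.measurable_gap t
  have hnext := measurable_nextArrival_const h.measurable_gap t
  -- split according to the number of arrivals up to time `t`
  have hsplit : ∀ v, P (A ∩ {ω | v < nextArrival gap t ω - t}) =
      ∑' k, P (A ∩ {ω | v < nextArrival gap t ω - t} ∩ arrivalCount gap t ⁻¹' {k}) := fun v => by
    rw [← measure_iUnion]
    · rw [← Set.inter_iUnion, ← Set.preimage_iUnion, Set.iUnion_of_singleton, Set.preimage_univ,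
        Set.inter_univ]
    · intro i j hij
      refine Set.disjoint_left.2 fun ω h1 h2 => hij ?_
      exact h1.2.symm.trans h2.2
    · exact fun k => (hA'.inter (measurableSet_lt measurable_const (hnext.sub_const t))).inter
        (hcount (measurableSet_singleton k))
  have hterm : ∀ k, P (A ∩ {ω | u < nextArrival gap t ω - t} ∩ arrivalCount gap t ⁻¹' {k}) =
      ENNReal.ofReal (Real.exp (-u)) *
        P (A ∩ {ω | 0 < nextArrival gap t ω - t} ∩ arrivalCount gap t ⁻¹' {k}) := fun k => by
    obtain ⟨B, hB, hAB⟩ := exists_gapHistory_of_arrivalHistory k hA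
    have hS : Measurable[gapHistory gap erased k] fun ω => ∑ i ∈ Finset.range k, gap i ω :=
      measurable_sum_range fun i hi => measurable_gap_gapHistory hi
    have hev : ∀ v, 0 ≤ v → P (A ∩ {ω | v < nextArrival gap t ω - t} ∩ arrivalCount gap t ⁻¹' {k}) =
        P (B ∩ {ω | (∑ i ∈ Finset.range k, gap i ω) ≤ t ∧
          t + v < (∑ i ∈ Finset.range k, gap i ω) + gap k ω}) := fun v hv => by
      refine measure_congr ?_
      filter_upwards [h.ae_isRegularPath] with ω hω
      have hk : arrivalTime gap k ω = (∑ i ∈ Finset.range k, gap i ω) + gap k ω := by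
        rw [arrivalTime, Finset.sum_range_succ]
      refine propext ⟨?_, ?_⟩
      · rintro ⟨⟨h1, h2⟩, h3⟩
        have h3 : arrivalCount gap t ω = k := h3
        refine ⟨(hAB ω hω h3).1 h1, ?_, ?_⟩
        · cases k with
          | zero => simpa using ht
          | succ k => exact hω.lt_arrivalCount_iff.1 (by omega)
        · have h2 : v < nextArrival gap t ω - t := h2
          rw [nextArrival, h3, hk] at h2
          linarith
      · rintro ⟨h1, h2, h3⟩
        have hcnt : arrivalCount gap t ω = k := by
          rw [hω.arrivalCount_eq_iff, hk]
          refine ⟨fun i hi => ?_, by linarith⟩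
          refine le_trans ?_ h2
          exact Finset.sum_le_sum_of_subset_of_nonneg
            (Finset.range_mono hi) fun j _ _ => (hω.gap_pos j).le
        refine ⟨⟨(hAB ω hω hcnt).2 h1, ?_⟩, hcnt⟩
        change v < nextArrival gap t ω - t
        rw [nextArrival, hcnt, hk]
        linarith
    rw [hev u hu, hev 0 le_rfl, measure_inter_lt_add_gap h hB hS hu]
    simp only [add_zero]
  have h0 : P (A ∩ {ω | 0 < nextArrival gap t ω - t}) = P A := by
    refine measure_congr ?_
    filter_upwards [h.ae_isRegularPath] with ω hω
    refine propext ⟨fun h => h.1, fun h => ⟨h, ?_⟩⟩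
    exact sub_pos.2 (hω.lt_nextArrival t)
  rw [← h0, hsplit u, hsplit 0, ← ENNReal.tsum_mul_left]
  exact tsum_congr hterm

end Markov

section StrongMarkov

lemma measurableSet_nat_lt {α : Type*} {m : MeasurableSpace α} {f g : α → ℕ} (hf : Measurable f)
    (hg : Measurable g) : MeasurableSet {a | f a < g a} :=
  measurableSet_lt hf hg

/-- The history up to time `t`, completed by the null events. -/
@[reducible] def completedHistory (P : Measure Ω) (gap : ℕ → Ω → ℝ) (erased : ℕ → Ω → Bool)
    (t : ℝ) : MeasurableSpace Ω :=
  eventuallyMeasurableSpace (arrivalHistory gap erased t) (ae P)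

/-- A random time is an online time if the completed history up to `t` decides whether it has come
by time `t`, for all `t`. -/
def IsOnlineTime (P : Measure Ω) (gap : ℕ → Ω → ℝ) (erased : ℕ → Ω → Bool) (p : Ω → ℝ) : Prop :=
  ∀ t, MeasurableSet[completedHistory P gap erased t] {ω | p ω ≤ t}

variable {P : Measure Ω} {gap : ℕ → Ω → ℝ} {erased : ℕ → Ω → Bool} {p p' : Ω → ℝ}

/-- The σ-algebra of the events that are decided at the online time `p`. -/
@[reducible] def IsOnlineTime.past (hp : IsOnlineTime P gap erased p) : MeasurableSpace Ω where
  MeasurableSet' A := ∀ t, MeasurableSet[completedHistory P gap erased t] (A ∩ {ω | p ω ≤ t})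
  measurableSet_empty t := by
    rw [Set.empty_inter]; exact @MeasurableSet.empty _ (_)
  measurableSet_compl A hA t := by
    have : Aᶜ ∩ {ω | p ω ≤ t} = {ω | p ω ≤ t} \ (A ∩ {ω | p ω ≤ t}) := by
      ext ω; simp only [Set.mem_inter_iff, Set.mem_compl_iff, Set.mem_sdiff]; tauto
    rw [this]
    exact (hp t).diff (hA t)
  measurableSet_iUnion A hA t := by
    rw [Set.iUnion_inter]
    exact MeasurableSet.iUnion fun i => hA i t

lemma completedHistory_mono : Monotone (completedHistory P gap erased) := by
  rintro s t hst _ ⟨B, hB, hAB⟩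
  exact ⟨B, arrivalHistory_mono hst B hB, hAB⟩

lemma MeasurableSet.congr_completedHistory {t : ℝ} {A B : Set Ω}
    (hA : MeasurableSet[completedHistory P gap erased t] A) (h : B =ᵐ[P] A) :
    MeasurableSet[completedHistory P gap erased t] B :=
  EventuallyMeasurableSet.congr hA h

lemma measurableSet_completedHistory_of_arrivalHistory {t : ℝ} {A : Set Ω}
    (hA : MeasurableSet[arrivalHistory gap erased t] A) :
    MeasurableSet[completedHistory P gap erased t] A :=
  ⟨A, hA, EventuallyEq.rfl⟩

lemma IsOnlineTime.measurable_past (hp : IsOnlineTime P gap erased p) : Measurable[hp.past] p := by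
  refine measurable_of_Iic fun s t => ?_
  have : p ⁻¹' Set.Iic s ∩ {ω | p ω ≤ t} = {ω | p ω ≤ min s t} := by
    ext ω; simp
  rw [this]
  exact completedHistory_mono (min_le_right s t) _ (hp _)

lemma IsOnlineTime.past_mono (hp : IsOnlineTime P gap erased p)
    (hp' : IsOnlineTime P gap erased p') (hle : ∀ᵐ ω ∂P, p ω ≤ p' ω) : hp.past ≤ hp'.past := by
  intro A hA t
  refine MeasurableSet.congr_completedHistory ((hA t).inter (hp' t)) ?_
  filter_upwards [hle] with ω hω
  refine propext ⟨fun h => ⟨⟨h.1, hω.trans h.2⟩, h.2⟩, fun h => ⟨h.1.1, h.2⟩⟩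

lemma measurableSet_erased_arrivalHistory (i : ℕ) (t : ℝ) (E : Set Bool) :
    MeasurableSet[arrivalHistory gap erased t] (erased i ⁻¹' E) :=
  (le_iSup (fun i => MeasurableSpace.comap (erased i) ⊤) i).trans le_sup_right _
    ⟨E, trivial, rfl⟩

lemma IsOnlineTime.measurable_erased (hp : IsOnlineTime P gap erased p) (i : ℕ) :
    Measurable[hp.past] (erased i) := fun E _ t =>
  (measurableSet_completedHistory_of_arrivalHistory
    (measurableSet_erased_arrivalHistory i t E)).inter (hp t)

lemma isOnlineTime_const (c : ℝ) : IsOnlineTime P gap erased fun _ => c := fun t => by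
  by_cases hc : c ≤ t
  · simp only [hc, Set.ofPred_true]; exact @MeasurableSet.univ _ (_)
  · simp only [hc, Set.ofPred_false]; exact @MeasurableSet.empty _ (_)

variable [IsProbabilityMeasure P] {q : ℝ}

lemma measure_inter_lt_nextArrival_sub_of_completedHistory (h : IsEnvironment P q gap erased)
    {t : ℝ} (ht : 0 ≤ t) {A : Set Ω} (hA : MeasurableSet[completedHistory P gap erased t] A)
    {u : ℝ} (hu : 0 ≤ u) :
    P (A ∩ {ω | u < nextArrival gap t ω - t}) = ENNReal.ofReal (Real.exp (-u)) * P A := by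
  obtain ⟨B, hB, hAB⟩ := hA
  rw [measure_congr (hAB.inter (ae_eq_refl {ω | u < nextArrival gap t ω - t})),
    measure_inter_lt_nextArrival_sub h ht hB hu, measure_congr hAB]

lemma nullMeasurableSet_of_completedHistory (h : IsEnvironment P q gap erased) {t : ℝ} {A : Set Ω}
    (hA : MeasurableSet[completedHistory P gap erased t] A) : NullMeasurableSet A P := by
  obtain ⟨B, hB, hAB⟩ := hA
  exact (arrivalHistory_le h.measurable_gap h.measurable_erased t B hB).nullMeasurableSet.congr
    hAB.symm

lemma IsOnlineTime.nullMeasurableSet (h : IsEnvironment P q gap erased)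
    (hp : IsOnlineTime P gap erased p) {A : Set Ω} (hA : MeasurableSet[hp.past] A) :
    NullMeasurableSet A P := by
  have : A = ⋃ n : ℕ, A ∩ {ω | p ω ≤ n} := by
    rw [← Set.inter_iUnion]
    refine (Set.inter_eq_left.2 fun ω _ => Set.mem_iUnion.2 ?_).symm
    exact exists_nat_ge (p ω)
  rw [this]
  exact NullMeasurableSet.iUnion fun n => nullMeasurableSet_of_completedHistory h (hA n)

/-- The wait at the online time `p` for the next energy arrival. -/
def waitingTime (gap : ℕ → Ω → ℝ) (p : Ω → ℝ) (ω : Ω) : ℝ := nextArrival gap (p ω) ω - p ω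

lemma measurable_nextArrival_comp (hgap : ∀ k, Measurable (gap k)) (hpm : Measurable p) :
    Measurable fun ω => nextArrival gap (p ω) ω :=
  (measurable_nextArrival hgap).comp (g := fun z : ℝ × Ω => nextArrival gap z.1 z.2)
    (f := fun ω => (p ω, ω)) (hpm.prodMk measurable_id)

lemma measurable_waitingTime (hgap : ∀ k, Measurable (gap k)) (hpm : Measurable p) :
    Measurable (waitingTime gap p) :=
  (measurable_nextArrival_comp hgap hpm).sub hpm

/-- The strong Markov property for an online time with values in a grid. -/
lemma IsOnlineTime.measure_inter_grid (h : IsEnvironment P q gap erased)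
    (hp : IsOnlineTime P gap erased p) (hpm : Measurable p)
    {A : Set Ω} (hA : MeasurableSet[hp.past] A) {u : ℝ} (hu : 0 ≤ u) {c : ℝ} (hc : 0 < c) :
    P (A ∩ {ω | u < waitingTime gap (fun ω => ⌈c * p ω⌉₊ / c) ω}) =
      ENNReal.ofReal (Real.exp (-u)) * P A := by
  let D : ℕ → Set Ω := fun j => A ∩ {ω | ⌈c * p ω⌉₊ = j}
  have hD : ∀ j : ℕ, MeasurableSet[completedHistory P gap erased ((j : ℕ) / c)] (D j) := fun j => by
    have heq : D j = (A ∩ {ω | p ω ≤ j / c}) \ ⋃ i : Fin j, {ω | p ω ≤ (i : ℕ) / c} := by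
      ext ω
      simp only [D, Set.mem_inter_iff, Set.mem_sdiff, Set.mem_iUnion, Set.mem_ofPred_eq,
        le_div_iff₀' hc, ← Nat.ceil_le, and_assoc]
      refine and_congr_right fun _ => ⟨?_, ?_⟩
      · rintro rfl
        exact ⟨le_rfl, fun ⟨i, hi⟩ => absurd i.2 (not_lt.2 hi)⟩
      · rintro ⟨h1, h2⟩
        refine le_antisymm h1 ?_
        by_contra! hlt
        exact h2 ⟨⟨_, hlt⟩, le_rfl⟩
    rw [heq]
    refine (hA _).diff (MeasurableSet.iUnion fun i => completedHistory_mono ?_ _ (hp _))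
    have : ((i : ℕ) : ℝ) ≤ j := by exact_mod_cast i.2.le
    gcongr
  have hUD : ∀ B : Set Ω, A ∩ B = ⋃ j, D j ∩ B := fun B => by
    rw [← Set.iUnion_inter, ← Set.inter_iUnion]
    congr 1
    exact (Set.inter_eq_left.2 fun ω _ => Set.mem_iUnion.2 ⟨⌈c * p ω⌉₊, rfl⟩).symm
  have hdisj : ∀ B : Set Ω, Pairwise (Function.onFun (AEDisjoint P) fun j => D j ∩ B) :=
    fun B i j hij => (Set.disjoint_left.2 fun ω h1 h2 => hij (h1.1.2.symm.trans h2.1.2)).aedisjoint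
  have hw := measurable_waitingTime h.measurable_gap (p := fun ω => (⌈c * p ω⌉₊ : ℝ) / c)
    (by fun_prop)
  have hmeas := measurableSet_lt (measurable_const (a := u)) hw
  rw [hUD, measure_iUnion₀ (hdisj _)
    fun j => (nullMeasurableSet_of_completedHistory h (hD j)).inter hmeas.nullMeasurableSet]
  have hA0 : P A = ∑' j, P (D j) := by
    have := hUD Set.univ
    simp only [Set.inter_univ] at this
    conv_lhs => rw [this]
    refine measure_iUnion₀ ?_ fun j => nullMeasurableSet_of_completedHistory h (hD j)
    simpa using hdisj Set.univ
  rw [hA0, ← ENNReal.tsum_mul_left]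
  refine tsum_congr fun j => ?_
  rw [← measure_inter_lt_nextArrival_sub_of_completedHistory h (by positivity) (hD j) hu]
  congr 1
  ext ω
  refine and_congr_right fun hω => ?_
  have hω : ⌈c * p ω⌉₊ = j := hω.2
  simp only [Set.mem_ofPred_eq, waitingTime, hω]

/-- The strong Markov property: the wait for the next arrival after an online time is exponential and
independent of what is decided at that time.  The online time is approximated from the right by
times in a grid. -/
lemma IsOnlineTime.measure_inter_lt_waitingTime (h : IsEnvironment P q gap erased)
    (hp : IsOnlineTime P gap erased p) (hpm : Measurable p) (hp0 : ∀ᵐ ω ∂P, 0 ≤ p ω)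
    {A : Set Ω} (hA : MeasurableSet[hp.past] A) {u : ℝ} (hu : 0 ≤ u) :
    P (A ∩ {ω | u < waitingTime gap p ω}) = ENNReal.ofReal (Real.exp (-u)) * P A := by
  obtain ⟨A', hA'm, hAA'⟩ := hp.nullMeasurableSet h hA
  let pk : ℕ → Ω → ℝ := fun n ω => (⌈((n : ℝ) + 1) * p ω⌉₊ : ℝ) / ((n : ℝ) + 1)
  have hlim : Tendsto (fun n => P (A' ∩ {ω | u < waitingTime gap (pk n) ω})) atTop
      (nhds (P (A' ∩ {ω | u < waitingTime gap p ω}))) := by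
    refine tendsto_measure_of_ae_tendsto_indicator_of_isFiniteMeasure atTop ?_ (fun n => ?_) ?_
    · exact hA'm.inter (measurableSet_lt measurable_const
        (measurable_waitingTime h.measurable_gap hpm))
    · exact hA'm.inter (measurableSet_lt measurable_const
        (measurable_waitingTime h.measurable_gap (by fun_prop)))
    · filter_upwards [hp0, h.ae_isRegularPath] with ω hω hr
      have hge : ∀ n, p ω ≤ pk n ω := fun n => by
        rw [le_div_iff₀' (by positivity)]
        exact Nat.le_ceil _
      have hle : ∀ n, pk n ω ≤ p ω + 1 / ((n : ℝ) + 1) := fun n => by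
        have hn : (0 : ℝ) < (n : ℝ) + 1 := by positivity
        have hring : (p ω + 1 / ((n : ℝ) + 1)) * ((n : ℝ) + 1) = ((n : ℝ) + 1) * p ω + 1 := by
          field_simp
        rw [div_le_iff₀ hn, hring]
        exact (Nat.ceil_lt_add_one (by positivity)).le
      have hconv : Tendsto (fun n => pk n ω) atTop (nhds (p ω)) := by
        refine tendsto_of_tendsto_of_tendsto_of_le_of_le tendsto_const_nhds ?_ hge hle
        simpa using (tendsto_const_nhds (x := p ω)).add
          (tendsto_one_div_add_atTop_nhds_zero_nat (𝕜 := ℝ))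
      have hnext : ∀ᶠ n in atTop, nextArrival gap (pk n ω) ω = nextArrival gap (p ω) ω := by
        filter_upwards [hconv.eventually (gt_mem_nhds (hr.lt_nextArrival (p ω)))] with n hn
        exact hr.nextArrival_eq_of_lt (hge n) hn
      by_cases hu' : u < waitingTime gap p ω
      · have hclose : ∀ᶠ n in atTop, pk n ω < nextArrival gap (p ω) ω - u :=
          hconv.eventually (gt_mem_nhds (by unfold waitingTime at hu'; linarith))
        filter_upwards [hnext, hclose] with n hn1 hn2
        refine and_congr_right fun _ => ⟨fun _ => hu', fun _ => ?_⟩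
        simp only [Set.mem_ofPred_eq, waitingTime, hn1]
        linarith
      · filter_upwards [hnext] with n hn1
        refine and_congr_right fun _ => ⟨fun h1 => absurd h1 ?_, fun h1 => absurd h1 hu'⟩
        simp only [Set.mem_ofPred_eq, waitingTime, hn1, not_lt] at hu' ⊢
        linarith [hge n]
  have hconst : ∀ n, P (A' ∩ {ω | u < waitingTime gap (pk n) ω}) =
      ENNReal.ofReal (Real.exp (-u)) * P A := fun n => by
    rw [← measure_congr (hAA'.inter (ae_eq_refl {ω | u < waitingTime gap (pk n) ω}))]
    exact hp.measure_inter_grid h hpm hA hu (by positivity)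
  rw [measure_congr (hAA'.inter (ae_eq_refl {ω | u < waitingTime gap p ω}))]
  simp only [hconst] at hlim
  exact tendsto_nhds_unique hlim tendsto_const_nhds |>.symm ▸ rfl

lemma IsOnlineTime.measure_inter_waitingTime_Ioi (h : IsEnvironment P q gap erased)
    (hp : IsOnlineTime P gap erased p) (hpm : Measurable p) (hp0 : ∀ᵐ ω ∂P, 0 ≤ p ω)
    {A : Set Ω} (hA : MeasurableSet[hp.past] A) (u : ℝ) :
    P (A ∩ waitingTime gap p ⁻¹' Set.Ioi u) = P A * expMeasure 1 (Set.Ioi u) := by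
  have := isProbabilityMeasure_expMeasure (r := 1) one_pos
  rcases le_or_gt 0 u with hu | hu
  · rw [expMeasure_Ioi hu, mul_comm, ← hp.measure_inter_lt_waitingTime h hpm hp0 hA hu]
    rfl
  · have h1 : expMeasure 1 (Set.Ioi u) = 1 := by
      refine le_antisymm prob_le_one ?_
      calc (1 : ENNReal) = expMeasure 1 (Set.Ioi 0) := by rw [expMeasure_Ioi le_rfl]; simp
        _ ≤ _ := measure_mono (Set.Ioi_subset_Ioi hu.le)
    rw [h1, mul_one]
    refine measure_congr ?_
    filter_upwards [h.ae_isRegularPath] with ω hω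
    refine propext ⟨fun h => h.1, fun h => ⟨h, hu.trans ?_⟩⟩
    exact sub_pos.2 (hω.lt_nextArrival _)

lemma IsOnlineTime.map_waitingTime (h : IsEnvironment P q gap erased)
    (hp : IsOnlineTime P gap erased p) (hpm : Measurable p) (hp0 : ∀ᵐ ω ∂P, 0 ≤ p ω) :
    P.map (waitingTime gap p) = expMeasure 1 := by
  have := isProbabilityMeasure_expMeasure (r := 1) one_pos
  have hm := measurable_waitingTime h.measurable_gap hpm
  have := Measure.isProbabilityMeasure_map hm.aemeasurable (μ := P)
  refine ext_of_generate_finite _ (borel_eq_generateFrom_Ioi ℝ ▸ BorelSpace.measurable_eq)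
    isPiSystem_Ioi ?_ (by simp)
  rintro _ ⟨u, rfl⟩
  rw [Measure.map_apply hm measurableSet_Ioi]
  have := hp.measure_inter_waitingTime_Ioi h hpm hp0 (@MeasurableSet.univ _ hp.past) u
  simpa using this

lemma IsOnlineTime.measure_inter_preimage_waitingTime (h : IsEnvironment P q gap erased)
    (hp : IsOnlineTime P gap erased p) (hpm : Measurable p) (hp0 : ∀ᵐ ω ∂P, 0 ≤ p ω)
    {A : Set Ω} (hA : MeasurableSet[hp.past] A) {B : Set ℝ} (hB : MeasurableSet B) :
    P (A ∩ waitingTime gap p ⁻¹' B) = P A * expMeasure 1 B := by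
  have := isProbabilityMeasure_expMeasure (r := 1) one_pos
  have hm := measurable_waitingTime h.measurable_gap hpm
  have hAn := hp.nullMeasurableSet h hA
  have hext : (P.restrict A).map (waitingTime gap p) = P A • expMeasure 1 := by
    have : IsFiniteMeasure ((P.restrict A).map (waitingTime gap p)) :=
      Measure.isFiniteMeasure_map _ _
    refine ext_of_generate_finite _ (borel_eq_generateFrom_Ioi ℝ ▸ BorelSpace.measurable_eq)
      isPiSystem_Ioi ?_ ?_
    · rintro _ ⟨u, rfl⟩
      rw [Measure.map_apply hm measurableSet_Ioi, Measure.restrict_apply (hm measurableSet_Ioi),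
        Set.inter_comm, hp.measure_inter_waitingTime_Ioi h hpm hp0 hA u]
      simp
    · rw [Measure.map_apply hm MeasurableSet.univ]
      simp
  have := congrArg (fun μ => μ B) hext
  simpa [Measure.map_apply hm hB, Measure.restrict_apply (hm hB), Set.inter_comm] using this

/-- The wait after an online time is independent of every variable that is decided at that time. -/
lemma IsOnlineTime.indepFun_waitingTime (h : IsEnvironment P q gap erased)
    (hp : IsOnlineTime P gap erased p) (hpm : Measurable p) (hp0 : ∀ᵐ ω ∂P, 0 ≤ p ω)
    {β : Type*} [MeasurableSpace β] {Z : Ω → β} (hZ : Measurable[hp.past] Z) :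
    IndepFun Z (waitingTime gap p) P := by
  rw [indepFun_iff_measure_inter_preimage_eq_mul]
  intro s t hs ht
  rw [hp.measure_inter_preimage_waitingTime h hpm hp0 (hZ hs) ht, ← hp.map_waitingTime h hpm hp0,
    Measure.map_apply (measurable_waitingTime h.measurable_gap hpm) ht]

/-- Whether the first arrival after `p` comes by time `t` is decided by the arrivals up to time `t`
and by the position of `p` relative to earlier times. -/
lemma measurableSet_nextArrival_le {Ω : Type*} {m : MeasurableSpace Ω} [MeasurableSpace Ω]
    {P : Measure Ω} [IsProbabilityMeasure P] {q : ℝ} {gap : ℕ → Ω → ℝ} {erased : ℕ → Ω → Bool}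
    {p : Ω → ℝ} (h : IsEnvironment P q gap erased) {t : ℝ}
    (hcount : ∀ s ≤ t, MeasurableSpace.comap (arrivalCount gap s) ⊤ ≤ m)
    (hp : ∀ r < t, MeasurableSet[eventuallyMeasurableSpace m (ae P)] {ω | p ω ≤ r}) :
    MeasurableSet[eventuallyMeasurableSpace m (ae P)] {ω | nextArrival gap (p ω) ω ≤ t} := by
  have hcount' : ∀ s ≤ t, Measurable[m] (arrivalCount gap s) :=
    fun s hs => (comap_measurable (m := ⊤) (arrivalCount gap s)).mono (hcount s hs) le_top
  have hmeas : MeasurableSet[eventuallyMeasurableSpace m (ae P)]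
      (⋃ r : {r : ℚ // (r : ℝ) < t}, {ω | p ω ≤ (r : ℚ)} ∩
        {ω | arrivalCount gap (r : ℚ) ω < arrivalCount gap t ω}) :=
    MeasurableSet.iUnion fun r => (hp _ r.2).inter
      (le_eventuallyMeasurableSpace _
        (measurableSet_nat_lt (m := m) (hcount' _ r.2.le) (hcount' t le_rfl)))
  refine EventuallyMeasurableSet.congr hmeas ?_
  filter_upwards [h.ae_isRegularPath] with ω hω
  refine propext ⟨fun hle => ?_, fun hω' => ?_⟩
  · have hle : StatusUpdate.nextArrival gap (p ω) ω ≤ t := hle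
    obtain ⟨r, hr1, hr2⟩ := exists_rat_btwn (hω.lt_nextArrival (p ω))
    refine Set.mem_iUnion.2 ⟨⟨r, hr2.trans_le hle⟩, hr1.le, ?_⟩
    change arrivalCount gap (r : ℝ) ω < arrivalCount gap t ω
    rw [hω.arrivalCount_eq_of_lt_nextArrival hr1.le hr2]
    exact hω.nextArrival_le_iff.1 hle
  · obtain ⟨r, hr1, hr2⟩ := Set.mem_iUnion.1 hω'
    have hr1 : p ω ≤ (r : ℚ) := hr1
    exact hω.nextArrival_le_iff.2 ((hω.arrivalCount_mono hr1).trans_lt hr2)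

/-- The first arrival after an online time is an online time. -/
lemma IsOnlineTime.nextArrival (h : IsEnvironment P q gap erased)
    (hp : IsOnlineTime P gap erased p) :
    IsOnlineTime P gap erased fun ω => nextArrival gap (p ω) ω := fun t =>
  measurableSet_nextArrival_le h (fun s hs => (le_iSup₂ (f := fun (s : ℝ) (_ : s ≤ t) =>
      MeasurableSpace.comap (arrivalCount gap s) ⊤) s hs).trans le_sup_left)
    fun r hr => completedHistory_mono hr.le _ (hp r)

end StrongMarkov

/-! ### Integrals against the exponential law -/

lemma expMeasure_one_eq : expMeasure 1 =
    (volume.restrict (Set.Ioi 0)).withDensity fun x => ENNReal.ofReal (Real.exp (-x)) := by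
  rw [← withDensity_indicator measurableSet_Ioi]
  refine withDensity_congr_ae ?_
  have h0 : ∀ᵐ x : ℝ, x ≠ 0 := by simp [ae_iff]
  filter_upwards [h0] with x hx
  rcases lt_or_gt_of_ne hx with h | h
  · rw [gammaPDF_of_neg h, Set.indicator_of_notMem (by simpa using h.le)]
  · rw [gammaPDF_of_nonneg h.le, Set.indicator_of_mem (Set.mem_Ioi.2 h)]
    simp

lemma integral_expMeasure_one (f : ℝ → ℝ) :
    ∫ x, f x ∂expMeasure 1 = ∫ x in Set.Ioi 0, Real.exp (-x) * f x := by
  rw [expMeasure_one_eq, integral_withDensity_eq_integral_toReal_smul (by fun_prop) (by simp)]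
  simp [ENNReal.toReal_ofReal (Real.exp_pos _).le]

lemma integrable_expMeasure_one_iff (f : ℝ → ℝ) :
    Integrable f (expMeasure 1) ↔ IntegrableOn (fun x => Real.exp (-x) * f x) (Set.Ioi 0) := by
  rw [expMeasure_one_eq, integrable_withDensity_iff_integrable_smul' (by fun_prop) (by simp)]
  simp [ENNReal.toReal_ofReal (Real.exp_pos _).le, IntegrableOn]

lemma hasDerivAt_neg_exp_mul_quadratic (b x : ℝ) :
    HasDerivAt (fun x => -(Real.exp (-x) * ((x + b) ^ 2 / 2 + (x + b) + 1)))
      (Real.exp (-x) * ((x + b) ^ 2 / 2)) x := by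
  have h1 : HasDerivAt (fun x : ℝ => x + b) 1 x := (hasDerivAt_id x).add_const b
  have h2 := ((h1.pow 2).div_const 2).add h1 |>.add_const (1 : ℝ)
  have h3 : HasDerivAt (fun x => Real.exp (-x)) (-Real.exp (-x)) x := by
    simpa using (hasDerivAt_neg x).exp
  convert! (h3.mul h2).neg using 1
  simp
  ring

lemma tendsto_neg_exp_mul_quadratic (b : ℝ) :
    Tendsto (fun x => -(Real.exp (-x) * ((x + b) ^ 2 / 2 + (x + b) + 1))) atTop (nhds 0) := by
  have h : ∀ n : ℕ, Tendsto (fun x : ℝ => x ^ n * Real.exp (-x)) atTop (nhds 0) :=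
    Real.tendsto_pow_mul_exp_neg_atTop_nhds_zero
  have h2 := (((h 2).const_mul (1 / 2)).add ((h 1).const_mul (b + 1))).add
    ((h 0).const_mul (b ^ 2 / 2 + b + 1)) |>.neg
  simp only [mul_zero, add_zero, neg_zero] at h2
  refine h2.congr fun x => ?_
  ring

lemma integral_Ioi_exp_mul_sq (a b : ℝ) :
    ∫ x in Set.Ioi a, Real.exp (-x) * ((x + b) ^ 2 / 2) =
      Real.exp (-a) * ((a + b) ^ 2 / 2 + (a + b) + 1) := by
  rw [integral_Ioi_of_hasDerivAt_of_nonneg' (fun x _ => hasDerivAt_neg_exp_mul_quadratic b x)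
    (fun x _ => by positivity) (tendsto_neg_exp_mul_quadratic b)]
  ring

lemma integrable_sq_expMeasure_one : Integrable (fun x : ℝ => x ^ 2) (expMeasure 1) := by
  rw [integrable_expMeasure_one_iff]
  have := (integrableOn_Ioi_deriv_of_nonneg' (fun x _ => hasDerivAt_neg_exp_mul_quadratic 0 x)
    (fun x _ => by positivity) (tendsto_neg_exp_mul_quadratic 0) (a := 0)).const_mul 2
  refine this.congr (Eventually.of_forall fun x => ?_)
  simp only [add_zero]; ring

/-- The mean of half the squared positive part of `b + τ` for an exponential variable `τ`. -/
lemma integral_sq_posPart_expMeasure_one (b : ℝ) :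
    ∫ x, max (b + x) 0 ^ 2 / 2 ∂expMeasure 1 =
      max b 0 ^ 2 / 2 + max b 0 + Real.exp (min b 0) := by
  rw [integral_expMeasure_one]
  rcases le_total 0 b with hb | hb
  · rw [max_eq_left hb, min_eq_right hb]
    have : ∫ x in Set.Ioi (0 : ℝ), Real.exp (-x) * (max (b + x) 0 ^ 2 / 2) =
        ∫ x in Set.Ioi (0 : ℝ), Real.exp (-x) * ((x + b) ^ 2 / 2) := by
      refine setIntegral_congr_fun measurableSet_Ioi fun x hx => ?_
      have hx : 0 < x := hx
      rw [max_eq_left (show 0 ≤ b + x by linarith), add_comm b x]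
    rw [this, integral_Ioi_exp_mul_sq]
    simp
  · rw [max_eq_right hb, min_eq_left hb]
    have h1 : ∫ x in Set.Ioi (0 : ℝ), Real.exp (-x) * (max (b + x) 0 ^ 2 / 2) =
        ∫ x in Set.Ioi (-b), Real.exp (-x) * (max (b + x) 0 ^ 2 / 2) := by
      refine setIntegral_eq_of_subset_of_forall_sdiff_eq_zero measurableSet_Ioi
        (Set.Ioi_subset_Ioi (by linarith)) fun x hx => ?_
      have : x ≤ -b := not_lt.1 hx.2
      simp [max_eq_right (show b + x ≤ 0 by linarith)]
    have h2 : ∫ x in Set.Ioi (-b), Real.exp (-x) * (max (b + x) 0 ^ 2 / 2) =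
        ∫ x in Set.Ioi (-b), Real.exp (-x) * ((x + b) ^ 2 / 2) := by
      refine setIntegral_congr_fun measurableSet_Ioi fun x hx => ?_
      have hx : -b < x := hx
      rw [max_eq_left (show 0 ≤ b + x by linarith), add_comm b x]
    rw [h1, h2, integral_Ioi_exp_mul_sq]
    simp

/-! ### The value functions of the threshold rule -/

/-- The mean number of erased attempts before a success; it is also the mean time that they add to an
epoch when every attempt follows an energy arrival at once. -/
def meanRetries (q : ℝ) : ℝ := q / (1 - q)

/-- The number `γ` is the optimal threshold: the cost of an epoch under the threshold rule, relative
to the average age `γ + meanRetries q`, is zero. -/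
structure IsThreshold (q γ : ℝ) : Prop where
  pos : 0 < γ
  balance : Real.exp (-γ) + meanRetries q * (1 - γ) = γ ^ 2 / 2

lemma exists_isThreshold {q : ℝ} (hq0 : 0 < q) (hq1 : q < 1) : ∃ γ, IsThreshold q γ := by
  have hm : 0 < meanRetries q := div_pos hq0 (by linarith)
  let f : ℝ → ℝ := fun γ => γ ^ 2 / 2 - (Real.exp (-γ) + meanRetries q * (1 - γ))
  have hf : ContinuousOn f (Set.Icc 0 1) := by fun_prop
  have h0 : f 0 < 0 := by simp [f]; linarith
  have h1 : 0 < f 1 := by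
    have : Real.exp (-1) < 1 / 2 := by
      rw [Real.exp_neg, inv_lt_comm₀ (Real.exp_pos _) (by norm_num)]
      linarith [Real.exp_one_gt_d9]
    simp [f]; linarith
  obtain ⟨γ, ⟨hγ0, -⟩, hγ⟩ := intermediate_value_Ioo (zero_le_one (α := ℝ)) hf ⟨h0, h1⟩
  exact ⟨γ, hγ0, by simp only [f] at hγ; linarith⟩

/-- The area under the age in an epoch of length `s`, minus the cost of `s` units of time at the rate
`γ + meanRetries q`. -/
def epochCost (q γ s : ℝ) : ℝ := s ^ 2 / 2 - (γ + meanRetries q) * s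

/-- The least mean cost of the current epoch when the age is `a` and the battery is full. -/
def fullValue (γ a : ℝ) : ℝ := max (a - γ) 0 ^ 2 / 2 - Real.exp (-γ)

/-- The least mean cost of the current epoch when the age is `a` and the battery is empty. -/
def emptyValue (γ a : ℝ) : ℝ :=
  max (a - γ) 0 ^ 2 / 2 + max (a - γ) 0 + Real.exp (min (a - γ) 0) - Real.exp (-γ)

/-- The mean cost of the current epoch when an attempt is made at age `s` and the sensor behaves
optimally afterwards. -/
def attemptValue (q γ s : ℝ) : ℝ := (1 - q) * epochCost q γ s + q * emptyValue γ s

lemma emptyValue_zero {γ : ℝ} (hγ : 0 ≤ γ) : emptyValue γ 0 = 0 := by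
  simp [emptyValue, hγ]

/-- With an empty battery nothing can be done before the next energy arrival. -/
lemma integral_fullValue (γ a : ℝ) :
    ∫ x, fullValue γ (a + x) ∂expMeasure 1 = emptyValue γ a := by
  have := isProbabilityMeasure_expMeasure (r := 1) one_pos
  have h := integral_sq_posPart_expMeasure_one (a - γ)
  have hint : Integrable (fun x => max (a - γ + x) 0 ^ 2 / 2) (expMeasure 1) := by
    refine Integrable.mono' ((integrable_const ((a - γ) ^ 2)).add integrable_sq_expMeasure_one)
      (by fun_prop) (Eventually.of_forall fun x => ?_)
    rw [Real.norm_of_nonneg (by positivity)]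
    simp only [Pi.add_apply]
    have : max (a - γ + x) 0 ^ 2 ≤ (a - γ + x) ^ 2 := by
      rcases max_cases (a - γ + x) 0 with ⟨h, _⟩ | ⟨h, _⟩ <;> rw [h]
      simpa using sq_nonneg (a - γ + x)
    nlinarith [sq_nonneg (a - γ - x)]
  have heq : (fun x => fullValue γ (a + x)) =
      fun x => max (a - γ + x) 0 ^ 2 / 2 - Real.exp (-γ) := by
    funext x; rw [fullValue, show a + x - γ = a - γ + x by ring]
  rw [heq, integral_sub hint (integrable_const _), h, emptyValue]
  simp

lemma fullValue_mono (γ : ℝ) : Monotone (fullValue γ) := fun a b hab => by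
  unfold fullValue
  have : max (a - γ) 0 ≤ max (b - γ) 0 := max_le_max (by linarith) le_rfl
  have : 0 ≤ max (a - γ) 0 := le_max_right _ _
  gcongr

lemma attemptValue_eq_fullValue {q γ s : ℝ} (hq1 : q < 1) (h : IsThreshold q γ) (hs : γ ≤ s) :
    attemptValue q γ s = fullValue γ s := by
  have hm : (1 - q) * meanRetries q = q := by
    rw [meanRetries]; field_simp [show (1 : ℝ) - q ≠ 0 by linarith]
  rw [attemptValue, epochCost, emptyValue, fullValue, max_eq_left (by linarith),
    min_eq_right (by linarith), Real.exp_zero]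
  have hb : Real.exp (-γ) = γ ^ 2 / 2 - meanRetries q * (1 - γ) := by linarith [h.balance]
  rw [hb]
  linear_combination (-s - (1 - γ)) * hm

/-- An attempt never does better than the threshold rule. -/
lemma fullValue_le_attemptValue {q γ s : ℝ} (hq0 : 0 < q) (hq1 : q < 1) (h : IsThreshold q γ) :
    fullValue γ s ≤ attemptValue q γ s := by
  rcases le_total γ s with hs | hs
  · exact (attemptValue_eq_fullValue hq1 h hs).ge
  · have hm : (1 - q) * meanRetries q = q := by
      rw [meanRetries]; field_simp [show (1 : ℝ) - q ≠ 0 by linarith]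
    have hb : Real.exp (-γ) = γ ^ 2 / 2 - meanRetries q * (1 - γ) := by linarith [h.balance]
    rw [attemptValue, epochCost, emptyValue, fullValue, max_eq_right (by linarith),
      min_eq_left (by linarith)]
    have hexp := Real.add_one_le_exp (s - γ)
    have h1 := mul_le_mul_of_nonneg_left hexp hq0.le
    have h2 : 0 ≤ (1 - q) * (s - γ) ^ 2 := mul_nonneg (by linarith) (sq_nonneg _)
    rw [hb]
    nlinarith [congrArg (fun z => z * s) hm, congrArg (fun z => z * γ) hm]

/-! ### Stages of a policy -/

/-- The beginning of stage `n`: time `0` for `n = 0`, and the time of attempt `n - 1` otherwise. -/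
def stageStart (x : ℕ → Ω → ℝ) : ℕ → Ω → ℝ
  | 0, _ => 0
  | n + 1, ω => x n ω

/-- The time of the last success among the attempts `0, …, n - 1`, or `0` if there is none. -/
def lastSuccess (erased : ℕ → Ω → Bool) (x : ℕ → Ω → ℝ) : ℕ → Ω → ℝ
  | 0, _ => 0
  | n + 1, ω => if erased n ω = true then lastSuccess erased x n ω else x n ω

/-- Along the path `ω` every attempt waits for an energy arrival after the previous attempt. -/
structure IsFeasiblePath (gap x : ℕ → Ω → ℝ) (ω : Ω) : Prop where
  regular : IsRegularPath gap ω
  nextArrival_le : ∀ n, nextArrival gap (stageStart x n ω) ω ≤ x n ω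

section Path

variable {gap x : ℕ → Ω → ℝ} {erased : ℕ → Ω → Bool} {ω : Ω}

lemma IsFeasiblePath.stageStart_lt (h : IsFeasiblePath gap x ω) (n : ℕ) :
    stageStart x n ω < x n ω :=
  (h.regular.lt_nextArrival _).trans_le (h.nextArrival_le n)

lemma IsFeasiblePath.stageStart_strictMono (h : IsFeasiblePath gap x ω) :
    StrictMono fun n => stageStart x n ω :=
  strictMono_nat_of_lt_succ h.stageStart_lt

lemma IsFeasiblePath.lastSuccess_le (h : IsFeasiblePath gap x ω) (n : ℕ) :
    lastSuccess erased x n ω ≤ stageStart x n ω := by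
  induction n with
  | zero => exact le_rfl
  | succ n ih =>
    simp only [lastSuccess, stageStart]
    split_ifs
    · exact ih.trans (h.stageStart_lt n).le
    · exact le_rfl

lemma IsFeasiblePath.stageStart_nonneg (h : IsFeasiblePath gap x ω) (n : ℕ) :
    0 ≤ stageStart x n ω :=
  h.stageStart_strictMono.monotone (Nat.zero_le n)

lemma IsFeasiblePath.lastSuccess_nonneg (h : IsFeasiblePath gap x ω) (n : ℕ) :
    0 ≤ lastSuccess erased x n ω := by
  induction n with
  | zero => exact le_rfl
  | succ n ih =>
    simp only [lastSuccess]
    split_ifs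
    · exact ih
    · exact h.stageStart_nonneg (n + 1)

lemma IsFeasiblePath.arrivalTime_le (h : IsFeasiblePath gap x ω) (n : ℕ) :
    arrivalTime gap n ω ≤ x n ω := by
  induction n with
  | zero =>
    refine le_trans ?_ (h.nextArrival_le 0)
    exact h.regular.strictMono.monotone (Nat.zero_le _)
  | succ n ih =>
    refine le_trans ?_ (h.nextArrival_le (n + 1))
    exact h.regular.strictMono.monotone (h.regular.lt_arrivalCount_iff.2 ih)

lemma IsFeasiblePath.tendsto_stageStart (h : IsFeasiblePath gap x ω) :
    Tendsto (fun n => stageStart x n ω) atTop atTop :=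
  (tendsto_add_atTop_iff_nat 1).1
    (tendsto_atTop_mono h.arrivalTime_le h.regular.tendsto_arrivalTime)

end Path

lemma battery_le_one (gap x : ℕ → Ω → ℝ) (n : ℕ) (ω : Ω) : battery gap x n ω ≤ 1 := by
  cases n <;> exact min_le_right _ _

/-- With a unit battery, energy causality says that between two attempts there is an energy
arrival. -/
lemma forall_one_le_battery_iff {gap x : ℕ → Ω → ℝ} {ω : Ω} (h : IsRegularPath gap ω) :
    (∀ n, 1 ≤ battery gap x n ω) ↔ ∀ n, nextArrival gap (stageStart x n ω) ω ≤ x n ω := by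
  have key : ∀ n, (∀ i < n, 1 ≤ battery gap x i ω) →
      (1 ≤ battery gap x n ω ↔ nextArrival gap (stageStart x n ω) ω ≤ x n ω) := by
    intro n hn
    rw [← h.one_le_harvested_iff]
    cases n with
    | zero => simp only [battery, stageStart, le_min_iff, le_refl, and_true]; norm_cast
    | succ n =>
      have : battery gap x n ω = 1 := le_antisymm (battery_le_one gap x n ω) (hn n n.lt_succ_self)
      simp only [battery, stageStart, le_min_iff, le_refl, and_true, this, sub_self, zero_add]
      norm_cast
  refine ⟨fun hb n => (key n fun i _ => hb i).1 (hb n), fun hn n => ?_⟩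
  induction n using Nat.strong_induction_on with
  | _ n ih => exact (key n ih).2 (hn n)

section Policy

variable {P : Measure Ω} {q : ℝ} {gap x : ℕ → Ω → ℝ} {erased : ℕ → Ω → Bool}

lemma IsPolicy.ae_isFeasiblePath (hx : IsPolicy P gap erased x) (h : IsEnvironment P q gap erased) :
    ∀ᵐ ω ∂P, IsFeasiblePath gap x ω := by
  filter_upwards [h.ae_isRegularPath, hx.energy_causality] with ω h1 h2
  exact ⟨h1, (forall_one_le_battery_iff h1).1 h2⟩

lemma IsPolicy.measurable_stageStart (hx : IsPolicy P gap erased x) (n : ℕ) :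
    Measurable (stageStart x n) := by
  cases n with
  | zero => exact measurable_const
  | succ n => exact hx.measurable n

lemma measurableSet_erased (her : ∀ n, Measurable (erased n)) (n : ℕ) :
    MeasurableSet {ω | erased n ω = true} := her n (measurableSet_singleton true)

lemma IsPolicy.measurable_lastSuccess (hx : IsPolicy P gap erased x)
    (h : IsEnvironment P q gap erased) (n : ℕ) : Measurable (lastSuccess erased x n) := by
  induction n with
  | zero => exact measurable_const
  | succ n ih =>
    exact Measurable.ite (measurableSet_erased h.measurable_erased n) ih (hx.measurable n)

lemma information_le_arrivalHistory (n : ℕ) (t : ℝ) :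
    information gap erased n t ≤ arrivalHistory gap erased t :=
  sup_le_sup_left (iSup₂_le fun i _ => le_iSup (fun i => MeasurableSpace.comap (erased i) ⊤) i) _

lemma IsPolicy.isOnlineTime_stageStart (hx : IsPolicy P gap erased x) (n : ℕ) :
    IsOnlineTime P gap erased (stageStart x n) := by
  cases n with
  | zero => exact isOnlineTime_const 0
  | succ n =>
    intro t
    obtain ⟨s, hs, heq⟩ := hx.online n t
    exact ⟨s, information_le_arrivalHistory n t s hs, heq⟩

lemma measurable_ite_bool {α : Type*} {m : MeasurableSpace α} {b : α → Bool} {f g : α → ℝ}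
    (hb : Measurable b) (hf : Measurable f) (hg : Measurable g) :
    Measurable fun a => if b a = true then f a else g a :=
  Measurable.ite (hb (measurableSet_singleton true)) hf hg

lemma IsPolicy.measurable_past_lastSuccess (hx : IsPolicy P gap erased x)
    (h : IsEnvironment P q gap erased) (n : ℕ) :
    Measurable[(hx.isOnlineTime_stageStart n).past] (lastSuccess erased x n) := by
  induction n with
  | zero => exact @measurable_const _ _ _ (_) _
  | succ n ih =>
    have hle := (hx.isOnlineTime_stageStart n).past_mono (hx.isOnlineTime_stageStart (n + 1))
      ((hx.ae_isFeasiblePath h).mono fun ω hω => (hω.stageStart_lt n).le)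
    exact measurable_ite_bool ((hx.isOnlineTime_stageStart (n + 1)).measurable_erased n)
      (ih.mono hle le_rfl) (hx.isOnlineTime_stageStart (n + 1)).measurable_past

/-! ### Erasures are independent of the attempt times -/

/-- All energy arrivals and the outcomes of the attempts `0, …, n - 1`, up to null events. -/
@[reducible] def outcomeHistory (P : Measure Ω) (gap : ℕ → Ω → ℝ)
    (erased : ℕ → Ω → Bool) (n : ℕ) : MeasurableSpace Ω :=
  eventuallyMeasurableSpace ((⨆ (i : ℕ) (_ : i ∈ Set.Iio n), MeasurableSpace.comap (erased i) ⊤) ⊔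
    MeasurableSpace.comap (fun ω k => gap k ω) inferInstance) (ae P)

lemma outcomeHistory_mono : Monotone (outcomeHistory P gap erased) := by
  rintro m n hmn _ ⟨B, hB, hAB⟩
  refine ⟨B, ?_, hAB⟩
  refine sup_le_sup_right (iSup₂_le fun i hi => le_iSup₂ (f := fun (i : ℕ) (_ : i ∈ Set.Iio n) =>
    MeasurableSpace.comap (erased i) ⊤) i (hi.trans_le hmn)) _ B hB

lemma measurable_erased_outcomeHistory (n : ℕ) :
    Measurable[outcomeHistory P gap erased (n + 1)] (erased n) := fun E hE =>
  ⟨erased n ⁻¹' E, (le_iSup₂ (f := fun (i : ℕ) (_ : i ∈ Set.Iio (n + 1)) =>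
    MeasurableSpace.comap (erased i) ⊤) n (Nat.lt_succ_self n)).trans le_sup_left _ ⟨E, hE, rfl⟩,
    EventuallyEq.rfl⟩

lemma information_le (n : ℕ) (t : ℝ) : information gap erased n t ≤
    (⨆ (i : ℕ) (_ : i ∈ Set.Iio n), MeasurableSpace.comap (erased i) ⊤) ⊔
      MeasurableSpace.comap (fun ω k => gap k ω) inferInstance := by
  refine sup_le (iSup₂_le fun s _ => le_trans ?_ le_sup_right) le_sup_left
  have : arrivalCount gap s =
      (fun g : ℕ → ℝ => arrivalCount (fun k g => g k) s g) ∘ fun ω k => gap k ω := rfl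
  rw [this, ← MeasurableSpace.comap_comp]
  exact MeasurableSpace.comap_mono
    (measurable_arrivalCount_const (fun k => measurable_pi_apply k) s).comap_le

lemma IsPolicy.measurable_outcomeHistory (hx : IsPolicy P gap erased x) (n : ℕ) :
    Measurable[outcomeHistory P gap erased n] (x n) := by
  refine measurable_of_Iic fun t => ?_
  obtain ⟨s, hs, heq⟩ := hx.online n t
  exact ⟨s, information_le n t s hs, heq⟩

lemma IsPolicy.measurable_outcomeHistory_lastSuccess (hx : IsPolicy P gap erased x) (n : ℕ) :
    Measurable[outcomeHistory P gap erased n] (lastSuccess erased x n) := by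
  induction n with
  | zero => exact @measurable_const _ _ _ (_) _
  | succ n ih =>
    exact measurable_ite_bool (measurable_erased_outcomeHistory n)
      (ih.mono (outcomeHistory_mono n.le_succ) le_rfl)
      ((hx.measurable_outcomeHistory n).mono (outcomeHistory_mono n.le_succ) le_rfl)

variable [IsProbabilityMeasure P]

lemma IsEnvironment.indep_erased_outcomeHistory (h : IsEnvironment P q gap erased) (n : ℕ) :
    Indep (outcomeHistory P gap erased n) (MeasurableSpace.comap (erased n) ⊤) P := by
  have hle : ∀ i, MeasurableSpace.comap (erased i) ⊤ ≤
      MeasurableSpace.comap (fun ω k => erased k ω) inferInstance := fun i =>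
    (((measurable_pi_apply i).comp (comap_measurable fun ω k => erased k ω))).comap_le
  have hgap : MeasurableSpace.comap (fun ω k => gap k ω) inferInstance ≤ ‹MeasurableSpace Ω› :=
    (measurable_pi_lambda _ h.measurable_gap).comap_le
  have hind : Indep (MeasurableSpace.comap (erased n) ⊤)
      ((⨆ (i : ℕ) (_ : i ∈ Set.Iio n), MeasurableSpace.comap (erased i) ⊤) ⊔
        MeasurableSpace.comap (fun ω k => gap k ω) inferInstance) P := by
    refine Indep.sup_right (h.measurable_erased n).comap_le
      (iSup₂_le fun i _ => (h.measurable_erased i).comap_le) hgap ?_ ?_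
    · have := indep_iSup_of_disjoint (fun i => (h.measurable_erased i).comap_le) h.indep_erased
        (S := {n}) (T := Set.Iio n) (by simp)
      simp only [Set.mem_singleton_iff, iSup_iSup_eq_left] at this
      exact this
    · exact indep_of_indep_of_le h.indep_gap_erased.symm
        (sup_le (hle n) (iSup₂_le fun i _ => hle i)) le_rfl
  rw [Indep_iff] at hind ⊢
  rintro A E ⟨B, hB, hAB⟩ hE
  rw [measure_congr (hAB.inter (ae_eq_refl E)), measure_congr hAB, Set.inter_comm,
    hind E B hE hB, mul_comm]

lemma IsPolicy.indepFun_erased (hx : IsPolicy P gap erased x) (h : IsEnvironment P q gap erased)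
    (n : ℕ) : IndepFun (fun ω => (x n ω, lastSuccess erased x n ω)) (erased n) P :=
  indep_of_indep_of_le_left (h.indep_erased_outcomeHistory n)
    ((hx.measurable_outcomeHistory n).prodMk
      (hx.measurable_outcomeHistory_lastSuccess n)).comap_le

/-! ### The cost of one stage -/

lemma continuous_epochCost (q γ : ℝ) : Continuous (epochCost q γ) := by
  unfold epochCost; fun_prop

lemma continuous_fullValue (γ : ℝ) : Continuous (fullValue γ) := by
  unfold fullValue; fun_prop

lemma continuous_emptyValue (γ : ℝ) : Continuous (emptyValue γ) := by
  unfold emptyValue; fun_prop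

lemma continuous_attemptValue (q γ : ℝ) : Continuous (attemptValue q γ) :=
  ((continuous_epochCost q γ).const_mul _).add ((continuous_emptyValue γ).const_mul _)

lemma integrable_ite_lt {u v : Ω → ℝ} (hu : Measurable u) (hv : Measurable v)
    (huv : ∀ᵐ ω ∂P, 0 ≤ v ω ∧ v ω ≤ u ω) {G : ℝ → ℝ} (hG : Continuous G) (T : ℝ) :
    Integrable (fun ω => if u ω < T then G (u ω - v ω) else 0) P := by
  obtain ⟨C, hC⟩ := (isCompact_Icc (a := (0 : ℝ)) (b := T)).exists_bound_of_continuousOn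
    hG.continuousOn
  refine Integrable.of_bound (C := max C 0) ?_ ?_
  · exact (Measurable.ite (measurableSet_lt hu measurable_const)
      (hG.measurable.comp (hu.sub hv)) measurable_const).aestronglyMeasurable
  · filter_upwards [huv] with ω hω
    split_ifs with h
    · exact (hC _ ⟨by linarith, by linarith⟩).trans (le_max_left _ _)
    · simp

lemma IsPolicy.ae_lastSuccess (hx : IsPolicy P gap erased x) (h : IsEnvironment P q gap erased)
    (n : ℕ) : ∀ᵐ ω ∂P, 0 ≤ lastSuccess erased x n ω ∧
      lastSuccess erased x n ω ≤ stageStart x n ω ∧ lastSuccess erased x n ω ≤ x n ω := by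
  filter_upwards [hx.ae_isFeasiblePath h] with ω hω
  exact ⟨hω.lastSuccess_nonneg n, hω.lastSuccess_le n,
    (hω.lastSuccess_le n).trans (hω.stageStart_lt n).le⟩

lemma fullValue_bound {γ T s y : ℝ} (hγ : 0 ≤ γ) (hs0 : 0 ≤ s) (hsT : s ≤ T) :
    ‖fullValue γ (s + y)‖ ≤ T ^ 2 + y ^ 2 + 1 := by
  have h1 : Real.exp (-γ) ≤ 1 := by simpa using hγ
  have h2 := Real.exp_pos (-γ)
  have h3 : max (s + y - γ) 0 ^ 2 ≤ (T + |y|) ^ 2 := by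
    refine pow_le_pow_left₀ (le_max_right _ _) (max_le ?_ ?_) 2
    · linarith [le_abs_self y]
    · linarith [abs_nonneg y]
  have h4 : (T + |y|) ^ 2 ≤ 2 * T ^ 2 + 2 * y ^ 2 := by
    nlinarith [sq_nonneg (T - |y|), sq_abs y]
  have h5 := sq_nonneg (max (s + y - γ) 0)
  rw [Real.norm_eq_abs, abs_le, fullValue]
  constructor <;> nlinarith [sq_nonneg T, sq_nonneg y]

lemma IsPolicy.integrable_sq_waitingTime (hx : IsPolicy P gap erased x)
    (h : IsEnvironment P q gap erased) (n : ℕ) :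
    Integrable (fun ω => waitingTime gap (stageStart x n) ω ^ 2) P := by
  have hm := measurable_waitingTime h.measurable_gap (hx.measurable_stageStart n)
  have hint := integrable_sq_expMeasure_one
  rw [← (hx.isOnlineTime_stageStart n).map_waitingTime h (hx.measurable_stageStart n)
    ((hx.ae_isFeasiblePath h).mono fun ω hω => hω.stageStart_nonneg n),
    integrable_map_measure (by fun_prop) hm.aemeasurable] at hint
  exact hint

lemma IsPolicy.integrable_fullValue (hx : IsPolicy P gap erased x)
    (h : IsEnvironment P q gap erased) {γ : ℝ} (hγ : 0 ≤ γ) (T : ℝ) (n : ℕ) :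
    Integrable (fun ω => if stageStart x n ω < T then
      fullValue γ (nextArrival gap (stageStart x n ω) ω - lastSuccess erased x n ω) else 0) P := by
  have hw := hx.integrable_sq_waitingTime h n
  refine Integrable.mono' (((integrable_const (T ^ 2)).add hw).add (integrable_const 1)) ?_ ?_
  · refine (Measurable.ite (measurableSet_lt (hx.measurable_stageStart n) measurable_const) ?_
      measurable_const).aestronglyMeasurable
    exact (continuous_fullValue γ).measurable.comp ((measurable_nextArrival_comp h.measurable_gap
      (hx.measurable_stageStart n)).sub (hx.measurable_lastSuccess h n))
  · filter_upwards [hx.ae_lastSuccess h n] with ω hω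
    split_ifs with hT
    · have := fullValue_bound (T := T) (y := waitingTime gap (stageStart x n) ω) hγ
        (s := stageStart x n ω - lastSuccess erased x n ω) (by linarith) (by linarith)
      have heq : nextArrival gap (stageStart x n ω) ω - lastSuccess erased x n ω =
          stageStart x n ω - lastSuccess erased x n ω + waitingTime gap (stageStart x n) ω := by
        simp only [waitingTime]; ring
      rw [heq]
      exact this
    · simp only [norm_zero, Pi.add_apply]
      positivity

/-- With an empty battery the value of the epoch is the mean of its value at the next arrival; here
the strong Markov property is used. -/
lemma IsPolicy.integral_emptyValue (hx : IsPolicy P gap erased x)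
    (h : IsEnvironment P q gap erased) {γ : ℝ} (hγ : 0 ≤ γ) (T : ℝ) (n : ℕ) :
    ∫ ω, (if stageStart x n ω < T then
        emptyValue γ (stageStart x n ω - lastSuccess erased x n ω) else 0) ∂P =
      ∫ ω, (if stageStart x n ω < T then
        fullValue γ (nextArrival gap (stageStart x n ω) ω - lastSuccess erased x n ω) else 0) ∂P := by
  have := isProbabilityMeasure_expMeasure (r := 1) one_pos
  have hpm := hx.measurable_stageStart n
  have hlm := hx.measurable_lastSuccess h n
  have hwm := measurable_waitingTime h.measurable_gap hpm
  have hp0 : ∀ᵐ ω ∂P, 0 ≤ stageStart x n ω :=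
    (hx.ae_isFeasiblePath h).mono fun ω hω => hω.stageStart_nonneg n
  have hon := hx.isOnlineTime_stageStart n
  have hind := hon.indepFun_waitingTime h hpm hp0
    (hon.measurable_past.prodMk (hx.measurable_past_lastSuccess h n))
  have hmap := (indepFun_iff_map_prod_eq_prod_map_map (hpm.prodMk hlm).aemeasurable
    hwm.aemeasurable).1 hind
  rw [hon.map_waitingTime h hpm hp0] at hmap
  let K : (ℝ × ℝ) × ℝ → ℝ := fun z => if z.1.1 < T then fullValue γ (z.1.1 - z.1.2 + z.2) else 0
  have hK : Measurable K := by
    refine Measurable.ite (measurableSet_lt measurable_fst.fst measurable_const) ?_ measurable_const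
    exact (continuous_fullValue γ).measurable.comp
      ((measurable_fst.fst.sub measurable_fst.snd).add measurable_snd)
  have hKeq : ∀ ω, K ((stageStart x n ω, lastSuccess erased x n ω),
      waitingTime gap (stageStart x n) ω) = if stageStart x n ω < T then
        fullValue γ (nextArrival gap (stageStart x n ω) ω - lastSuccess erased x n ω) else 0 := by
    intro ω
    simp only [K, waitingTime]
    congr 2; ring
  have hKint := hx.integrable_fullValue h hγ T n
  simp only [← hKeq] at hKint ⊢
  have hm3 : Measurable fun ω => ((stageStart x n ω, lastSuccess erased x n ω),
      waitingTime gap (stageStart x n) ω) := (hpm.prodMk hlm).prodMk hwm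
  have hKint' : Integrable K ((P.map fun ω => (stageStart x n ω, lastSuccess erased x n ω)).prod
      (expMeasure 1)) := by
    rw [← hmap, integrable_map_measure hK.aestronglyMeasurable hm3.aemeasurable]
    exact hKint
  rw [← integral_map (f := K) hm3.aemeasurable hK.aestronglyMeasurable, hmap,
    integral_prod _ hKint', integral_map (hpm.prodMk hlm).aemeasurable
      hKint'.aestronglyMeasurable.integral_prod_right']
  refine integral_congr_ae (Eventually.of_forall fun ω => ?_)
  simp only [K]
  split_ifs
  · rw [integral_fullValue]
  · simp

/-- The mean over the outcome of an attempt, which is independent of the time of the attempt. -/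
lemma IsPolicy.integral_attemptValue (hx : IsPolicy P gap erased x)
    (h : IsEnvironment P q gap erased) (hq0 : 0 ≤ q) (γ T : ℝ) (n : ℕ) :
    ∫ ω, (if x n ω < T then (if erased n ω = true then
        emptyValue γ (x n ω - lastSuccess erased x n ω) else
        epochCost q γ (x n ω - lastSuccess erased x n ω)) else 0) ∂P =
      ∫ ω, (if x n ω < T then attemptValue q γ (x n ω - lastSuccess erased x n ω) else 0) ∂P := by
  have hxm := hx.measurable n
  have hlm := hx.measurable_lastSuccess h n
  have hae : ∀ᵐ ω ∂P, 0 ≤ lastSuccess erased x n ω ∧ lastSuccess erased x n ω ≤ x n ω :=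
    (hx.ae_lastSuccess h n).mono fun ω hω => ⟨hω.1, hω.2.2⟩
  let e : Ω → ℝ := fun ω => if erased n ω = true then 1 else 0
  have hem : Measurable e := measurable_ite_bool (h.measurable_erased n) measurable_const
    measurable_const
  have he : ∫ ω, e ω ∂P = q := by
    have h1 : e = {ω | erased n ω = true}.indicator 1 := by
      funext ω; simp [e, Set.indicator_apply]
    rw [h1, integral_indicator_one (measurableSet_erased h.measurable_erased n), measureReal_def,
      h.prob_erased, ENNReal.toReal_ofReal hq0]
  have hsplit : ∀ G : ℝ → ℝ, Continuous G →
      Integrable (fun ω => e ω * if x n ω < T then G (x n ω - lastSuccess erased x n ω) else 0) P ∧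
      ∫ ω, e ω * (if x n ω < T then G (x n ω - lastSuccess erased x n ω) else 0) ∂P =
        q * ∫ ω, (if x n ω < T then G (x n ω - lastSuccess erased x n ω) else 0) ∂P := by
    intro G hG
    have hint := integrable_ite_lt hxm hlm hae hG T
    have hind : IndepFun e
        (fun ω => if x n ω < T then G (x n ω - lastSuccess erased x n ω) else 0) P := by
      refine (hx.indepFun_erased h n).symm.comp (φ := fun b => if b = true then (1 : ℝ) else 0)
        (ψ := fun z : ℝ × ℝ => if z.1 < T then G (z.1 - z.2) else 0)
        (measurable_from_top) ?_
      exact Measurable.ite (measurableSet_lt measurable_fst measurable_const)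
        (hG.measurable.comp (measurable_fst.sub measurable_snd)) measurable_const
    have heint : Integrable e P := Integrable.of_bound (C := 1) hem.aestronglyMeasurable
      (Eventually.of_forall fun ω => by simp only [e]; split_ifs <;> simp)
    refine ⟨hind.integrable_mul heint hint, ?_⟩
    rw [hind.integral_fun_mul_eq_mul_integral hem.aestronglyMeasurable hint.aestronglyMeasurable, he]
  obtain ⟨hi1, h1⟩ := hsplit _ (continuous_emptyValue γ)
  obtain ⟨hi2, h2⟩ := hsplit _ (continuous_epochCost q γ)
  have hi3 := integrable_ite_lt hxm hlm hae (continuous_epochCost q γ) T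
  have hi4 := integrable_ite_lt hxm hlm hae (continuous_emptyValue γ) T
  have hl : ∀ ω, (if x n ω < T then (if erased n ω = true then
        emptyValue γ (x n ω - lastSuccess erased x n ω) else
        epochCost q γ (x n ω - lastSuccess erased x n ω)) else 0) =
      (e ω * (if x n ω < T then emptyValue γ (x n ω - lastSuccess erased x n ω) else 0) +
      (if x n ω < T then epochCost q γ (x n ω - lastSuccess erased x n ω) else 0)) -
      e ω * (if x n ω < T then epochCost q γ (x n ω - lastSuccess erased x n ω) else 0) := by
    intro ω
    simp only [e]
    split_ifs <;> ring
  have hr : ∀ ω, (if x n ω < T then attemptValue q γ (x n ω - lastSuccess erased x n ω) else 0) =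
      (1 - q) * (if x n ω < T then epochCost q γ (x n ω - lastSuccess erased x n ω) else 0) +
      q * (if x n ω < T then emptyValue γ (x n ω - lastSuccess erased x n ω) else 0) := by
    intro ω
    split_ifs
    · rfl
    · ring
  simp only [hl, hr]
  rw [integral_sub (hi1.fun_add hi3) hi2, integral_add hi1 hi3,
    integral_add (hi3.const_mul _) (hi4.const_mul _), integral_const_mul, integral_const_mul, h1, h2]
  ring

end Policy

/-! ### Stopping at a fixed horizon -/

/-- The stage that is under way at time `T`, which is the index of the first attempt made at time
`T` or later. -/
def horizonStage (x : ℕ → Ω → ℝ) (T : ℝ) (ω : Ω) : ℕ := sInf {n | T ≤ x n ω}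

/-- The sum of `G` over the lengths of the epochs that are completed by an attempt with index below
`n`. -/
def epochSum (erased : ℕ → Ω → Bool) (x : ℕ → Ω → ℝ) (G : ℝ → ℝ) (n : ℕ) (ω : Ω) : ℝ :=
  ∑ i ∈ Finset.range n, if erased i ω = false then G (x i ω - lastSuccess erased x i ω) else 0

/-- The cost of the epochs completed before time `T`, plus the value of the current epoch at the
first energy arrival after the last attempt made before time `T`. -/
def horizonCost (q γ : ℝ) (gap : ℕ → Ω → ℝ) (erased : ℕ → Ω → Bool) (x : ℕ → Ω → ℝ) (T : ℝ)
    (ω : Ω) : ℝ :=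
  epochSum erased x (epochCost q γ) (horizonStage x T ω) ω +
    fullValue γ (nextArrival gap (stageStart x (horizonStage x T ω) ω) ω -
      lastSuccess erased x (horizonStage x T ω) ω)

/-- The horizon cost when the process is stopped at stage `n` or at time `T`, whichever comes
first. -/
def stoppedCost (q γ : ℝ) (gap : ℕ → Ω → ℝ) (erased : ℕ → Ω → Bool) (x : ℕ → Ω → ℝ) (T : ℝ)
    (n : ℕ) (ω : Ω) : ℝ :=
  (∑ i ∈ Finset.range n, ((if x i ω < T ∧ erased i ω = false then
      epochCost q γ (x i ω - lastSuccess erased x i ω) else 0) +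
    if stageStart x i ω < T ∧ T ≤ x i ω then
      fullValue γ (nextArrival gap (stageStart x i ω) ω - lastSuccess erased x i ω) else 0)) +
  if stageStart x n ω < T then emptyValue γ (stageStart x n ω - lastSuccess erased x n ω) else 0

section Path

variable {gap x : ℕ → Ω → ℝ} {erased : ℕ → Ω → Bool} {ω : Ω} {T : ℝ}

lemma IsFeasiblePath.lt_horizonStage_iff (h : IsFeasiblePath gap x ω) (i : ℕ) :
    i < horizonStage x T ω ↔ x i ω < T := by
  have hne : {n | T ≤ x n ω}.Nonempty :=
    ((tendsto_add_atTop_iff_nat 1).2 h.tendsto_stageStart).eventually_ge_atTop T |>.exists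
  constructor
  · intro hi
    by_contra! hT
    exact absurd (Nat.sInf_le hT) (not_le.2 hi)
  · intro hi
    by_contra! hT
    have h1 : T ≤ x (horizonStage x T ω) ω := Nat.sInf_mem hne
    have h2 : x (horizonStage x T ω) ω ≤ x i ω :=
      h.stageStart_strictMono.monotone (Nat.succ_le_succ hT)
    linarith

lemma IsFeasiblePath.le_horizonStage (h : IsFeasiblePath gap x ω) :
    T ≤ x (horizonStage x T ω) ω :=
  not_lt.1 fun hlt => lt_irrefl _ ((h.lt_horizonStage_iff _).2 hlt)

lemma IsFeasiblePath.le_horizonStage_iff (h : IsFeasiblePath gap x ω) (hT : 0 < T) (i : ℕ) :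
    i ≤ horizonStage x T ω ↔ stageStart x i ω < T := by
  cases i with
  | zero => simpa [stageStart] using hT
  | succ i => exact h.lt_horizonStage_iff i

lemma IsFeasiblePath.stageStart_horizonStage_lt (h : IsFeasiblePath gap x ω) (hT : 0 < T) :
    stageStart x (horizonStage x T ω) ω < T :=
  (h.le_horizonStage_iff hT _).1 le_rfl

lemma IsFeasiblePath.sum_stage (h : IsFeasiblePath gap x ω) (hT : 0 < T) (G : ℝ → ℝ) (v : ℕ → ℝ)
    (n : ℕ) :
    ∑ i ∈ Finset.range n, ((if x i ω < T ∧ erased i ω = false then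
        G (x i ω - lastSuccess erased x i ω) else 0) +
      if stageStart x i ω < T ∧ T ≤ x i ω then v i else 0) =
    epochSum erased x G (min n (horizonStage x T ω)) ω +
      if horizonStage x T ω < n then v (horizonStage x T ω) else 0 := by
  simp only [epochSum]
  simp only [← h.lt_horizonStage_iff, ← h.le_horizonStage_iff hT, ← not_lt (a := x _ ω)]
  generalize horizonStage x T ω = N
  induction n with
  | zero => simp
  | succ n ih =>
    rw [Finset.sum_range_succ, ih]
    rcases lt_trichotomy n N with hn | rfl | hn
    · rw [min_eq_left hn.le, min_eq_left (Nat.succ_le_of_lt hn), Finset.sum_range_succ]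
      simp [hn, hn.not_gt]
    · simp
    · rw [min_eq_right hn.le, min_eq_right (by omega)]
      simp [hn, hn.not_gt, hn.not_ge, show N < n + 1 by omega]

lemma IsFeasiblePath.stoppedCost_eq (h : IsFeasiblePath gap x ω) (hT : 0 < T) (q γ : ℝ) {n : ℕ}
    (hn : horizonStage x T ω < n) :
    stoppedCost q γ gap erased x T n ω = horizonCost q γ gap erased x T ω := by
  rw [stoppedCost, horizonCost, h.sum_stage hT (epochCost q γ)
    fun i => fullValue γ (nextArrival gap (stageStart x i ω) ω - lastSuccess erased x i ω),
    min_eq_right hn.le, if_pos hn, if_neg, add_zero]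
  rw [← h.le_horizonStage_iff hT]
  omega

/-- The completed epochs fill the time up to the last success. -/
lemma epochSum_id (n : ℕ) : epochSum erased x id n ω = lastSuccess erased x n ω := by
  induction n with
  | zero => simp [epochSum, lastSuccess]
  | succ n ih =>
    rw [epochSum, Finset.sum_range_succ, ← epochSum, ih, lastSuccess]
    cases erased n ω <;> simp

lemma IsFeasiblePath.abs_epochSum_le (h : IsFeasiblePath gap x ω) (q γ : ℝ) {n : ℕ}
    (hn : n ≤ horizonStage x T ω) (hT : 0 < T) :
    |epochSum erased x (epochCost q γ) n ω| ≤ (T / 2 + |γ + meanRetries q|) * T := by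
  have h1 : |epochSum erased x (epochCost q γ) n ω| ≤
      (T / 2 + |γ + meanRetries q|) * epochSum erased x id n ω := by
    rw [epochSum, epochSum, Finset.mul_sum]
    refine (Finset.abs_sum_le_sum_abs _ _).trans (Finset.sum_le_sum fun i hi => ?_)
    split_ifs
    · have hs0 : 0 ≤ x i ω - lastSuccess erased x i ω := by
        linarith [h.lastSuccess_le (erased := erased) i, h.stageStart_lt i]
      have hsT : x i ω - lastSuccess erased x i ω ≤ T := by
        linarith [h.lastSuccess_nonneg (erased := erased) i, (h.lt_horizonStage_iff (T := T) i).1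
          ((Finset.mem_range.1 hi).trans_le hn)]
      rw [epochCost, id]
      generalize x i ω - lastSuccess erased x i ω = s at hs0 hsT
      generalize γ + meanRetries q = l
      have h2 := mul_le_mul_of_nonneg_right (le_abs_self l) hs0
      have h3 := mul_le_mul_of_nonneg_right (neg_abs_le l) hs0
      rw [abs_le]
      constructor <;> nlinarith
    · simp
  refine h1.trans (mul_le_mul_of_nonneg_left ?_ (by positivity))
  rw [epochSum_id]
  exact (h.lastSuccess_le n).trans ((h.le_horizonStage_iff hT n).1 hn).le

lemma abs_emptyValue_le {γ T s : ℝ} (hγ : 0 ≤ γ) (hs0 : 0 ≤ s) (hsT : s ≤ T) :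
    |emptyValue γ s| ≤ T ^ 2 + T + 1 := by
  have h1 : Real.exp (-γ) ≤ 1 := by simpa using hγ
  have h2 := Real.exp_pos (-γ)
  have h3 : max (s - γ) 0 ≤ T := max_le (by linarith) (by linarith)
  have h4 : 0 ≤ max (s - γ) 0 := le_max_right _ _
  have h5 : Real.exp (min (s - γ) 0) ≤ 1 := by simp
  have h6 := Real.exp_pos (min (s - γ) 0)
  have h7 : max (s - γ) 0 ^ 2 ≤ T ^ 2 := pow_le_pow_left₀ h4 h3 2
  rw [emptyValue, abs_le]
  constructor <;> nlinarith [sq_nonneg (max (s - γ) 0)]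

lemma IsFeasiblePath.abs_fullValue_le (h : IsFeasiblePath gap x ω) {γ : ℝ} (hγ : 0 ≤ γ)
    (hT : 0 < T) {n : ℕ} (hn : stageStart x n ω < T) :
    |fullValue γ (nextArrival gap (stageStart x n ω) ω - lastSuccess erased x n ω)| ≤
      T ^ 2 + waitingTime gap (fun _ => T) ω ^ 2 + 1 := by
  have h1 : nextArrival gap (stageStart x n ω) ω - lastSuccess erased x n ω ≤
      T + waitingTime gap (fun _ => T) ω := by
    simp only [waitingTime]
    linarith [h.regular.nextArrival_mono hn.le, h.lastSuccess_nonneg (erased := erased) n]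
  have h2 := fullValue_bound (y := waitingTime gap (fun _ => T) ω) hγ hT.le le_rfl
  rw [Real.norm_eq_abs, abs_le] at h2
  rw [abs_le]
  refine ⟨?_, (fullValue_mono γ h1).trans h2.2⟩
  have h3 : Real.exp (-γ) ≤ 1 := by simpa using hγ
  have h4 : -1 ≤ fullValue γ (nextArrival gap (stageStart x n ω) ω - lastSuccess erased x n ω) := by
    rw [fullValue]; linarith [sq_nonneg (max (nextArrival gap (stageStart x n ω) ω -
      lastSuccess erased x n ω - γ) 0)]
  linarith [sq_nonneg T, sq_nonneg (waitingTime gap (fun _ => T) ω)]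

lemma IsFeasiblePath.abs_stoppedCost_le (h : IsFeasiblePath gap x ω) {γ : ℝ} (hγ : 0 ≤ γ)
    (hT : 0 < T) (q : ℝ) (n : ℕ) :
    |stoppedCost q γ gap erased x T n ω| ≤ ((T / 2 + |γ + meanRetries q|) * T +
      (T ^ 2 + waitingTime gap (fun _ => T) ω ^ 2 + 1)) + (T ^ 2 + T + 1) := by
  rw [stoppedCost, h.sum_stage hT (epochCost q γ)
    fun i => fullValue γ (nextArrival gap (stageStart x i ω) ω - lastSuccess erased x i ω)]
  refine (abs_add_le _ _).trans (add_le_add ((abs_add_le _ _).trans (add_le_add ?_ ?_)) ?_)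
  · exact h.abs_epochSum_le q γ (min_le_right _ _) hT
  · split_ifs
    · exact h.abs_fullValue_le hγ hT (h.stageStart_horizonStage_lt hT)
    · rw [abs_zero]; positivity
  · split_ifs with hn
    · exact abs_emptyValue_le hγ (by linarith [h.lastSuccess_le (erased := erased) n])
        (by linarith [h.lastSuccess_nonneg (erased := erased) n])
    · rw [abs_zero]; positivity

end Path

section Policy

variable {P : Measure Ω} [IsProbabilityMeasure P] {q : ℝ} {gap x : ℕ → Ω → ℝ}
  {erased : ℕ → Ω → Bool}

/-- The mean cost of a stage is what is lost by not following the threshold rule in that stage. -/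
lemma IsPolicy.integral_stage (hx : IsPolicy P gap erased x) (h : IsEnvironment P q gap erased)
    (hq0 : 0 ≤ q) {γ : ℝ} (hγ : 0 ≤ γ) {T : ℝ} (n : ℕ) :
    Integrable (fun ω => stoppedCost q γ gap erased x T (n + 1) ω -
      stoppedCost q γ gap erased x T n ω) P ∧
    ∫ ω, (stoppedCost q γ gap erased x T (n + 1) ω - stoppedCost q γ gap erased x T n ω) ∂P =
      ∫ ω, (if x n ω < T then attemptValue q γ (x n ω - lastSuccess erased x n ω) -
        fullValue γ (nextArrival gap (stageStart x n ω) ω - lastSuccess erased x n ω) else 0) ∂P := by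
  have hxm := hx.measurable n
  have hlm := hx.measurable_lastSuccess h n
  have hae := hx.ae_lastSuccess h n
  have hax : ∀ᵐ ω ∂P, 0 ≤ lastSuccess erased x n ω ∧ lastSuccess erased x n ω ≤ x n ω :=
    hae.mono fun ω hω => ⟨hω.1, hω.2.2⟩
  let a : Ω → ℝ := fun ω => if x n ω < T then (if erased n ω = true then
    emptyValue γ (x n ω - lastSuccess erased x n ω) else
    epochCost q γ (x n ω - lastSuccess erased x n ω)) else 0
  let b : Ω → ℝ := fun ω => if stageStart x n ω < T then
    emptyValue γ (stageStart x n ω - lastSuccess erased x n ω) else 0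
  let c : Ω → ℝ := fun ω => if stageStart x n ω < T then
    fullValue γ (nextArrival gap (stageStart x n ω) ω - lastSuccess erased x n ω) else 0
  let d : Ω → ℝ := fun ω => if x n ω < T then
    fullValue γ (nextArrival gap (stageStart x n ω) ω - lastSuccess erased x n ω) else 0
  let f : Ω → ℝ := fun ω => if x n ω < T then
    attemptValue q γ (x n ω - lastSuccess erased x n ω) else 0
  have hE := integrable_ite_lt hxm hlm hax (continuous_emptyValue γ) T
  have hF := integrable_ite_lt hxm hlm hax (continuous_epochCost q γ) T
  have ha : Integrable a P := by
    refine Integrable.mono' (hE.norm.add hF.norm) ?_ (Eventually.of_forall fun ω => ?_)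
    · refine (Measurable.ite (measurableSet_lt hxm measurable_const) (measurable_ite_bool
        (h.measurable_erased n) ?_ ?_) measurable_const).aestronglyMeasurable
      · exact (continuous_emptyValue γ).measurable.comp (hxm.sub hlm)
      · exact (continuous_epochCost q γ).measurable.comp (hxm.sub hlm)
    · simp only [a, Pi.add_apply]
      split_ifs
      · exact le_add_of_nonneg_right (norm_nonneg _)
      · exact le_add_of_nonneg_left (norm_nonneg _)
      · simp
  have hb : Integrable b P := integrable_ite_lt (hx.measurable_stageStart n) hlm
    (hae.mono fun ω hω => ⟨hω.1, hω.2.1⟩) (continuous_emptyValue γ) T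
  have hc : Integrable c P := hx.integrable_fullValue h hγ T n
  have hcd : ∀ᵐ ω ∂P, d ω = if x n ω < T then c ω else 0 := by
    filter_upwards [hx.ae_isFeasiblePath h] with ω hω
    have := hω.stageStart_lt n
    simp only [c, d]
    split_ifs <;> first | rfl | (exfalso; linarith)
  have hd : Integrable d P := by
    have : Integrable ({ω | x n ω < T}.indicator c) P :=
      hc.indicator (measurableSet_lt hxm measurable_const)
    refine this.congr ?_
    filter_upwards [hcd] with ω hω
    rw [hω, Set.indicator_apply]; rfl
  have hf : Integrable f P := integrable_ite_lt hxm hlm hax (continuous_attemptValue q γ) T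
  have hstep : ∀ᵐ ω ∂P, stoppedCost q γ gap erased x T (n + 1) ω -
      stoppedCost q γ gap erased x T n ω = ((a ω - b ω) + c ω) - d ω := by
    filter_upwards [hx.ae_isFeasiblePath h] with ω hω
    have hlt := hω.stageStart_lt n
    have h0 := emptyValue_zero hγ
    simp only [stoppedCost, Finset.sum_range_succ, a, b, c, d, lastSuccess]
    rw [show stageStart x (n + 1) ω = x n ω from rfl]
    by_cases h1 : x n ω < T
    · have h2 : stageStart x n ω < T := hlt.trans h1
      cases h3 : erased n ω
      · simp [h1, h2, h0, not_le.2 h1]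
      · simp [h1, h2, not_le.2 h1]
    · by_cases h2 : stageStart x n ω < T
      · simp [h1, h2, not_lt.1 h1]; ring
      · simp [h1, h2]
  refine ⟨(((ha.sub hb).add hc).sub hd).congr (hstep.mono fun ω hω => hω.symm), ?_⟩
  have hab' : Integrable (fun ω => a ω - b ω) P := ha.sub hb
  have hab : ∫ ω, b ω ∂P = ∫ ω, c ω ∂P := hx.integral_emptyValue h hγ T n
  have haf : ∫ ω, a ω ∂P = ∫ ω, f ω ∂P := hx.integral_attemptValue h hq0 γ T n
  have hr : ∀ ω, (if x n ω < T then attemptValue q γ (x n ω - lastSuccess erased x n ω) -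
      fullValue γ (nextArrival gap (stageStart x n ω) ω - lastSuccess erased x n ω) else 0) =
      f ω - d ω := fun ω => by
    simp only [f, d]; split_ifs <;> simp
  rw [integral_congr_ae hstep, integral_sub (hab'.fun_add hc) hd,
    integral_add hab' hc, integral_sub ha hb, integral_congr_ae (Eventually.of_forall hr),
    integral_sub hf hd, hab, haf]
  ring

lemma integrable_sq_waitingTime_const (h : IsEnvironment P q gap erased) {T : ℝ} (hT : 0 ≤ T) :
    Integrable (fun ω => waitingTime gap (fun _ => T) ω ^ 2) P ∧
      ∫ ω, waitingTime gap (fun _ => T) ω ^ 2 ∂P = ∫ s, s ^ 2 ∂expMeasure 1 := by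
  have hm := measurable_waitingTime h.measurable_gap (measurable_const (a := T))
  have hint := integrable_sq_expMeasure_one
  have hmap := (isOnlineTime_const (P := P) (gap := gap) (erased := erased) T).map_waitingTime h
    measurable_const (Eventually.of_forall fun _ => hT)
  rw [← hmap, integrable_map_measure (by fun_prop) hm.aemeasurable] at hint
  refine ⟨hint, ?_⟩
  rw [← hmap, integral_map hm.aemeasurable (by fun_prop)]

lemma IsPolicy.tendsto_integral_stoppedCost (hx : IsPolicy P gap erased x)
    (h : IsEnvironment P q gap erased) (hq0 : 0 ≤ q) {γ : ℝ} (hγ : 0 ≤ γ) {T : ℝ} (hT : 0 < T) :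
    (∀ n, Integrable (stoppedCost q γ gap erased x T n) P) ∧
    Integrable (horizonCost q γ gap erased x T) P ∧
    Tendsto (fun n => ∫ ω, stoppedCost q γ gap erased x T n ω ∂P) atTop
      (nhds (∫ ω, horizonCost q γ gap erased x T ω ∂P)) := by
  have hint : ∀ n, Integrable (stoppedCost q γ gap erased x T n) P := by
    intro n
    induction n with
    | zero =>
      have : stoppedCost q γ gap erased x T 0 = fun _ => 0 := by
        funext ω; simp [stoppedCost, stageStart, lastSuccess, emptyValue_zero hγ]
      rw [this]
      exact integrable_const 0
    | succ n ih =>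
      refine (((hx.integral_stage h hq0 hγ (T := T) n).1).add ih).congr
        (Eventually.of_forall fun ω => ?_)
      simp
  have hbd := ((((integrable_const ((T / 2 + |γ + meanRetries q|) * T)).add
    (((integrable_const (T ^ 2)).add (integrable_sq_waitingTime_const h hT.le).1).add
      (integrable_const (1 : ℝ)))).add (integrable_const (T ^ 2 + T + 1))) :
      Integrable _ P)
  have hbound : ∀ n, ∀ᵐ ω ∂P, ‖stoppedCost q γ gap erased x T n ω‖ ≤ _ := fun n =>
    (hx.ae_isFeasiblePath h).mono fun ω hω => hω.abs_stoppedCost_le hγ hT q n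
  have hlim : ∀ᵐ ω ∂P, Tendsto (fun n => stoppedCost q γ gap erased x T n ω) atTop
      (nhds (horizonCost q γ gap erased x T ω)) := by
    filter_upwards [hx.ae_isFeasiblePath h] with ω hω
    refine tendsto_const_nhds.congr' ?_
    filter_upwards [eventually_gt_atTop (horizonStage x T ω)] with n hn
    exact (hω.stoppedCost_eq hT q γ hn).symm
  refine ⟨hint, ?_, tendsto_integral_of_dominated_convergence _
    (fun n => (hint n).aestronglyMeasurable) hbd hbound hlim⟩
  refine Integrable.mono' hbd
    (aestronglyMeasurable_of_tendsto_ae atTop (fun n => (hint n).aestronglyMeasurable) hlim) ?_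
  filter_upwards [hx.ae_isFeasiblePath h] with ω hω
  rw [← hω.stoppedCost_eq hT q γ (Nat.lt_succ_self _)]
  exact hω.abs_stoppedCost_le hγ hT q _

/-- No policy has a negative mean horizon cost. -/
lemma IsPolicy.integral_horizonCost_nonneg (hx : IsPolicy P gap erased x)
    (h : IsEnvironment P q gap erased) (hq0 : 0 < q) (hq1 : q < 1) {γ : ℝ} (hγ : IsThreshold q γ)
    {T : ℝ} (hT : 0 < T) : 0 ≤ ∫ ω, horizonCost q γ gap erased x T ω ∂P := by
  obtain ⟨hint, -, hlim⟩ := hx.tendsto_integral_stoppedCost h hq0.le hγ.pos.le hT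
  refine ge_of_tendsto' hlim fun n => ?_
  induction n with
  | zero => simp [stoppedCost, stageStart, lastSuccess, emptyValue_zero hγ.pos.le]
  | succ n ih =>
    have h1 := (hx.integral_stage h hq0.le hγ.pos.le (T := T) n).2
    rw [integral_sub (hint _) (hint _)] at h1
    have h2 : 0 ≤ ∫ ω, (if x n ω < T then attemptValue q γ (x n ω - lastSuccess erased x n ω) -
        fullValue γ (nextArrival gap (stageStart x n ω) ω - lastSuccess erased x n ω)
        else 0) ∂P := by
      refine integral_nonneg_of_ae ?_
      filter_upwards [hx.ae_isFeasiblePath h] with ω hω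
      simp only [Pi.zero_apply]
      split_ifs
      · have h3 : fullValue γ (nextArrival gap (stageStart x n ω) ω - lastSuccess erased x n ω) ≤
            fullValue γ (x n ω - lastSuccess erased x n ω) :=
          fullValue_mono γ (by linarith [hω.nextArrival_le n])
        linarith [fullValue_le_attemptValue (s := x n ω - lastSuccess erased x n ω) hq0 hq1 hγ]
      · exact le_rfl
    linarith

/-- A policy that follows the threshold rule has mean horizon cost zero. -/
lemma IsPolicy.integral_horizonCost_eq_zero (hx : IsPolicy P gap erased x)
    (h : IsEnvironment P q gap erased) (hq0 : 0 < q) (hq1 : q < 1) {γ : ℝ} (hγ : IsThreshold q γ)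
    (hrule : ∀ᵐ ω ∂P, ∀ n, x n ω =
      max (nextArrival gap (stageStart x n ω) ω) (lastSuccess erased x n ω + γ))
    {T : ℝ} (hT : 0 < T) : ∫ ω, horizonCost q γ gap erased x T ω ∂P = 0 := by
  obtain ⟨hint, -, hlim⟩ := hx.tendsto_integral_stoppedCost h hq0.le hγ.pos.le hT
  refine tendsto_nhds_unique hlim ?_
  suffices h0 : ∀ n, ∫ ω, stoppedCost q γ gap erased x T n ω ∂P = 0 by
    simp only [h0]; exact tendsto_const_nhds
  intro n
  induction n with
  | zero => simp [stoppedCost, stageStart, lastSuccess, emptyValue_zero hγ.pos.le]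
  | succ n ih =>
    have h1 := (hx.integral_stage h hq0.le hγ.pos.le (T := T) n).2
    rw [integral_sub (hint _) (hint _), ih, sub_zero] at h1
    rw [h1]
    refine integral_eq_zero_of_ae ?_
    filter_upwards [hrule] with ω hω
    simp only [Pi.zero_apply]
    split_ifs
    · rw [hω n, attemptValue_eq_fullValue hq1 hγ, fullValue, fullValue, sub_eq_zero]
      · congr 3
        rcases max_cases (nextArrival gap (stageStart x n ω) ω)
          (lastSuccess erased x n ω + γ) with ⟨h3, h4⟩ | ⟨h3, h4⟩
        · rw [h3]
        · rw [h3, max_eq_right (by linarith), max_eq_right (by linarith)]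
      · linarith [le_max_right (nextArrival gap (stageStart x n ω) ω)
          (lastSuccess erased x n ω + γ)]
    · rfl

end Policy

/-! ### Horizon cost and age of information -/

section Path

variable {gap x : ℕ → Ω → ℝ} {erased : ℕ → Ω → Bool} {ω : Ω} {T : ℝ}

lemma lastSuccess_eq_successTime (n : ℕ) : lastSuccess erased x n ω =
    successTime erased x (Nat.count (fun n => erased n ω = false) n) ω := by
  induction n with
  | zero => simp [lastSuccess, successTime]
  | succ n ih =>
    rw [lastSuccess, Nat.count_succ]
    cases h : erased n ω
    · simp only [if_true, successTime]
      rw [Nat.nth_count h]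
      simp
    · simpa using ih

lemma epochSum_eq_sum_epochLength (G : ℝ → ℝ) (n : ℕ) : epochSum erased x G n ω =
    ∑ j ∈ Finset.range (Nat.count (fun n => erased n ω = false) n),
      G (epochLength erased x j ω) := by
  induction n with
  | zero => simp [epochSum]
  | succ n ih =>
    rw [epochSum, Finset.sum_range_succ, ← epochSum, ih, Nat.count_succ]
    cases h : erased n ω
    · simp only [if_true, Finset.sum_range_succ, add_right_inj]
      rw [epochLength, ← lastSuccess_eq_successTime, successTime, Nat.nth_count h]
    · simp

lemma IsFeasiblePath.successCount_eq (h : IsFeasiblePath gap x ω)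
    (hs : ∃ᶠ n in atTop, erased n ω = false) (hT : 0 < T) : successCount erased x T ω =
      Nat.count (fun n => erased n ω = false) (horizonStage x T ω) := by
  have hinf := Nat.frequently_atTop_iff_infinite.1 hs
  refine IsGreatest.csSup_eq ⟨?_, ?_⟩
  · change successTime erased x _ ω < T
    rw [← lastSuccess_eq_successTime]
    exact (h.lastSuccess_le _).trans_lt (h.stageStart_horizonStage_lt hT)
  · intro j hj
    by_contra! hlt
    obtain ⟨i, rfl⟩ : ∃ i, j = i + 1 := ⟨j - 1, by omega⟩
    have h1 : horizonStage x T ω ≤ Nat.nth (fun n => erased n ω = false) i :=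
      (Nat.le_nth_count hinf _).trans ((Nat.nth_strictMono hinf).monotone (by omega))
    have h2 : x (Nat.nth (fun n => erased n ω = false) i) ω < T := hj
    exact absurd ((h.lt_horizonStage_iff _).2 h2) (not_lt.2 h1)

lemma IsFeasiblePath.ageArea_eq (h : IsFeasiblePath gap x ω)
    (hs : ∃ᶠ n in atTop, erased n ω = false) (hT : 0 < T) : ageArea erased x T ω =
      epochSum erased x (fun s => 1 / 2 * s ^ 2) (horizonStage x T ω) ω +
        1 / 2 * (T - lastSuccess erased x (horizonStage x T ω) ω) ^ 2 := by
  rw [ageArea, h.successCount_eq hs hT, epochSum_eq_sum_epochLength, lastSuccess_eq_successTime]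

/-- The area minus the cost of time, split over the completed epochs and the current one. -/
lemma IsFeasiblePath.ageArea_sub_eq (h : IsFeasiblePath gap x ω)
    (hs : ∃ᶠ n in atTop, erased n ω = false) (hT : 0 < T) (q γ : ℝ) :
    ageArea erased x T ω - (γ + meanRetries q) * T =
      epochSum erased x (epochCost q γ) (horizonStage x T ω) ω +
        epochCost q γ (T - lastSuccess erased x (horizonStage x T ω) ω) := by
  have h1 : epochSum erased x (epochCost q γ) (horizonStage x T ω) ω =
      epochSum erased x (fun s => 1 / 2 * s ^ 2) (horizonStage x T ω) ω -
        (γ + meanRetries q) * epochSum erased x id (horizonStage x T ω) ω := by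
    simp only [epochSum, Finset.mul_sum, ← Finset.sum_sub_distrib]
    refine Finset.sum_congr rfl fun i _ => ?_
    split_ifs
    · simp only [epochCost, id]; ring
    · simp
  rw [h.ageArea_eq hs hT, h1, epochSum_id, epochCost]
  ring

lemma ageArea_nonneg (T : ℝ) : 0 ≤ ageArea erased x T ω := by
  unfold ageArea; positivity

lemma IsFeasiblePath.sq_le_ageArea (h : IsFeasiblePath gap x ω)
    (hs : ∃ᶠ n in atTop, erased n ω = false) (hT : 0 < T) :
    1 / 2 * (T - lastSuccess erased x (horizonStage x T ω) ω) ^ 2 ≤ ageArea erased x T ω := by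
  rw [h.ageArea_eq hs hT, epochSum]
  refine le_add_of_nonneg_left (Finset.sum_nonneg fun i _ => ?_)
  split_ifs <;> positivity

/-- The value of the current epoch at the first arrival after the last attempt exceeds its cost up
to time `T` by little: the linear term in the age is absorbed by the area. -/
lemma IsFeasiblePath.horizonCost_le (h : IsFeasiblePath gap x ω)
    (hs : ∃ᶠ n in atTop, erased n ω = false) (hT : 0 < T) {q γ : ℝ} (hγ : 0 ≤ γ) {ε : ℝ}
    (hε : 0 < ε) :
    horizonCost q γ gap erased x T ω ≤ (1 + 2 * ε) * ageArea erased x T ω -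
      (γ + meanRetries q) * T + ((1 / 2 + 1 / (2 * ε)) * waitingTime gap (fun _ => T) ω ^ 2 +
        (γ + meanRetries q) ^ 2 / (2 * ε)) := by
  have h1 := h.ageArea_sub_eq hs hT q γ
  have h2 := h.sq_le_ageArea hs hT
  set a := T - lastSuccess erased x (horizonStage x T ω) ω with ha
  set σ := waitingTime gap (fun _ => T) ω with hσ
  set l := γ + meanRetries q with hl
  have hT' := h.stageStart_horizonStage_lt hT
  have hlast := h.lastSuccess_le (erased := erased) (horizonStage x T ω)
  have hσ0 : 0 ≤ σ := by
    simp only [hσ, waitingTime]; linarith [h.regular.lt_nextArrival T]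
  have h3 : fullValue γ (nextArrival gap (stageStart x (horizonStage x T ω) ω) ω -
      lastSuccess erased x (horizonStage x T ω) ω) ≤ (a + σ) ^ 2 / 2 := by
    refine (fullValue_mono γ (b := a + σ) ?_).trans ?_
    · simp only [ha, hσ, waitingTime]
      linarith [h.regular.nextArrival_mono hT'.le]
    · rw [fullValue]
      have : max (a + σ - γ) 0 ^ 2 ≤ (a + σ) ^ 2 :=
        pow_le_pow_left₀ (le_max_right _ _) (max_le (by linarith) (by linarith)) 2
      linarith [Real.exp_pos (-γ)]
  have h4 : (a + σ) ^ 2 / 2 - epochCost q γ a ≤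
      ε * a ^ 2 + ((1 / 2 + 1 / (2 * ε)) * σ ^ 2 + l ^ 2 / (2 * ε)) := by
    rw [epochCost, ← hl]
    have h5 : 0 ≤ (2 * ε * a - (σ + l)) ^ 2 / (4 * ε) := by positivity
    have h6 : (2 * ε * a - (σ + l)) ^ 2 / (4 * ε) =
        ε * a ^ 2 - a * (σ + l) + (σ + l) ^ 2 / (4 * ε) := by field_simp; ring
    have h7 : (σ + l) ^ 2 / (4 * ε) ≤ (2 * σ ^ 2 + 2 * l ^ 2) / (4 * ε) := by
      gcongr; nlinarith [sq_nonneg (σ - l)]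
    have h8 : (2 * σ ^ 2 + 2 * l ^ 2) / (4 * ε) = 1 / (2 * ε) * σ ^ 2 + l ^ 2 / (2 * ε) := by
      field_simp; ring
    linarith
  rw [horizonCost]
  nlinarith

lemma IsFeasiblePath.ageArea_le (h : IsFeasiblePath gap x ω)
    (hs : ∃ᶠ n in atTop, erased n ω = false) (hT : 0 < T) {q γ : ℝ} (hγ0 : 0 ≤ γ)
    (hm : 0 ≤ meanRetries q)
    (hrule : ∀ n, x n ω = max (nextArrival gap (stageStart x n ω) ω)
      (lastSuccess erased x n ω + γ)) :
    ageArea erased x T ω ≤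
      (γ + meanRetries q) * T + horizonCost q γ gap erased x T ω + (γ ^ 2 / 2 + 1) := by
  have h1 := h.ageArea_sub_eq hs hT q γ
  rw [horizonCost]
  set N := horizonStage x T ω
  have hT' := h.le_horizonStage (T := T)
  have hlast := (h.lastSuccess_le (erased := erased) N).trans (h.stageStart_horizonStage_lt hT).le
  -- the attempt that follows time `T` is late only because of the threshold
  have h2 : fullValue γ (T - lastSuccess erased x N ω) ≤
      fullValue γ (nextArrival gap (stageStart x N ω) ω - lastSuccess erased x N ω) := by
    refine (fullValue_mono γ (b := x N ω - lastSuccess erased x N ω) (by linarith)).trans ?_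
    rw [hrule N]
    rcases max_cases (nextArrival gap (stageStart x N ω) ω) (lastSuccess erased x N ω + γ) with
      ⟨h3, h4⟩ | ⟨h3, h4⟩
    · rw [h3]
    · rw [h3, fullValue, fullValue, add_sub_cancel_left, sub_self, max_self]
      have := sq_nonneg
        (max (nextArrival gap (stageStart x N ω) ω - lastSuccess erased x N ω - γ) 0)
      linarith
  have h3 : epochCost q γ (T - lastSuccess erased x N ω) ≤
      fullValue γ (T - lastSuccess erased x N ω) + (γ ^ 2 / 2 + 1) := by
    have hexp : Real.exp (-γ) ≤ 1 := by simpa using hγ0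
    have ha : 0 ≤ T - lastSuccess erased x N ω := by linarith
    rw [epochCost, fullValue]
    generalize T - lastSuccess erased x N ω = a at ha
    have hma := mul_nonneg hm ha
    rcases le_total γ a with hγa | hγa
    · rw [max_eq_left (by linarith)]; nlinarith
    · rw [max_eq_right (by linarith)]; nlinarith
  linarith

end Path

/-! ### The optimal average age -/

section Policy

variable {P : Measure Ω} [IsProbabilityMeasure P] {q : ℝ} {gap x : ℕ → Ω → ℝ}
  {erased : ℕ → Ω → Bool}

lemma ofReal_integral_le_lintegral_ofReal {f : Ω → ℝ} (hf : Integrable f P) :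
    ENNReal.ofReal (∫ ω, f ω ∂P) ≤ ∫⁻ ω, ENNReal.ofReal (f ω) ∂P := by
  rw [integral_eq_lintegral_pos_part_sub_lintegral_neg_part hf]
  refine (ENNReal.ofReal_le_ofReal (sub_le_self _ ENNReal.toReal_nonneg)).trans ?_
  exact ENNReal.ofReal_toReal_le

/-- Every policy has average age at least `γ + meanRetries q`. -/
lemma IsPolicy.le_averageAge (hx : IsPolicy P gap erased x) (h : IsEnvironment P q gap erased)
    (hq0 : 0 < q) (hq1 : q < 1) {γ : ℝ} (hγ : IsThreshold q γ) :
    ENNReal.ofReal (γ + meanRetries q) ≤ averageAge P erased x := by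
  set l := γ + meanRetries q with hl
  have key : ∀ ε : ℝ, 0 < ε → ENNReal.ofReal (l / (1 + 2 * ε)) ≤ averageAge P erased x := by
    intro ε hε
    set M := ∫ s, s ^ 2 ∂expMeasure 1
    set c := (1 / 2 + 1 / (2 * ε)) * M + l ^ 2 / (2 * ε) with hc
    have hbound : ∀ T : ℝ, 0 < T → ENNReal.ofReal ((l - c / T) / (1 + 2 * ε)) ≤
        (∫⁻ ω, ENNReal.ofReal (ageArea erased x T ω) ∂P) / ENNReal.ofReal T := by
      intro T hT
      obtain ⟨hw, hwM⟩ := integrable_sq_waitingTime_const h hT.le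
      rw [show ∫ s, s ^ 2 ∂expMeasure 1 = M from rfl] at hwM
      obtain ⟨-, hH, -⟩ := hx.tendsto_integral_stoppedCost h hq0.le hγ.pos.le hT
      have hH0 := hx.integral_horizonCost_nonneg h hq0 hq1 hγ hT
      have hint : Integrable (fun ω => (l * T + horizonCost q γ gap erased x T ω -
          ((1 / 2 + 1 / (2 * ε)) * waitingTime gap (fun _ => T) ω ^ 2 + l ^ 2 / (2 * ε))) /
            (1 + 2 * ε)) P :=
        ((((integrable_const _).add hH).sub
          ((hw.const_mul _).add (integrable_const _))).div_const _)
      have hval : (l * T - c) / (1 + 2 * ε) ≤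
          ∫ ω, (l * T + horizonCost q γ gap erased x T ω -
          ((1 / 2 + 1 / (2 * ε)) * waitingTime gap (fun _ => T) ω ^ 2 + l ^ 2 / (2 * ε))) /
            (1 + 2 * ε) ∂P := by
        rw [integral_div, integral_sub ((integrable_const _).fun_add hH)
          ((hw.const_mul _).fun_add (integrable_const _)), integral_add (integrable_const _) hH,
          integral_add (hw.const_mul _) (integrable_const _)]
        simp only [integral_const_mul, hwM, integral_const, probReal_univ, one_smul]
        gcongr
        linarith
      have hle : ENNReal.ofReal ((l * T - c) / (1 + 2 * ε)) ≤
          ∫⁻ ω, ENNReal.ofReal (ageArea erased x T ω) ∂P := by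
        refine (ENNReal.ofReal_le_ofReal hval).trans
          ((ofReal_integral_le_lintegral_ofReal hint).trans (lintegral_mono_ae ?_))
        filter_upwards [hx.ae_isFeasiblePath h, h.ae_frequently_success hq1] with ω hω hs
        refine ENNReal.ofReal_le_ofReal ?_
        rw [div_le_iff₀' (by positivity)]
        linarith [hω.horizonCost_le hs hT (q := q) hγ.pos.le hε]
      rw [ENNReal.le_div_iff_mul_le (by simp [hT]) (by simp), ← ENNReal.ofReal_mul' hT.le]
      refine le_trans (le_of_eq ?_) hle
      congr 1
      field_simp
    have hlim : Tendsto (fun T : ℝ => ENNReal.ofReal ((l - c / T) / (1 + 2 * ε))) atTop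
        (nhds (ENNReal.ofReal (l / (1 + 2 * ε)))) := by
      refine ENNReal.tendsto_ofReal (Tendsto.div_const ?_ _)
      simpa using tendsto_const_nhds.sub ((tendsto_const_nhds (x := c)).div_atTop tendsto_id)
    rw [← hlim.limsup_eq]
    exact limsup_le_limsup ((eventually_gt_atTop 0).mono hbound)
  have hlim : Tendsto (fun ε : ℝ => ENNReal.ofReal (l / (1 + 2 * ε))) (nhdsWithin 0 (Set.Ioi 0))
      (nhds (ENNReal.ofReal l)) := by
    have : ContinuousAt (fun ε : ℝ => l / (1 + 2 * ε)) 0 :=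
      ContinuousAt.div continuousAt_const (by fun_prop) (by norm_num)
    have h2 := this.tendsto
    simp only [mul_zero, add_zero, div_one] at h2
    exact ENNReal.tendsto_ofReal (h2.mono_left nhdsWithin_le_nhds)
  exact le_of_tendsto hlim (eventually_mem_nhdsWithin.mono fun ε hε => key ε hε)

/-- The threshold rule has average age at most `γ + meanRetries q`. -/
lemma IsPolicy.averageAge_le (hx : IsPolicy P gap erased x) (h : IsEnvironment P q gap erased)
    (hq0 : 0 < q) (hq1 : q < 1) {γ : ℝ} (hγ : IsThreshold q γ)
    (hrule : ∀ᵐ ω ∂P, ∀ n, x n ω =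
      max (nextArrival gap (stageStart x n ω) ω) (lastSuccess erased x n ω + γ)) :
    averageAge P erased x ≤ ENNReal.ofReal (γ + meanRetries q) := by
  set l := γ + meanRetries q with hl
  have hm : 0 ≤ meanRetries q := div_nonneg hq0.le (by linarith)
  set c := γ ^ 2 / 2 + 1
  have hbound : ∀ T : ℝ, 0 < T →
      (∫⁻ ω, ENNReal.ofReal (ageArea erased x T ω) ∂P) / ENNReal.ofReal T ≤
        ENNReal.ofReal (l + c / T) := by
    intro T hT
    obtain ⟨-, hH, -⟩ := hx.tendsto_integral_stoppedCost h hq0.le hγ.pos.le hT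
    have hH0 := hx.integral_horizonCost_eq_zero h hq0 hq1 hγ hrule hT
    have hint : Integrable (fun ω => l * T + horizonCost q γ gap erased x T ω + c) P :=
      ((integrable_const _).add hH).add (integrable_const _)
    have hle : ∀ᵐ ω ∂P, ageArea erased x T ω ≤ l * T + horizonCost q γ gap erased x T ω + c := by
      filter_upwards [hx.ae_isFeasiblePath h, h.ae_frequently_success hq1, hrule] with ω hω hs hr
      exact hω.ageArea_le hs hT hγ.pos.le hm hr
    rw [ENNReal.div_le_iff (by simp [hT]) (by simp), ← ENNReal.ofReal_mul' hT.le]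
    calc ∫⁻ ω, ENNReal.ofReal (ageArea erased x T ω) ∂P
        ≤ ∫⁻ ω, ENNReal.ofReal (l * T + horizonCost q γ gap erased x T ω + c) ∂P :=
          lintegral_mono_ae (hle.mono fun ω hω => ENNReal.ofReal_le_ofReal hω)
      _ = ENNReal.ofReal (∫ ω, (l * T + horizonCost q γ gap erased x T ω + c) ∂P) :=
          (ofReal_integral_eq_lintegral_ofReal hint
            (hle.mono fun ω hω => (ageArea_nonneg T).trans hω)).symm
      _ = ENNReal.ofReal ((l + c / T) * T) := by
          rw [integral_add ((integrable_const _).fun_add hH) (integrable_const _),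
            integral_add (integrable_const _) hH, hH0]
          simp only [integral_const, probReal_univ, one_smul]
          congr 1
          field_simp
          ring
  have hlim : Tendsto (fun T : ℝ => ENNReal.ofReal (l + c / T)) atTop (nhds (ENNReal.ofReal l)) := by
    refine ENNReal.tendsto_ofReal ?_
    simpa using tendsto_const_nhds.add ((tendsto_const_nhds (x := c)).div_atTop tendsto_id)
  rw [← hlim.limsup_eq]
  exact limsup_le_limsup ((eventually_gt_atTop 0).mono hbound)

end Policy

/-! ### The threshold policy -/

/-- The pair of the time of the latest attempt before attempt `n` and of the latest success under the
threshold policy. -/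
def thresholdState (gap : ℕ → Ω → ℝ) (erased : ℕ → Ω → Bool) (γ : ℝ) : ℕ → Ω → ℝ × ℝ
  | 0, _ => (0, 0)
  | n + 1, ω =>
    let s := thresholdState gap erased γ n ω
    let t := max (nextArrival gap s.1 ω) (s.2 + γ)
    (t, if erased n ω = true then s.2 else t)

/-- The threshold policy: an attempt is made as soon as there is energy and the age is at least
`γ`. -/
def thresholdPolicy (gap : ℕ → Ω → ℝ) (erased : ℕ → Ω → Bool) (γ : ℝ) (n : ℕ) (ω : Ω) : ℝ :=
  (thresholdState gap erased γ (n + 1) ω).1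

section

variable {gap : ℕ → Ω → ℝ} {erased : ℕ → Ω → Bool} {γ : ℝ}

lemma thresholdState_fst (n : ℕ) (ω : Ω) : (thresholdState gap erased γ n ω).1 =
    stageStart (thresholdPolicy gap erased γ) n ω := by
  cases n <;> rfl

lemma thresholdState_snd (n : ℕ) (ω : Ω) : (thresholdState gap erased γ n ω).2 =
    lastSuccess erased (thresholdPolicy gap erased γ) n ω := by
  induction n with
  | zero => rfl
  | succ n ih => rw [lastSuccess, ← ih]; rfl

lemma thresholdPolicy_eq (n : ℕ) (ω : Ω) : thresholdPolicy gap erased γ n ω =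
    max (nextArrival gap (stageStart (thresholdPolicy gap erased γ) n ω) ω)
      (lastSuccess erased (thresholdPolicy gap erased γ) n ω + γ) := by
  rw [← thresholdState_fst, ← thresholdState_snd]; rfl

lemma IsRegularPath.isFeasiblePath_thresholdPolicy {ω : Ω} (h : IsRegularPath gap ω) :
    IsFeasiblePath gap (thresholdPolicy gap erased γ) ω :=
  ⟨h, fun n => by rw [thresholdPolicy_eq]; exact le_max_left _ _⟩

lemma measurable_thresholdState (hgap : ∀ k, Measurable (gap k)) (her : ∀ n, Measurable (erased n))
    (n : ℕ) : Measurable (thresholdState gap erased γ n) := by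
  induction n with
  | zero => exact measurable_const
  | succ n ih =>
    have hmax := (measurable_nextArrival_comp hgap ih.fst).max (ih.snd.add_const γ)
    exact hmax.prodMk (measurable_ite_bool (her n) ih.snd hmax)

variable {P : Measure Ω} [IsProbabilityMeasure P] {q : ℝ}

lemma information_mono {m n : ℕ} {s t : ℝ} (hmn : m ≤ n) (hst : s ≤ t) :
    information gap erased m s ≤ information gap erased n t := by
  refine sup_le_sup (iSup₂_le fun r hr => le_iSup₂ (f := fun (s : ℝ) (_ : s ≤ t) =>
    MeasurableSpace.comap (arrivalCount gap s) ⊤) r (hr.trans hst)) (iSup₂_le fun i hi => ?_)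
  exact le_iSup₂ (f := fun (i : ℕ) (_ : i < n) =>
    MeasurableSpace.comap (erased i) ⊤) i (hi.trans_le hmn)

lemma measurableSet_erased_information (n : ℕ) (t : ℝ) (b : Bool) :
    MeasurableSet[information gap erased (n + 1) t] {ω | erased n ω = b} :=
  (le_iSup₂ (f := fun (i : ℕ) (_ : i < n + 1) => MeasurableSpace.comap (erased i) ⊤) n
    n.lt_succ_self).trans le_sup_right _ ⟨{b}, trivial, rfl⟩

/-- At time `t` the sensor knows whether the attempts and successes of the threshold policy have
taken place. -/
lemma measurableSet_thresholdPolicy_le (h : IsEnvironment P q gap erased) (hγ : 0 ≤ γ) (n : ℕ) :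
    ∀ t, MeasurableSet[eventuallyMeasurableSpace (information gap erased n t) (ae P)]
        {ω | thresholdPolicy gap erased γ n ω ≤ t} ∧
      MeasurableSet[eventuallyMeasurableSpace (information gap erased n t) (ae P)]
        {ω | lastSuccess erased (thresholdPolicy gap erased γ) n ω ≤ t} := by
  have hmono : ∀ {m n : ℕ} {s t : ℝ}, m ≤ n → s ≤ t → ∀ A,
      MeasurableSet[eventuallyMeasurableSpace (information gap erased m s) (ae P)] A →
      MeasurableSet[eventuallyMeasurableSpace (information gap erased n t) (ae P)] A := by
    rintro m n s t hmn hst A ⟨B, hB, hAB⟩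
    exact ⟨B, information_mono hmn hst B hB, hAB⟩
  have hconst : ∀ (m : MeasurableSpace Ω) (t : ℝ), MeasurableSet[m] {_ω : Ω | (0 : ℝ) ≤ t} :=
    fun m t => MeasurableSet.const _
  have hattempt : ∀ n, (∀ t,
      MeasurableSet[eventuallyMeasurableSpace (information gap erased n t) (ae P)]
        {ω | stageStart (thresholdPolicy gap erased γ) n ω ≤ t}) →
      (∀ t, MeasurableSet[eventuallyMeasurableSpace (information gap erased n t) (ae P)]
        {ω | lastSuccess erased (thresholdPolicy gap erased γ) n ω ≤ t}) →
      ∀ t, MeasurableSet[eventuallyMeasurableSpace (information gap erased n t) (ae P)]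
        {ω | thresholdPolicy gap erased γ n ω ≤ t} := by
    intro n h1 h2 t
    have heq : {ω | thresholdPolicy gap erased γ n ω ≤ t} =
        {ω | nextArrival gap (stageStart (thresholdPolicy gap erased γ) n ω) ω ≤ t} ∩
        {ω | lastSuccess erased (thresholdPolicy gap erased γ) n ω ≤ t - γ} := by
      ext ω
      simp only [thresholdPolicy_eq n, max_le_iff, Set.mem_ofPred_eq, Set.mem_inter_iff,
        le_sub_iff_add_le]
    rw [heq]
    refine MeasurableSet.inter ?_ (hmono le_rfl (by linarith) _ (h2 _))
    refine measurableSet_nextArrival_le h (fun s hs => ?_) fun r hr => hmono le_rfl hr.le _ (h1 r)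
    exact (le_iSup₂ (f := fun (s : ℝ) (_ : s ≤ t) =>
      MeasurableSpace.comap (arrivalCount gap s) ⊤) s hs).trans le_sup_left
  induction n with
  | zero =>
    exact fun t => ⟨hattempt 0 (fun t => hconst _ t) (fun t => hconst _ t) t, hconst _ t⟩
  | succ n ih =>
    have hlast : ∀ t, MeasurableSet[eventuallyMeasurableSpace
        (information gap erased (n + 1) t) (ae P)]
        {ω | lastSuccess erased (thresholdPolicy gap erased γ) (n + 1) ω ≤ t} := by
      intro t
      have heq : {ω | lastSuccess erased (thresholdPolicy gap erased γ) (n + 1) ω ≤ t} =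
          ({ω | erased n ω = true} ∩
            {ω | lastSuccess erased (thresholdPolicy gap erased γ) n ω ≤ t}) ∪
          ({ω | erased n ω = false} ∩ {ω | thresholdPolicy gap erased γ n ω ≤ t}) := by
        ext ω
        simp only [lastSuccess, Set.mem_ofPred_eq, Set.mem_union, Set.mem_inter_iff]
        cases erased n ω <;> simp
      rw [heq]
      exact MeasurableSet.union
        (MeasurableSet.inter
          (le_eventuallyMeasurableSpace _ (measurableSet_erased_information n t _))
          (hmono n.le_succ le_rfl _ (ih t).2))
        (MeasurableSet.inter
          (le_eventuallyMeasurableSpace _ (measurableSet_erased_information n t _))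
          (hmono n.le_succ le_rfl _ (ih t).1))
    refine fun t => ⟨hattempt (n + 1) (fun t => ?_) hlast t, hlast t⟩
    exact hmono n.le_succ le_rfl _ (ih t).1

lemma isPolicy_thresholdPolicy (h : IsEnvironment P q gap erased) (hγ : 0 ≤ γ) :
    IsPolicy P gap erased (thresholdPolicy gap erased γ) where
  measurable n := (measurable_thresholdState h.measurable_gap h.measurable_erased (n + 1)).fst
  nonneg := h.ae_isRegularPath.mono fun _ hω =>
    (hω.isFeasiblePath_thresholdPolicy (erased := erased) (γ := γ)).stageStart_nonneg 1
  mono := h.ae_isRegularPath.mono fun _ hω _ _ hmn =>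
    (hω.isFeasiblePath_thresholdPolicy (erased := erased) (γ := γ)).stageStart_strictMono.monotone
      (Nat.succ_le_succ hmn)
  online n t := (measurableSet_thresholdPolicy_le h hγ n t).1
  energy_causality := h.ae_isRegularPath.mono fun _ hω =>
    (forall_one_le_battery_iff hω).2
      (hω.isFeasiblePath_thresholdPolicy (erased := erased) (γ := γ)).nextArrival_le

end

/-! ### Epochs of the threshold policy -/

/-- The index of the first success in a sequence of outcomes, and `0` if there is none. -/
def firstSuccess (e : ℕ → Bool) : ℕ := sInf {n | e n = false}

/-- The time of attempt `i` of an epoch under the threshold policy, measured from the beginning of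
the epoch, as a function of the gaps and erasures seen from there. Within an epoch the first attempt
is at `γ` or later, so that the condition on the age matters only for the first attempt. -/
def thresholdRule (γ : ℝ) : ℕ → (ℕ → ℝ) × (ℕ → Bool) → ℝ
  | 0, z => max (nextArrival (fun k (g : ℕ → ℝ) => g k) 0 z.1) γ
  | i + 1, z => max (nextArrival (fun k (g : ℕ → ℝ) => g k) (thresholdRule γ i z) z.1) γ

/-- The length of an epoch under the threshold policy as a function of what is seen from its
beginning. -/
def thresholdEpoch (γ : ℝ) (z : (ℕ → ℝ) × (ℕ → Bool)) : ℝ := thresholdRule γ (firstSuccess z.2) z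

lemma firstSuccess_eq_iff {e : ℕ → Bool} (he : ∃ n, e n = false) {k : ℕ} :
    firstSuccess e = k ↔ e k = false ∧ ∀ i < k, e i = true := by
  constructor
  · rintro rfl
    refine ⟨Nat.sInf_mem he, fun i hi => ?_⟩
    by_contra hne
    exact absurd (Nat.sInf_le (show i ∈ {n | e n = false} by simpa using hne)) (not_le.2 hi)
  · rintro ⟨h1, h2⟩
    refine le_antisymm (Nat.sInf_le h1) ?_
    by_contra! hlt
    have h3 : e (sInf {n | e n = false}) = false := Nat.sInf_mem he
    exact Bool.noConfusion ((h2 _ hlt).symm.trans h3)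

lemma measurable_firstSuccess : Measurable firstSuccess := by
  refine measurable_to_countable' fun k => ?_
  have hset : ∀ (i : ℕ) (b : Bool), MeasurableSet {e : ℕ → Bool | e i = b} := fun i b =>
    (measurable_pi_apply (X := fun _ : ℕ => Bool) i) (measurableSet_singleton b)
  have hnone : MeasurableSet {e : ℕ → Bool | ∀ n, e n = true} := by
    rw [Set.ofPred_forall]; exact MeasurableSet.iInter fun n => hset n true
  have hD : MeasurableSet {e : ℕ → Bool | e k = false ∧ ∀ i < k, e i = true} := by
    refine (hset k false).inter ?_
    change MeasurableSet {e : ℕ → Bool | ∀ i < k, e i = true}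
    simp only [Set.ofPred_forall]
    exact MeasurableSet.iInter fun i => MeasurableSet.iInter fun _ => hset i true
  have heq : firstSuccess ⁻¹' {k} = ({e | e k = false ∧ ∀ i < k, e i = true} \
      {e | ∀ n, e n = true}) ∪ ({e | ∀ n, e n = true} ∩ {_e | k = 0}) := by
    ext e
    by_cases he : ∃ n, e n = false
    · have h1 : ¬ ∀ n, e n = true := by
        obtain ⟨n, hn⟩ := he
        exact fun h => by simp [h n] at hn
      simp only [Set.mem_preimage, Set.mem_singleton_iff, firstSuccess_eq_iff he, Set.mem_union,
        Set.mem_sdiff, Set.mem_ofPred_eq, Set.mem_inter_iff, h1, not_false_eq_true, and_true,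
        false_and, or_false]
    · have h1 : ∀ n, e n = true := fun n => by
        by_contra hne
        exact he ⟨n, by simpa using hne⟩
      simp only [Set.mem_preimage, Set.mem_singleton_iff, Set.mem_union, Set.mem_sdiff,
        Set.mem_ofPred_eq, Set.mem_inter_iff, firstSuccess, h1]
      simp [eq_comm]
  rw [heq]
  exact (hD.diff hnone).union (hnone.inter (MeasurableSet.const _))

lemma measurable_thresholdRule (γ : ℝ) (i : ℕ) : Measurable (thresholdRule γ i) := by
  have hn := measurable_nextArrival (gap := fun k (g : ℕ → ℝ) => g k)
    fun k => measurable_pi_apply k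
  induction i with
  | zero => exact (hn.comp (measurable_const.prodMk measurable_fst)).max measurable_const
  | succ i ih => exact (hn.comp (ih.prodMk measurable_fst)).max measurable_const

lemma measurable_thresholdEpoch (γ : ℝ) : Measurable (thresholdEpoch γ) := by
  have h : Measurable fun y : ℕ × ((ℕ → ℝ) × (ℕ → Bool)) => thresholdRule γ y.1 y.2 :=
    measurable_from_prod_countable_right fun i => measurable_thresholdRule γ i
  exact h.comp ((measurable_firstSuccess.comp measurable_snd).prodMk measurable_id)

lemma le_thresholdRule (γ : ℝ) (i : ℕ) (z : (ℕ → ℝ) × (ℕ → Bool)) : γ ≤ thresholdRule γ i z := by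
  cases i <;> exact le_max_right _ _

section Path

variable {gap x : ℕ → Ω → ℝ} {erased : ℕ → Ω → Bool} {γ : ℝ} {ω : Ω}

lemma successTime_eq_stageStart (j : ℕ) :
    successTime erased x j ω = stageStart x (firstAttempt erased j ω) ω := by
  cases j <;> rfl

lemma lastSuccess_firstAttempt (hs : ∃ᶠ n in atTop, erased n ω = false) (j : ℕ) :
    lastSuccess erased x (firstAttempt erased j ω) ω = successTime erased x j ω := by
  cases j with
  | zero => rfl
  | succ j =>
    have := Nat.nth_mem_of_infinite (Nat.frequently_atTop_iff_infinite.1 hs) j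
    simp only [firstAttempt, lastSuccess, successTime, this]
    simp

/-- An epoch ends with its first success. -/
lemma firstSuccess_epoch (hs : ∃ᶠ n in atTop, erased n ω = false) (j : ℕ) :
    firstAttempt erased (j + 1) ω =
      firstAttempt erased j ω +
        firstSuccess (fun i => erased (firstAttempt erased j ω + i) ω) + 1 := by
  have hinf := Nat.frequently_atTop_iff_infinite.1 hs
  set p : ℕ → Prop := fun n => erased n ω = false
  have hle : firstAttempt erased j ω ≤ Nat.nth p j := by
    cases j with
    | zero => exact Nat.zero_le _
    | succ j => exact Nat.nth_strictMono hinf j.lt_succ_self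
  have hmem : erased (firstAttempt erased j ω + (Nat.nth p j - firstAttempt erased j ω)) ω =
      false := by
    rw [Nat.add_sub_cancel' hle]
    exact Nat.nth_mem_of_infinite hinf j
  have key : firstSuccess (fun i => erased (firstAttempt erased j ω + i) ω) =
      Nat.nth p j - firstAttempt erased j ω := by
    rw [firstSuccess_eq_iff ⟨_, hmem⟩]
    refine ⟨hmem, fun i hi => ?_⟩
    by_contra hne
    have hp : p (firstAttempt erased j ω + i) := by simpa [p] using hne
    have hlt : Nat.nth p (Nat.count p (firstAttempt erased j ω + i)) < Nat.nth p j := by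
      rw [Nat.nth_count hp]; omega
    have hcount := (Nat.nth_strictMono hinf).lt_iff_lt.1 hlt
    cases j with
    | zero => omega
    | succ j =>
      have hlt' : Nat.nth p j < Nat.nth p (Nat.count p (firstAttempt erased (j + 1) ω + i)) := by
        rw [Nat.nth_count hp]; simp only [firstAttempt, p]; omega
      have := (Nat.nth_strictMono hinf).lt_iff_lt.1 hlt'
      omega
  rw [key, Nat.add_sub_cancel' hle]
  rfl

lemma lastSuccess_epoch (hs : ∃ᶠ n in atTop, erased n ω = false) (j : ℕ) {i : ℕ}
    (hi : i ≤ firstSuccess (fun i => erased (firstAttempt erased j ω + i) ω)) :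
    lastSuccess erased x (firstAttempt erased j ω + i) ω = successTime erased x j ω := by
  induction i with
  | zero => exact lastSuccess_firstAttempt hs j
  | succ i ih =>
    have hex : ∃ i, erased (firstAttempt erased j ω + i) ω = false := by
      obtain ⟨n, hn, hn'⟩ := (frequently_atTop.1 hs) (firstAttempt erased j ω)
      exact ⟨n - firstAttempt erased j ω, by rwa [Nat.add_sub_cancel' hn]⟩
    have := ((firstSuccess_eq_iff hex).1 rfl).2 i (Nat.lt_of_succ_le hi)
    rw [← add_assoc, lastSuccess, if_pos this, ih (Nat.le_of_succ_le hi)]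

lemma successTime_succ (hs : ∃ᶠ n in atTop, erased n ω = false) (j : ℕ) :
    successTime erased x (j + 1) ω = x (firstAttempt erased j ω +
      firstSuccess (fun i => erased (firstAttempt erased j ω + i) ω)) ω := by
  rw [successTime_eq_stageStart, firstSuccess_epoch hs, stageStart]

/-- In each epoch the threshold policy applies the threshold rule to what is seen from the beginning
of the epoch. -/
lemma IsRegularPath.thresholdPolicy_sub (h : IsRegularPath gap ω)
    (hs : ∃ᶠ n in atTop, erased n ω = false) (hγ : 0 ≤ γ) (j : ℕ) {i : ℕ}
    (hi : i ≤ firstSuccess (fun i => erased (firstAttempt erased j ω + i) ω)) :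
    thresholdPolicy gap erased γ (firstAttempt erased j ω + i) ω -
        successTime erased (thresholdPolicy gap erased γ) j ω =
      thresholdRule γ i (epochEnvironment gap erased (thresholdPolicy gap erased γ) j ω) := by
  set y := successTime erased (thresholdPolicy gap erased γ) j ω with hy
  rw [thresholdPolicy_eq, lastSuccess_epoch hs j hi, ← hy]
  have henv : (epochEnvironment gap erased (thresholdPolicy gap erased γ) j ω).1 =
      StatusUpdate.gapsAfter gap y ω := rfl
  induction i with
  | zero =>
    rw [thresholdRule, henv, h.nextArrival_gapsAfter le_rfl, add_zero, add_zero,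
      ← successTime_eq_stageStart, ← hy, ← max_sub_sub_right, add_sub_cancel_left]
  | succ i ih =>
    have hprev : thresholdPolicy gap erased γ (firstAttempt erased j ω + i) ω - y =
        thresholdRule γ i (epochEnvironment gap erased (thresholdPolicy gap erased γ) j ω) := by
      rw [thresholdPolicy_eq, lastSuccess_epoch hs j (Nat.le_of_succ_le hi), ← hy]
      exact ih (Nat.le_of_succ_le hi)
    rw [thresholdRule, henv, h.nextArrival_gapsAfter (hγ.trans (le_thresholdRule γ i _)), ← hprev,
      add_sub_cancel, ← add_assoc, stageStart, ← max_sub_sub_right, add_sub_cancel_left]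

lemma IsRegularPath.epochLength_thresholdPolicy (h : IsRegularPath gap ω)
    (hs : ∃ᶠ n in atTop, erased n ω = false) (hγ : 0 ≤ γ) (j : ℕ) :
    epochLength erased (thresholdPolicy gap erased γ) j ω =
      thresholdEpoch γ (epochEnvironment gap erased (thresholdPolicy gap erased γ) j ω) := by
  rw [epochLength, successTime_succ hs, h.thresholdPolicy_sub hs hγ j le_rfl]
  rfl

end Path

/-! ### Independence of sequences -/

section Sequences

variable {P : Measure Ω} [IsProbabilityMeasure P] {E : Type*} [MeasurableSpace E]

/-- For the independence of a sequence it is enough to consider its initial segments. -/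
lemma iIndepFun_of_range {X : ℕ → Ω → E}
    (h : ∀ (B : ℕ → Set E), (∀ i, MeasurableSet (B i)) → ∀ n,
      P (⋂ i ∈ Finset.range n, X i ⁻¹' B i) = ∏ i ∈ Finset.range n, P (X i ⁻¹' B i)) :
    iIndepFun X P := by
  classical
  rw [iIndepFun_iff_measure_inter_preimage_eq_mul]
  intro S B hB
  obtain ⟨n, hn⟩ := S.exists_nat_subset_range
  have key := h (fun i => if i ∈ S then B i else Set.univ) (fun i => by
    by_cases hi : i ∈ S
    · simpa [hi] using hB i hi
    · simp [hi]) n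
  have h1 : (⋂ i ∈ Finset.range n, X i ⁻¹' (if i ∈ S then B i else Set.univ)) =
      ⋂ i ∈ S, X i ⁻¹' B i := by
    ext ω
    simp only [Set.mem_iInter, Set.mem_preimage]
    refine ⟨fun h i hi => by simpa [hi] using h i (hn hi), fun h i _ => ?_⟩
    by_cases hi : i ∈ S
    · simpa [hi] using h i hi
    · simp [hi]
  have h2 : ∏ i ∈ Finset.range n, P (X i ⁻¹' (if i ∈ S then B i else Set.univ)) =
      ∏ i ∈ S, P (X i ⁻¹' B i) := by
    rw [← Finset.prod_subset hn]
    · exact Finset.prod_congr rfl fun i hi => by simp [hi]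
    · intro i _ hi
      simp [hi]
  rw [← h1, ← h2, key]

/-- A sequence is independent if each term is independent of the terms before it. -/
lemma iIndepFun_of_forall_indep {X : ℕ → Ω → E}
    (h : ∀ n, Indep (⨆ (i : ℕ) (_ : i < n), MeasurableSpace.comap (X i) inferInstance)
      (MeasurableSpace.comap (X n) inferInstance) P) : iIndepFun X P := by
  refine iIndepFun_of_range fun B hB n => ?_
  induction n with
  | zero => simp
  | succ n ih =>
    have hset : ⋂ i ∈ Finset.range (n + 1), X i ⁻¹' B i =
        (⋂ i ∈ Finset.range n, X i ⁻¹' B i) ∩ X n ⁻¹' B n := by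
      rw [Finset.range_add_one, Finset.set_biInter_insert, Set.inter_comm]
    rw [hset, Finset.prod_range_succ, ← ih]
    refine (Indep_iff _ _ _).1 (h n) _ _ ?_ ⟨B n, hB n, rfl⟩
    refine Finset.measurableSet_biInter _ fun i hi => ?_
    exact le_iSup₂ (f := fun (i : ℕ) (_ : i < n) => MeasurableSpace.comap (X i) inferInstance) i
      (Finset.mem_range.1 hi) _ ⟨B i, hB i, rfl⟩

lemma iIndepFun_comp_of_map {S : Type*} [MeasurableSpace S] {Y : Ω → S} {X : ℕ → S → E}
    (hX : ∀ i, Measurable (X i)) (hY : Measurable Y) (h : iIndepFun X (P.map Y)) :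
    iIndepFun (fun i ω => X i (Y ω)) P := by
  rw [iIndepFun_iff_measure_inter_preimage_eq_mul] at h ⊢
  intro T B hB
  have key := h T hB
  rw [Measure.map_apply hY (Finset.measurableSet_biInter _ fun i hi => hX i (hB i hi)),
    Set.preimage_iInter₂] at key
  refine key.trans (Finset.prod_congr rfl fun i hi => ?_)
  rw [Measure.map_apply hY (hX i (hB i hi))]
  rfl

/-- If an observable `Ψ` is independent of the transformed state `R`, which has the original law,
then the observations along the orbit of `R` are independent and identically distributed. -/
lemma iIndepFun_iterate {R : Ω → Ω} {Ψ : Ω → E} (hR : Measurable R) (hΨ : Measurable Ψ)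
    (h : ∀ B C, MeasurableSet B → MeasurableSet C → P (Ψ ⁻¹' B ∩ R ⁻¹' C) = P (Ψ ⁻¹' B) * P C) :
    MeasurePreserving R P P ∧ iIndepFun (fun j ω => Ψ (R^[j] ω)) P := by
  have hpres : MeasurePreserving R P P := by
    refine ⟨hR, Measure.ext fun C hC => ?_⟩
    rw [Measure.map_apply hR hC]
    simpa using h Set.univ C MeasurableSet.univ hC
  refine ⟨hpres, iIndepFun_of_range fun B hB n => ?_⟩
  have hinv : ∀ i (D : Set E), MeasurableSet D →
      P ((fun ω => Ψ (R^[i] ω)) ⁻¹' D) = P (Ψ ⁻¹' D) := fun i D hD =>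
    (hpres.iterate i).measure_preimage (hΨ hD).nullMeasurableSet
  have hprod : ∏ i ∈ Finset.range n, P ((fun ω => Ψ (R^[i] ω)) ⁻¹' B i) =
      ∏ i ∈ Finset.range n, P (Ψ ⁻¹' B i) := Finset.prod_congr rfl fun i _ => hinv i _ (hB i)
  rw [hprod]
  clear hprod
  induction n generalizing B with
  | zero => simp
  | succ n ih =>
    have hset : ⋂ i ∈ Finset.range (n + 1), (fun ω => Ψ (R^[i] ω)) ⁻¹' B i = Ψ ⁻¹' B 0 ∩
        R ⁻¹' (⋂ i ∈ Finset.range n, (fun ω => Ψ (R^[i] ω)) ⁻¹' B (i + 1)) := by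
      ext ω
      simp only [Set.mem_iInter, Finset.mem_range, Set.mem_preimage, Set.mem_inter_iff]
      refine ⟨fun hω => ⟨hω 0 n.succ_pos, fun i hi => hω (i + 1) (Nat.succ_lt_succ hi)⟩, ?_⟩
      rintro ⟨h0, h1⟩ (_ | i) hi
      · exact h0
      · exact h1 i (Nat.lt_of_succ_lt_succ hi)
    rw [hset, h _ _ (hB 0), ih (fun i => B (i + 1)) fun i => hB (i + 1), Finset.prod_range_succ',
      mul_comm]
    exact Finset.measurableSet_biInter _ fun i _ => (hΨ.comp (hR.iterate i)) (hB (i + 1))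

/-- In an i.i.d. sequence the terms from index `m` on form an independent copy of the sequence. -/
lemma infinitePi_inter_shift (ν : Measure E) [IsProbabilityMeasure ν] (m : ℕ) {A C : Set (ℕ → E)}
    (hA : MeasurableSet[⨆ i ∈ Set.Iio m,
      MeasurableSpace.comap (fun ζ : ℕ → E => ζ i) inferInstance] A)
    (hC : MeasurableSet C) :
    Measure.infinitePi (fun _ : ℕ => ν) (A ∩ (fun ζ i => ζ (m + i)) ⁻¹' C) =
      Measure.infinitePi (fun _ : ℕ => ν) A * Measure.infinitePi (fun _ : ℕ => ν) C := by
  have hind := indep_iSup_of_disjoint (fun i => (measurable_pi_apply (X := fun _ => E) i).comap_le)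
    (iIndepFun_infinitePi (P := fun _ : ℕ => ν) (X := fun _ e => e) fun _ => measurable_id)
    (S := Set.Iio m) (T := Set.Ici m)
    (Set.disjoint_left.2 fun i (h1 : i < m) (h2 : m ≤ i) => absurd h1 (not_lt.2 h2))
  have hshift : Measurable fun (ζ : ℕ → E) (i : ℕ) => ζ (m + i) :=
    measurable_pi_iff.2 fun i => measurable_pi_apply _
  have hshift' : Measurable[⨆ i ∈ Set.Ici m, MeasurableSpace.comap (fun ζ : ℕ → E => ζ i)
      inferInstance] fun (ζ : ℕ → E) (i : ℕ) => ζ (m + i) := by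
    refine (@measurable_pi_iff _ _ _ (_) _ _).2 fun i => ?_
    exact (comap_measurable fun ζ : ℕ → E => ζ (m + i)).mono
      (le_iSup₂ (f := fun (i : ℕ) (_ : i ∈ Set.Ici m) =>
        MeasurableSpace.comap (fun ζ : ℕ → E => ζ i) inferInstance) (m + i) (Nat.le_add_right m i))
      le_rfl
  rw [(Indep_iff _ _ _).1 hind A _ hA (hshift' hC), ← Measure.map_apply hshift hC,
    Measure.map_infinitePi_infinitePi_of_inj (P := fun _ : ℕ => ν) (add_right_injective m)]

end Sequences

/-! ### Regeneration at the first success -/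

/-- The length of an epoch under the threshold policy in terms of the waits `(ζ i).1` for energy after
the attempts and the outcomes `(ζ i).2` of the attempts. -/
def waitsEpoch (γ : ℝ) (ζ : ℕ → ℝ × Bool) : ℝ :=
  max (ζ 0).1 γ + ∑ i ∈ Finset.range (firstSuccess fun i => (ζ i).2), (ζ (i + 1)).1

/-- The waits and outcomes after the first success. -/
def afterSuccess (ζ : ℕ → ℝ × Bool) : ℕ → ℝ × Bool :=
  fun i => ζ (firstSuccess (fun i => (ζ i).2) + 1 + i)

lemma measurable_firstSuccess_snd :
    Measurable fun ζ : ℕ → ℝ × Bool => firstSuccess fun i => (ζ i).2 :=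
  measurable_firstSuccess.comp (measurable_pi_iff.2 fun i => (measurable_pi_apply i).snd)

lemma measurable_waitsEpoch (γ : ℝ) : Measurable (waitsEpoch γ) := by
  have h : Measurable fun y : ℕ × (ℕ → ℝ × Bool) =>
      max (y.2 0).1 γ + ∑ i ∈ Finset.range y.1, (y.2 (i + 1)).1 :=
    measurable_from_prod_countable_right fun k => by
      refine Measurable.add ((measurable_pi_apply 0).fst.max measurable_const) ?_
      exact Finset.measurable_sum (Finset.range k) fun i _ =>
        (measurable_pi_apply (X := fun _ : ℕ => ℝ × Bool) (i + 1)).fst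
  exact h.comp (measurable_firstSuccess_snd.prodMk measurable_id)

lemma measurable_afterSuccess : Measurable afterSuccess := by
  have h : Measurable fun y : ℕ × (ℕ → ℝ × Bool) => fun i : ℕ => y.2 (y.1 + 1 + i) :=
    measurable_from_prod_countable_right fun k =>
      measurable_pi_iff.2 fun i => measurable_pi_apply (X := fun _ => ℝ × Bool) (k + 1 + i)
  exact h.comp (measurable_firstSuccess_snd.prodMk measurable_id)

/-- The length of an epoch is independent of what follows the epoch, which is distributed as the
sequence seen from time `0`. -/
lemma waitsEpoch_inter_afterSuccess (ν : Measure (ℝ × Bool)) [IsProbabilityMeasure ν] (γ : ℝ)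
    (hs : ∀ᵐ ζ ∂Measure.infinitePi (fun _ : ℕ => ν), ∃ n, (ζ n).2 = false)
    {B : Set ℝ} {C : Set (ℕ → ℝ × Bool)} (hB : MeasurableSet B) (hC : MeasurableSet C) :
    Measure.infinitePi (fun _ : ℕ => ν) (waitsEpoch γ ⁻¹' B ∩ afterSuccess ⁻¹' C) =
      Measure.infinitePi (fun _ : ℕ => ν) (waitsEpoch γ ⁻¹' B) *
        Measure.infinitePi (fun _ : ℕ => ν) C := by
  let D : ℕ → Set (ℕ → ℝ × Bool) := fun k => {ζ | ((ζ k).2 = false ∧ ∀ i < k, (ζ i).2 = true) ∧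
    max (ζ 0).1 γ + ∑ i ∈ Finset.range k, (ζ (i + 1)).1 ∈ B}
  have hD : ∀ k, MeasurableSet[⨆ i ∈ Set.Iio (k + 1),
      MeasurableSpace.comap (fun ζ : ℕ → ℝ × Bool => ζ i) inferInstance] (D k) := by
    intro k
    have hcoord : ∀ i ≤ k, Measurable[⨆ i ∈ Set.Iio (k + 1),
        MeasurableSpace.comap (fun ζ : ℕ → ℝ × Bool => ζ i) inferInstance]
        fun ζ : ℕ → ℝ × Bool => ζ i := fun i hi =>
      (comap_measurable fun ζ : ℕ → ℝ × Bool => ζ i).mono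
        (le_iSup₂ (f := fun (i : ℕ) (_ : i ∈ Set.Iio (k + 1)) =>
          MeasurableSpace.comap (fun ζ : ℕ → ℝ × Bool => ζ i) inferInstance) i
          (Nat.lt_succ_of_le hi)) le_rfl
    have hset : ∀ i ≤ k, ∀ b, MeasurableSet[⨆ i ∈ Set.Iio (k + 1),
        MeasurableSpace.comap (fun ζ : ℕ → ℝ × Bool => ζ i) inferInstance]
        {ζ : ℕ → ℝ × Bool | (ζ i).2 = b} := fun i hi b =>
      (measurable_snd.comp (hcoord i hi)) (measurableSet_singleton b)
    have hall : MeasurableSet[⨆ i ∈ Set.Iio (k + 1),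
        MeasurableSpace.comap (fun ζ : ℕ → ℝ × Bool => ζ i) inferInstance]
        {ζ : ℕ → ℝ × Bool | ∀ i < k, (ζ i).2 = true} := by
      have heq : {ζ : ℕ → ℝ × Bool | ∀ i < k, (ζ i).2 = true} =
          ⋂ i : Fin k, {ζ : ℕ → ℝ × Bool | (ζ i).2 = true} := by
        ext ζ
        simp only [Set.mem_ofPred_eq, Set.mem_iInter]
        exact ⟨fun h i => h i i.2, fun h i hi => h ⟨i, hi⟩⟩
      rw [heq]
      exact MeasurableSet.iInter fun i => hset i i.2.le true
    refine MeasurableSet.inter (MeasurableSet.inter (hset k le_rfl false) hall) ?_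
    refine Measurable.add (Measurable.max (measurable_fst.comp (hcoord 0 k.zero_le))
      measurable_const) ?_ hB
    exact Finset.measurable_sum _ fun i hi =>
      measurable_fst.comp (hcoord (i + 1) (Finset.mem_range.1 hi))
  have hcoord_le : ∀ k, (⨆ i ∈ Set.Iio (k + 1),
      MeasurableSpace.comap (fun ζ : ℕ → ℝ × Bool => ζ i) inferInstance) ≤
      (inferInstance : MeasurableSpace (ℕ → ℝ × Bool)) := fun k =>
    iSup₂_le fun i _ => (measurable_pi_apply i).comap_le
  have hdisj : Pairwise (Function.onFun Disjoint D) := by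
    intro k l hkl
    refine Set.disjoint_left.2 fun ζ h1 h2 => hkl ?_
    have h1 := (firstSuccess_eq_iff (e := fun i => (ζ i).2) ⟨k, h1.1.1⟩).2 h1.1
    have h2 := (firstSuccess_eq_iff (e := fun i => (ζ i).2) ⟨l, h2.1.1⟩).2 h2.1
    exact h1.symm.trans h2
  have key : ∀ C : Set (ℕ → ℝ × Bool), MeasurableSet C →
      Measure.infinitePi (fun _ : ℕ => ν) (waitsEpoch γ ⁻¹' B ∩ afterSuccess ⁻¹' C) =
      (∑' k, Measure.infinitePi (fun _ : ℕ => ν) (D k)) *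
        Measure.infinitePi (fun _ : ℕ => ν) C := by
    intro C hC
    have hae : (waitsEpoch γ ⁻¹' B ∩ afterSuccess ⁻¹' C : Set (ℕ → ℝ × Bool))
        =ᵐ[Measure.infinitePi (fun _ : ℕ => ν)]
        (⋃ k, D k ∩ (fun ζ i => ζ (k + 1 + i)) ⁻¹' C : Set (ℕ → ℝ × Bool)) := by
      filter_upwards [hs] with ζ hζ
      have hfirst := (firstSuccess_eq_iff (e := fun i => (ζ i).2) hζ).1 rfl
      refine propext ⟨fun h => Set.mem_iUnion.2 ⟨_, ⟨hfirst, h.1⟩, h.2⟩, fun h => ?_⟩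
      obtain ⟨k, ⟨h1, h2⟩, h3⟩ := Set.mem_iUnion.1 h
      have hk := (firstSuccess_eq_iff (e := fun i => (ζ i).2) hζ).2 h1
      refine ⟨?_, ?_⟩
      · change max (ζ 0).1 γ + _ ∈ B
        rw [hk]; exact h2
      · change afterSuccess ζ ∈ C
        unfold afterSuccess
        rw [hk]; exact h3
    rw [measure_congr hae, measure_iUnion, ← ENNReal.tsum_mul_right]
    · exact tsum_congr fun k => infinitePi_inter_shift ν (k + 1) (hD k) hC
    · exact fun k l hkl => (hdisj hkl).mono Set.inter_subset_left Set.inter_subset_left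
    · refine fun k => (hcoord_le k _ (hD k)).inter ?_
      have hshift : Measurable fun (ζ : ℕ → ℝ × Bool) (i : ℕ) => ζ (k + 1 + i) :=
        measurable_pi_iff.2 fun i => measurable_pi_apply _
      exact hshift hC
  have huniv := key Set.univ MeasurableSet.univ
  rw [Set.preimage_univ, Set.inter_univ, measure_univ, mul_one] at huniv
  rw [key C hC, huniv]

/-! ### Waits and outcomes are independent and identically distributed -/

/-- The wait for energy after attempt `n - 1` together with the outcome of attempt `n`. -/
def waitOutcome (gap : ℕ → Ω → ℝ) (erased : ℕ → Ω → Bool) (x : ℕ → Ω → ℝ) (n : ℕ) (ω : Ω) :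
    ℝ × Bool :=
  (waitingTime gap (stageStart x n) ω, erased n ω)

section

variable {P : Measure Ω} [IsProbabilityMeasure P] {q : ℝ} {gap : ℕ → Ω → ℝ} {erased : ℕ → Ω → Bool}
  {x : ℕ → Ω → ℝ}

lemma IsPolicy.measurable_waitOutcome (hx : IsPolicy P gap erased x)
    (h : IsEnvironment P q gap erased) (n : ℕ) : Measurable (waitOutcome gap erased x n) :=
  (measurable_waitingTime h.measurable_gap (hx.measurable_stageStart n)).prodMk
    (h.measurable_erased n)

lemma IsPolicy.ae_stageStart_nonneg (hx : IsPolicy P gap erased x)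
    (h : IsEnvironment P q gap erased) (n : ℕ) : ∀ᵐ ω ∂P, 0 ≤ stageStart x n ω :=
  (hx.ae_isFeasiblePath h).mono fun _ hω => hω.stageStart_nonneg n

lemma IsPolicy.measurable_past_waitingTime (hx : IsPolicy P gap erased x)
    (h : IsEnvironment P q gap erased) {i n : ℕ} (hi : i < n) :
    Measurable[(hx.isOnlineTime_stageStart n).past] (waitingTime gap (stageStart x i)) := by
  have hnext := (hx.isOnlineTime_stageStart i).nextArrival h
  refine Measurable.sub (hnext.measurable_past.mono (hnext.past_mono _ ?_) le_rfl)
    ((hx.isOnlineTime_stageStart i).measurable_past.mono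
      ((hx.isOnlineTime_stageStart i).past_mono _ ?_) le_rfl)
  · filter_upwards [hx.ae_isFeasiblePath h] with ω hω
    exact (hω.nextArrival_le i).trans (hω.stageStart_strictMono.monotone (Nat.succ_le_of_lt hi))
  · filter_upwards [hx.ae_isFeasiblePath h] with ω hω
    exact hω.stageStart_strictMono.monotone hi.le

lemma IsPolicy.measurable_outcomeHistory_waitingTime (hx : IsPolicy P gap erased x) (n : ℕ) :
    Measurable[outcomeHistory P gap erased n] (waitingTime gap (stageStart x n)) := by
  refine @measurable_waitingTime Ω (outcomeHistory P gap erased n) gap (stageStart x n)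
    (fun k E hE => ⟨gap k ⁻¹' E, ?_, EventuallyEq.rfl⟩) ?_
  · exact (le_sup_right : MeasurableSpace.comap (fun ω k => gap k ω) inferInstance ≤ _) _
      (((measurable_pi_apply k).comp (comap_measurable fun ω k => gap k ω)) hE)
  · cases n with
    | zero => exact @measurable_const _ _ _ (_) _
    | succ n => exact (hx.measurable_outcomeHistory n).mono (outcomeHistory_mono n.le_succ) le_rfl

/-- The waits for energy and the outcomes of the attempts are independent under every policy. -/
lemma IsPolicy.iIndepFun_waitOutcome (hx : IsPolicy P gap erased x)
    (h : IsEnvironment P q gap erased) : iIndepFun (waitOutcome gap erased x) P := by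
  refine iIndepFun_of_forall_indep fun n => ?_
  have hw := measurable_waitingTime h.measurable_gap (hx.measurable_stageStart n)
  have hon := hx.isOnlineTime_stageStart n
  have hsplit : MeasurableSpace.comap (waitOutcome gap erased x n) inferInstance ≤
      MeasurableSpace.comap (erased n) ⊤ ⊔
        MeasurableSpace.comap (waitingTime gap (stageStart x n)) inferInstance := by
    refine Measurable.comap_le (Measurable.prodMk ?_ ?_)
    · exact (comap_measurable _).mono le_sup_right le_rfl
    · exact (comap_measurable _).mono le_sup_left le_rfl
  refine indep_of_indep_of_le_right (Indep.sup_right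
    (iSup₂_le fun i _ => (hx.measurable_waitOutcome h i).comap_le)
    (h.measurable_erased n).comap_le hw.comap_le ?_ ?_) hsplit
  · refine indep_of_indep_of_le_left (h.indep_erased_outcomeHistory n)
      (iSup₂_le fun i hi => Measurable.comap_le (Measurable.prodMk ?_ ?_))
    · exact (hx.measurable_outcomeHistory_waitingTime i).mono (outcomeHistory_mono hi.le) le_rfl
    · exact (measurable_erased_outcomeHistory i).mono (outcomeHistory_mono hi) le_rfl
  · have hpast : Indep hon.past (MeasurableSpace.comap (waitingTime gap (stageStart x n))
        inferInstance) P := by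
      rw [Indep_iff]
      rintro A _ hA ⟨B, hB, rfl⟩
      rw [hon.measure_inter_preimage_waitingTime h (hx.measurable_stageStart n)
        (hx.ae_stageStart_nonneg h n) hA hB, ← hon.map_waitingTime h (hx.measurable_stageStart n)
        (hx.ae_stageStart_nonneg h n), Measure.map_apply hw hB]
    refine indep_of_indep_of_le_left hpast (sup_le (iSup₂_le fun i hi =>
      Measurable.comap_le (Measurable.prodMk ?_ (hon.measurable_erased i)))
      (hon.measurable_erased n).comap_le)
    exact hx.measurable_past_waitingTime h hi

lemma IsEnvironment.map_erased (h : IsEnvironment P q gap erased) (n : ℕ) :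
    P.map (erased n) = P.map (erased 0) := by
  have htrue : ∀ n, P.map (erased n) {true} = ENNReal.ofReal q := fun n => by
    rw [Measure.map_apply (h.measurable_erased n) (measurableSet_singleton _), ← h.prob_erased n]
    rfl
  have hfalse : ∀ n, P.map (erased n) {false} = 1 - ENNReal.ofReal q := fun n => by
    have := Measure.isProbabilityMeasure_map (h.measurable_erased n).aemeasurable (μ := P)
    rw [← htrue n, ← prob_compl_eq_one_sub (measurableSet_singleton _)]
    congr 1
    ext b
    cases b <;> simp
  refine Measure.ext_of_singleton fun b => ?_
  cases b
  · rw [hfalse, hfalse]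
  · rw [htrue, htrue]

lemma IsPolicy.map_waitOutcome (hx : IsPolicy P gap erased x)
    (h : IsEnvironment P q gap erased) (n : ℕ) :
    P.map (waitOutcome gap erased x n) = (expMeasure 1).prod (P.map (erased 0)) := by
  have hpm := hx.measurable_stageStart n
  have hw := measurable_waitingTime h.measurable_gap hpm
  have hon := hx.isOnlineTime_stageStart n
  have hp0 := hx.ae_stageStart_nonneg h n
  have hind := (hon.indepFun_waitingTime h hpm hp0 (hon.measurable_erased n)).symm
  rw [← h.map_erased n, ← hon.map_waitingTime h hpm hp0]
  exact (indepFun_iff_map_prod_eq_prod_map_map hw.aemeasurable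
    (h.measurable_erased n).aemeasurable).1 hind

lemma IsPolicy.map_waitOutcome_seq (hx : IsPolicy P gap erased x)
    (h : IsEnvironment P q gap erased) : P.map (fun ω n => waitOutcome gap erased x n ω) =
      Measure.infinitePi fun _ => (expMeasure 1).prod (P.map (erased 0)) := by
  rw [(hx.iIndepFun_waitOutcome h).map_fun_eq_infinitePi_map (hx.measurable_waitOutcome h)]
  congr 1
  exact funext (hx.map_waitOutcome h)

end

/-! ### The renewal property -/

section Renewal

variable {gap : ℕ → Ω → ℝ} {erased : ℕ → Ω → Bool} {γ : ℝ} {ω : Ω}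

lemma afterSuccess_iterate {x : ℕ → Ω → ℝ} (hs : ∃ᶠ n in atTop, erased n ω = false) (j : ℕ) :
    afterSuccess^[j] (fun n => waitOutcome gap erased x n ω) =
      fun i => waitOutcome gap erased x (firstAttempt erased j ω + i) ω := by
  induction j with
  | zero => simp [firstAttempt]
  | succ j ih =>
    rw [Function.iterate_succ_apply', ih, firstSuccess_epoch hs]
    funext i
    simp only [afterSuccess, waitOutcome, add_assoc]

/-- The attempts of an epoch follow one another at the waits for energy, except that the first one
is not made before age `γ`. -/
lemma IsRegularPath.epochLength_eq_waitsEpoch (h : IsRegularPath gap ω)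
    (hs : ∃ᶠ n in atTop, erased n ω = false) (j : ℕ) :
    epochLength erased (thresholdPolicy gap erased γ) j ω = waitsEpoch γ
      (afterSuccess^[j] fun n => waitOutcome gap erased (thresholdPolicy gap erased γ) n ω) := by
  set x := thresholdPolicy gap erased γ with hx
  set N := firstAttempt erased j ω with hN
  set y := successTime erased x j ω with hy
  have key : ∀ i ≤ firstSuccess (fun i => erased (N + i) ω), x (N + i) ω - y =
      max (waitingTime gap (stageStart x N) ω) γ +
        ∑ l ∈ Finset.range i, waitingTime gap (stageStart x (N + (l + 1))) ω := by
    intro i hi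
    induction i with
    | zero =>
      have hrule := thresholdPolicy_eq (gap := gap) (erased := erased) (γ := γ) N ω
      rw [lastSuccess_firstAttempt hs j, ← hx, ← hy] at hrule
      have hstart : stageStart x N ω = y := (successTime_eq_stageStart j).symm
      rw [add_zero, hrule, Finset.sum_range_zero, add_zero, waitingTime, hstart,
        ← max_sub_sub_right, add_sub_cancel_left]
    | succ i ih =>
      have ih := ih (Nat.le_of_succ_le hi)
      have hrule := thresholdPolicy_eq (gap := gap) (erased := erased) (γ := γ) (N + (i + 1)) ω
      rw [lastSuccess_epoch hs j hi, ← hx, ← hy] at hrule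
      have hge : y + γ ≤ x (N + i) ω := by
        rw [hx, thresholdPolicy_eq, lastSuccess_epoch hs j (Nat.le_of_succ_le hi)]
        exact le_max_right _ _
      have hstart : stageStart x (N + (i + 1)) ω = x (N + i) ω := rfl
      have hlt := h.lt_nextArrival (x (N + i) ω)
      rw [hstart, max_eq_left (by linarith)] at hrule
      rw [Finset.sum_range_succ, hrule, ← add_assoc, ← ih]
      simp only [waitingTime, hstart]
      ring
  rw [afterSuccess_iterate hs, epochLength, successTime_succ hs]
  exact key _ le_rfl

variable {P : Measure Ω} [IsProbabilityMeasure P] {q : ℝ}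

lemma isRenewalProcess_thresholdPolicy (h : IsEnvironment P q gap erased) (hq1 : q < 1)
    (hγ : 0 < γ) : IsRenewalProcess P (successTime erased (thresholdPolicy gap erased γ)) := by
  have hx := isPolicy_thresholdPolicy (erased := erased) h hγ.le
  set x := thresholdPolicy gap erased γ with hxdef
  have := isProbabilityMeasure_expMeasure (r := 1) one_pos
  have := Measure.isProbabilityMeasure_map (h.measurable_erased 0).aemeasurable (μ := P)
  have hlen : ∀ j, epochLength erased x j =ᵐ[P]
      fun ω => waitsEpoch γ (afterSuccess^[j] fun n => waitOutcome gap erased x n ω) := fun j => by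
    filter_upwards [h.ae_isRegularPath, h.ae_frequently_success hq1] with ω h1 h2
    exact h1.epochLength_eq_waitsEpoch h2 j
  have hseq : Measurable fun ω n => waitOutcome gap erased x n ω :=
    measurable_pi_iff.2 (hx.measurable_waitOutcome h)
  have hmap := hx.map_waitOutcome_seq h
  have hs : ∀ᵐ ζ ∂Measure.infinitePi (fun _ : ℕ => (expMeasure 1).prod (P.map (erased 0))),
      ∃ n, (ζ n).2 = false := by
    rw [← hmap]
    refine (ae_map_iff hseq.aemeasurable ?_).2 ?_
    · simp only [Set.ofPred_exists]
      exact MeasurableSet.iUnion fun n =>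
        ((measurable_pi_apply n).snd : Measurable fun ζ : ℕ → ℝ × Bool => (ζ n).2)
          (measurableSet_singleton false)
    · filter_upwards [h.ae_frequently_success hq1] with ω hω
      exact hω.exists
  obtain ⟨hpres, hind⟩ := iIndepFun_iterate measurable_afterSuccess (measurable_waitsEpoch γ)
    fun B C hB hC => waitsEpoch_inter_afterSuccess _ γ hs hB hC
  have hΨm : ∀ j, Measurable fun ζ => waitsEpoch γ (afterSuccess^[j] ζ) := fun j =>
    (measurable_waitsEpoch γ).comp (measurable_afterSuccess.iterate j)
  have hlaw : ∀ j, P.map (fun ω => waitsEpoch γ (afterSuccess^[j]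
      fun n => waitOutcome gap erased x n ω)) = (Measure.infinitePi fun _ : ℕ =>
        (expMeasure 1).prod (P.map (erased 0))).map (waitsEpoch γ) := fun j => by
    have h1 := Measure.map_map (hΨm j) hseq (μ := P)
    rw [hmap] at h1
    have h2 := Measure.map_map (measurable_waitsEpoch γ) (measurable_afterSuccess.iterate j)
      (μ := Measure.infinitePi fun _ : ℕ => (expMeasure 1).prod (P.map (erased 0)))
    rw [(hpres.iterate j).map_eq] at h2
    exact h1.symm.trans h2.symm
  refine ⟨Eventually.of_forall fun _ => rfl, fun j => ?_, ?_, fun j => ?_⟩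
  · filter_upwards [h.ae_isRegularPath, h.ae_frequently_success hq1] with ω h1 h2
    have := h1.epochLength_thresholdPolicy h2 hγ.le j
    refine hγ.trans_le ((le_thresholdRule γ _ _).trans this.symm.le)
  · have hi : iIndepFun (fun j ω => waitsEpoch γ (afterSuccess^[j]
        fun n => waitOutcome gap erased x n ω)) P := by
      rw [← hmap] at hind
      exact iIndepFun_comp_of_map hΨm hseq hind
    exact hi.congr fun j => (hlen j).symm
  · have haem : ∀ j, AEMeasurable (epochLength erased x j) P := fun j =>
      ((hΨm j).comp hseq).aemeasurable.congr (hlen j).symm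
    have hmaplen : ∀ j, P.map (epochLength erased x j) = (Measure.infinitePi fun _ : ℕ =>
        (expMeasure 1).prod (P.map (erased 0))).map (waitsEpoch γ) := fun j =>
      (Measure.map_congr (hlen j)).trans (hlaw j)
    have h0 : (fun ω => successTime erased x 1 ω - successTime erased x 0 ω) =
      epochLength erased x 0 := rfl
    exact ⟨haem j, haem 0, (hmaplen j).trans (hmaplen 0).symm⟩

lemma isRenewalPolicy_thresholdPolicy (h : IsEnvironment P q gap erased) (hq1 : q < 1)
    (hγ : 0 < γ) : IsRenewalPolicy P gap erased (thresholdPolicy gap erased γ) where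
  same_rule := by
    refine ⟨thresholdRule γ, measurable_thresholdRule γ, fun j i => ?_⟩
    filter_upwards [h.ae_isRegularPath, h.ae_frequently_success hq1] with ω h1 h2 hi
    rw [firstSuccess_epoch h2] at hi
    exact h1.thresholdPolicy_sub h2 hγ.le j (by omega)
  renewal := isRenewalProcess_thresholdPolicy h hq1 hγ

end Renewal

/-! ### The second moment of an epoch -/

section Moment

variable {gap : ℕ → Ω → ℝ} {erased : ℕ → Ω → Bool} {γ : ℝ}

/-- Cauchy-Schwarz with the geometric weights `r ^ i`. -/
lemma sq_waitsEpoch_le {ζ : ℕ → ℝ × Bool} (hγ : 0 ≤ γ) (hζ : ∀ i, 0 ≤ (ζ i).1) {r : ℝ} (hr0 : 0 < r)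
    (hr1 : r < 1) : waitsEpoch γ ζ ^ 2 ≤ 2 * γ ^ 2 + 2 / (1 - r) *
      ∑ i ∈ Finset.range ((firstSuccess fun i => (ζ i).2) + 1), (ζ i).1 ^ 2 / r ^ i := by
  set k := firstSuccess fun i => (ζ i).2
  have h1 : waitsEpoch γ ζ ≤ γ + ∑ i ∈ Finset.range (k + 1), (ζ i).1 := by
    rw [Finset.sum_range_succ', waitsEpoch]
    have : max (ζ 0).1 γ ≤ γ + (ζ 0).1 := max_le (by linarith) (by linarith [hζ 0])
    linarith
  have h0 : 0 ≤ waitsEpoch γ ζ :=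
    add_nonneg ((hζ 0).trans (le_max_left _ _)) (Finset.sum_nonneg fun i _ => hζ (i + 1))
  have hcs := Finset.sq_sum_div_le_sum_sq_div (Finset.range (k + 1)) (fun i => (ζ i).1)
    (g := fun i => r ^ i) fun i _ => pow_pos hr0 i
  have hgeom : ∑ i ∈ Finset.range (k + 1), r ^ i ≤ 1 / (1 - r) := by
    rw [le_div_iff₀ (by linarith), geom_sum_mul_neg]
    linarith [pow_pos hr0 (k + 1)]
  have hsum : 0 < ∑ i ∈ Finset.range (k + 1), r ^ i :=
    Finset.sum_pos (fun i _ => pow_pos hr0 i) ⟨0, by simp⟩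
  have hsq : 0 ≤ ∑ i ∈ Finset.range (k + 1), (ζ i).1 ^ 2 / r ^ i :=
    Finset.sum_nonneg fun i _ => by positivity
  rw [div_le_iff₀ hsum] at hcs
  calc waitsEpoch γ ζ ^ 2 ≤ (γ + ∑ i ∈ Finset.range (k + 1), (ζ i).1) ^ 2 :=
        pow_le_pow_left₀ h0 h1 2
    _ ≤ 2 * γ ^ 2 + 2 * (∑ i ∈ Finset.range (k + 1), (ζ i).1) ^ 2 := by
        linarith [add_sq_le (a := γ) (b := ∑ i ∈ Finset.range (k + 1), (ζ i).1)]
    _ ≤ 2 * γ ^ 2 + 2 * ((∑ i ∈ Finset.range (k + 1), (ζ i).1 ^ 2 / r ^ i) * (1 / (1 - r))) := by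
        linarith [mul_le_mul_of_nonneg_left hgeom hsq]
    _ = _ := by ring

variable {P : Measure Ω} [IsProbabilityMeasure P] {q : ℝ} {x : ℕ → Ω → ℝ}

lemma IsEnvironment.measure_forall_erased (h : IsEnvironment P q gap erased) (i : ℕ) :
    P {ω | ∀ l < i, erased l ω = true} = ENNReal.ofReal q ^ i := by
  have key := (iIndepFun_iff_measure_inter_preimage_eq_mul.1 h.indep_erased) (Finset.range i)
    (sets := fun _ => {true}) fun _ _ => measurableSet_singleton _
  have hset : {ω | ∀ l < i, erased l ω = true} =
      ⋂ l ∈ Finset.range i, erased l ⁻¹' {true} := by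
    ext ω; simp
  have hprob : ∀ l, P (erased l ⁻¹' {true}) = ENNReal.ofReal q := h.prob_erased
  rw [hset, key, Finset.prod_congr rfl fun l _ => hprob l, Finset.prod_const, Finset.card_range]

/-- The wait for energy before attempt `i` is independent of the event that no earlier attempt was
successful. -/
lemma IsPolicy.lintegral_sq_waitingTime_of_erased (hx : IsPolicy P gap erased x)
    (h : IsEnvironment P q gap erased) (i : ℕ) :
    ∫⁻ ω in {ω | ∀ l < i, erased l ω = true},
        ENNReal.ofReal (waitingTime gap (stageStart x i) ω ^ 2) ∂P =
      ENNReal.ofReal q ^ i * ∫⁻ s, ENNReal.ofReal (s ^ 2) ∂expMeasure 1 := by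
  have hpm := hx.measurable_stageStart i
  have hw := measurable_waitingTime h.measurable_gap hpm
  have hon := hx.isOnlineTime_stageStart i
  have hp0 := hx.ae_stageStart_nonneg h i
  have hset : {ω | ∀ l < i, erased l ω = true} = ⋂ l : Fin i, {ω | erased l ω = true} := by
    ext ω
    simp only [Set.mem_ofPred_eq, Set.mem_iInter]
    exact ⟨fun h l => h l l.2, fun h l hl => h ⟨l, hl⟩⟩
  have hA : MeasurableSet[hon.past] {ω | ∀ l < i, erased l ω = true} := by
    rw [hset]
    exact MeasurableSet.iInter fun l => hon.measurable_erased l (measurableSet_singleton true)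
  have hmap : (P.restrict {ω | ∀ l < i, erased l ω = true}).map (waitingTime gap (stageStart x i)) =
      ENNReal.ofReal q ^ i • expMeasure 1 := by
    ext B hB
    rw [Measure.map_apply hw hB, Measure.restrict_apply (hw hB), Set.inter_comm,
      hon.measure_inter_preimage_waitingTime h hpm hp0 hA hB, h.measure_forall_erased]
    rfl
  rw [← lintegral_map (f := fun s : ℝ => ENNReal.ofReal (s ^ 2)) (by fun_prop) hw, hmap,
    lintegral_smul_measure, smul_eq_mul]

lemma IsPolicy.lintegral_sq_waitsEpoch_lt_top (hx : IsPolicy P gap erased x)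
    (h : IsEnvironment P q gap erased) (hq0 : 0 < q) (hq1 : q < 1) (hγ : 0 ≤ γ) :
    ∫⁻ ω, ENNReal.ofReal (waitsEpoch γ (fun n => waitOutcome gap erased x n ω) ^ 2) ∂P < ⊤ := by
  -- With these weights term `i` of the weighted sum has mean at most a multiple of `q ^ i / r ^ i`,
  -- which is `r ^ i`.
  set r := √q with hr
  have hr0 : 0 < r := Real.sqrt_pos.2 hq0
  have hr1 : r < 1 := by rw [hr, Real.sqrt_lt' one_pos]; simpa using hq1
  have hrr : r * r = q := Real.mul_self_sqrt hq0.le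
  have hM : ∫⁻ s, ENNReal.ofReal (s ^ 2) ∂expMeasure 1 < ⊤ :=
    (hasFiniteIntegral_iff_ofReal (Eventually.of_forall fun _ => sq_nonneg _)).1
      integrable_sq_expMeasure_one.2
  set M := ∫⁻ s, ENNReal.ofReal (s ^ 2) ∂expMeasure 1
  let A : ℕ → Set Ω := fun i => {ω | ∀ l < i, erased l ω = true}
  have hA : ∀ i, MeasurableSet (A i) := fun i => by
    have heq : A i = ⋂ l : Fin i, {ω | erased l ω = true} := by
      ext ω
      simp only [A, Set.mem_ofPred_eq, Set.mem_iInter]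
      exact ⟨fun h l => h l l.2, fun h l hl => h ⟨l, hl⟩⟩
    rw [heq]
    exact MeasurableSet.iInter fun l => measurableSet_erased h.measurable_erased l
  have hwm : ∀ i, Measurable fun ω => ENNReal.ofReal (waitingTime gap (stageStart x i) ω ^ 2) :=
    fun i => ((measurable_waitingTime h.measurable_gap
      (hx.measurable_stageStart i)).pow_const 2).ennreal_ofReal
  let F : ℕ → Ω → ENNReal := fun i ω => ENNReal.ofReal (r ^ i)⁻¹ *
    (A i).indicator (fun ω => ENNReal.ofReal (waitingTime gap (stageStart x i) ω ^ 2)) ω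
  have hFm : ∀ i, Measurable (F i) := fun i => ((hwm i).indicator (hA i)).const_mul _
  have hF : ∀ i, ∫⁻ ω, F i ω ∂P = ENNReal.ofReal r ^ i * M := fun i => by
    rw [lintegral_const_mul _ ((hwm i).indicator (hA i)), lintegral_indicator (hA i),
      hx.lintegral_sq_waitingTime_of_erased h i, ← mul_assoc, ← ENNReal.ofReal_pow hq0.le,
      ← ENNReal.ofReal_mul (by positivity), ← ENNReal.ofReal_pow hr0.le]
    congr 2
    rw [← hrr, mul_pow]
    field_simp
  have hbound : ∀ᵐ ω ∂P, ENNReal.ofReal (waitsEpoch γ (fun n => waitOutcome gap erased x n ω) ^ 2) ≤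
      ENNReal.ofReal (2 * γ ^ 2) + ENNReal.ofReal (2 / (1 - r)) * ∑' i, F i ω := by
    filter_upwards [hx.ae_isFeasiblePath h, h.ae_frequently_success hq1] with ω h1 h2
    have hζ : ∀ i, 0 ≤ (waitOutcome gap erased x i ω).1 := fun i =>
      (sub_pos.2 (h1.regular.lt_nextArrival _)).le
    have hc : 0 ≤ 2 / (1 - r) := div_nonneg zero_le_two (by linarith)
    refine (ENNReal.ofReal_le_ofReal (sq_waitsEpoch_le hγ hζ hr0 hr1)).trans ?_
    rw [ENNReal.ofReal_add (by positivity)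
      (mul_nonneg hc (Finset.sum_nonneg fun i _ => by positivity)), ENNReal.ofReal_mul hc,
      ENNReal.ofReal_sum_of_nonneg fun i _ => by positivity]
    refine add_le_add le_rfl (mul_le_mul' le_rfl ((Finset.sum_le_sum fun i hi => ?_).trans
      (ENNReal.sum_le_tsum (Finset.range ((firstSuccess fun i => erased i ω) + 1)))))
    have hi : ω ∈ A i := fun l hl => ((firstSuccess_eq_iff (e := fun i => erased i ω) h2.exists).1
      rfl).2 l (hl.trans_le (Nat.lt_succ_iff.1 (Finset.mem_range.1 hi)))
    simp only [F, Set.indicator_of_mem hi]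
    rw [← ENNReal.ofReal_mul (by positivity), div_eq_inv_mul]
    rfl
  refine (lintegral_mono_ae hbound).trans_lt ?_
  rw [lintegral_add_left measurable_const, lintegral_const, measure_univ, mul_one,
    lintegral_const_mul _ (Measurable.tsum hFm),
    lintegral_tsum fun i => (hFm i).aemeasurable, tsum_congr hF, ENNReal.tsum_mul_right,
    ENNReal.tsum_geometric]
  have hr1' : 1 - ENNReal.ofReal r ≠ 0 := by
    rw [Ne, tsub_eq_zero_iff_le, not_le]
    exact ENNReal.ofReal_lt_one.2 hr1
  exact ENNReal.add_lt_top.2 ⟨ENNReal.ofReal_lt_top, ENNReal.mul_lt_top ENNReal.ofReal_lt_top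
    (ENNReal.mul_lt_top (ENNReal.inv_lt_top.2 (pos_iff_ne_zero.2 hr1')) hM)⟩

end Moment

lemma isUniformlyBounded_thresholdPolicy {gap : ℕ → Ω → ℝ} {erased : ℕ → Ω → Bool} {γ : ℝ}
    {P : Measure Ω} [IsProbabilityMeasure P] {q : ℝ} (h : IsEnvironment P q gap erased)
    (hq0 : 0 < q) (hq1 : q < 1) (hγ : 0 ≤ γ) :
    IsUniformlyBounded P gap erased (thresholdPolicy gap erased γ) := by
  have hlen : ∀ j, ∀ᵐ ω ∂P, epochLength erased (thresholdPolicy gap erased γ) j ω =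
      thresholdEpoch γ (epochEnvironment gap erased (thresholdPolicy gap erased γ) j ω) := by
    intro j
    filter_upwards [h.ae_isRegularPath, h.ae_frequently_success hq1] with ω h1 h2
    exact h1.epochLength_thresholdPolicy h2 hγ j
  refine ⟨thresholdEpoch γ, measurable_thresholdEpoch γ, ?_,
    fun j => (hlen j).mono fun _ => le_of_eq⟩
  have hgm : Measurable fun ω => thresholdEpoch γ (fun k => gap k ω, fun n => erased n ω) :=
    (measurable_thresholdEpoch γ).comp ((measurable_pi_iff.2 h.measurable_gap).prodMk
      (measurable_pi_iff.2 h.measurable_erased))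
  rw [memLp_two_iff_integrable_sq hgm.aestronglyMeasurable]
  refine ⟨(hgm.pow_const 2).aestronglyMeasurable, ?_⟩
  rw [hasFiniteIntegral_iff_ofReal (Eventually.of_forall fun _ => sq_nonneg _)]
  refine lt_of_eq_of_lt (lintegral_congr_ae ?_) ((isPolicy_thresholdPolicy (erased := erased) h
    hγ).lintegral_sq_waitsEpoch_lt_top h hq0 hq1 hγ)
  filter_upwards [h.ae_isRegularPath, h.ae_frequently_success hq1] with ω h1 h2
  have hlen := h1.epochLength_thresholdPolicy h2 hγ 0
  rw [h1.epochLength_eq_waitsEpoch h2 0] at hlen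
  have henv : epochEnvironment gap erased (thresholdPolicy gap erased γ) 0 ω =
      (fun k => gap k ω, fun n => erased n ω) := by
    refine Prod.ext ?_ ?_
    · exact h1.gapsAfter_zero
    · simp [epochEnvironment, firstAttempt]
  rw [henv] at hlen
  rw [← hlen]
  rfl

end StatusUpdate

end

theorem theorem1 {Ω : Type*} [MeasurableSpace Ω] (P : MeasureTheory.Measure Ω)
    [MeasureTheory.IsProbabilityMeasure P] (q : ℝ) (hq0 : 0 < q) (hq1 : q < 1)
    (gap : ℕ → Ω → ℝ) (erased : ℕ → Ω → Bool)
    (henv : StatusUpdate.IsEnvironment P q gap erased) :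
    ∃ x : ℕ → Ω → ℝ,
      StatusUpdate.IsPolicy P gap erased x ∧
      StatusUpdate.IsUniformlyBounded P gap erased x ∧
      StatusUpdate.IsRenewalPolicy P gap erased x ∧
      ∀ x' : ℕ → Ω → ℝ,
        StatusUpdate.IsPolicy P gap erased x' →
        StatusUpdate.IsUniformlyBounded P gap erased x' →
        StatusUpdate.averageAge P erased x ≤ StatusUpdate.averageAge P erased x' := by
  obtain ⟨γ, hγ⟩ := StatusUpdate.exists_isThreshold hq0 hq1
  have hx := StatusUpdate.isPolicy_thresholdPolicy (erased := erased) henv hγ.pos.le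
  refine ⟨_, hx, StatusUpdate.isUniformlyBounded_thresholdPolicy henv hq0 hq1 hγ.pos.le,
    StatusUpdate.isRenewalPolicy_thresholdPolicy henv hq1 hγ.pos, fun x' hx' _ => ?_⟩
  refine (hx.averageAge_le henv hq0 hq1 hγ (Eventually.of_forall fun ω n => ?_)).trans
    (hx'.le_averageAge henv hq0 hq1 hγ)
  exact StatusUpdate.thresholdPolicy_eq n ω
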